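/- Let $\ell_0>0$, $0<c<1$, and for $0<\ell<\ell_0$ let $$P^{\pm}_{\ell,k}=-(\tau^2+\ell^2)\frac{d^2}{d\tau^2}-2\tau\frac{d}{d\tau}+1+\frac{(\tau\pm k)^2}{\tau^2+\ell^2}$$ be the operators on the $k$-th Fourier mode on the hyperbolic cylinder $\bigl([-1,1]_\tau\times S^1_\theta,\ \frac{d\tau^2}{\tau^2+\ell^2}+(\tau^2+\ell^2)\,d\theta^2\bigr)$. Functions in the zero Fourier mode do not depend on $\theta$, and for them let $\widehat{\mathcal C}$ denote the blowup of $[-1,1]_\tau\times[0,\ell_0)_\ell$ at the point $\ell=\tau=0$. Its front face is $\{\rho=0\}$ in polar coordinates $\ell=\rho\sin\chi$, $\tau=\rho\cos\chi$, $\chi\in[0,\pi]$; its two side faces are the lifts of $\{\ell=0,\ \pm\tau>0\}$, near which $s=\ell/|\tau|$, $t=|\tau|$ are coordinates. An index set is a set $E\subset\mathbb C\times\mathbb N_0$ with finitely many elements in each half plane $\operatorname{Re}z\le C$, and such that $(z,p)\in E$ implies $(z+1,p)\in E$ and $(z,q)\in E$ for $q\le p$. A complex-valued function on $\{0<\ell<\ell_0,\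 |\tau|\le1\}$ is called polyhomogeneous on $\widehat{\mathcal C}$ if it is smooth there (up to $\tau=\pm1$) and if there are index sets, one for each of the three faces, such that at each face, with defining function $x$ ($x=\rho$ at the front face, $x=s$ at the side faces) and with coordinate $y$ along the face ($y=\chi$, respectively $y=t$), it has an asymptotic expansion $\sum_{(z,p)\in E}x^z(\log x)^p\,a_{z,p}(y)$. Here the $a_{z,p}$ are smooth on the interior of the face (for side faces up to $t=1$) and polyhomogeneous at its corners, with the index sets of the adjacent faces. For every $N$ the difference of the function and the sum of the terms with $\operatorname{Re}z\le N$, together with all its derivatives under $x\partial_x$ and $r(y)\partial_y$, is $O(x^N r(y)^{-M})$ as $x\searrow0$, uniformly along the face, with $M$ independent of $N$ and of the number of derivatives, where $r=\sin\chi$ on the front face and $r=t$ on the side faces. A function $\eta$ of $\ell\in(0,\ell_0)$ is polyhomogeneous in $\ell$ if it is smooth and, for some index set $E$, $\eta\sim\sum_{(z,p)\in E}c_{z,p}\,\ell^z(\log\ell)^p$ as $\ell\searrow0$, again together with all derivatives under $\ell\partial_\ell$. Suppose that $h=h(\ell,\tau)$ is polyhomogeneous on $\widehat{\mathcal C}$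 and vanishes for $|\tau|\le c$, and that $\eta^+,\eta^-$ are polyhomogeneous in $\ell$. Then for each of the two signs $\pm$ and each $\ell\in(0,\ell_0)$ the problem $$P^{\pm}_{\ell,0}\,\omega=h(\ell,\cdot)\ \text{ on }(-1,1),\qquad \omega(1)=\eta^+(\ell),\quad \omega(-1)=\eta^-(\ell),$$ has a unique solution $\omega(\ell,\cdot)\in C^0([-1,1])\cap C^2((-1,1))$, and the family $\omega(\ell,\tau)$ lifts to a polyhomogeneous function on $\widehat{\mathcal C}$. -/

import Mathlib

open Set
open scoped ContDiff

noncomputable section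

/-- A (smooth) index set: a set of pairs `(z, p)`, standing for the terms `x ^ z * (log x) ^ p`,
with finitely many members in each half plane `Re z ≤ C`, closed under lowering the power of the
logarithm and under `z ↦ z + 1`. -/
structure IndexSet where
  carrier : Set (ℂ × ℕ)
  finite_le : ∀ C : ℝ, {q ∈ carrier | q.1.re ≤ C}.Finite
  lower_log : ∀ (z : ℂ) (p q : ℕ), (z, p) ∈ carrier → q ≤ p → (z, q) ∈ carrier
  add_one : ∀ (z : ℂ) (p : ℕ), (z, p) ∈ carrier → (z + 1, p) ∈ carrier

/-- The members of an index set with `Re z ≤ N`. -/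
def IndexSet.upTo (E : IndexSet) (N : ℕ) : Finset (ℂ × ℕ) := (E.finite_le N).toFinset

/-- The model term `x ^ z * (log x) ^ p` (used for `x > 0`). -/
def phgTerm (q : ℂ × ℕ) (x : ℝ) : ℂ := (x : ℂ) ^ q.1 * (Real.log x : ℂ) ^ q.2

/-- The vector field `r(x) d/dx` on functions of one variable. -/
def bDeriv (r : ℝ → ℝ) (g : ℝ → ℂ) : ℝ → ℂ := fun x => (r x : ℂ) * deriv g x

/-- The vector field `x ∂/∂x` acting on functions of `(x, y)`. -/
def bDerivNormal (F : ℝ → ℝ → ℂ) : ℝ → ℝ → ℂ :=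
  fun x y => bDeriv id (fun x₁ => F x₁ y) x

/-- The vector field `r(y) ∂/∂y` acting on functions of `(x, y)`. -/
def bDerivTangent (r : ℝ → ℝ) (F : ℝ → ℝ → ℂ) : ℝ → ℝ → ℂ :=
  fun x y => bDeriv r (F x) y

/-- `g(x)` has, as `x ↘ 0`, an asymptotic expansion `∑ c_{z,p} x ^ z (log x) ^ p` over the index set
`E`, which stays valid after any number of differentiations. -/
def HasPhgExpansionAtZero (E : IndexSet) (g : ℝ → ℂ) : Prop :=
  ∃ c : ℂ × ℕ → ℂ, ∀ N i : ℕ, ∃ C δ : ℝ, 0 < δ ∧ ∀ x ∈ Ioo 0 δ,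
    ‖((bDeriv id)^[i] (fun x => g x - ∑ q ∈ E.upTo N, phgTerm q x * c q)) x‖ ≤ C * x ^ N

/-- `F(x, y)` has an asymptotic expansion `∑ x ^ z (log x) ^ p a_{z,p}(y)` over the index set `E` at
the boundary face `{x = 0}`, whose interior is parametrized by `y ∈ I`. The coefficients belong to
the class `A` of functions on the face. The function `r` on `I` is a defining function of the ends
of the face at which it meets other boundary faces. The expansion stays valid after application of
any number of the vector fields `x ∂/∂x` and `r ∂/∂y`; the remainders are `O(x ^ N)`, up to a fixed
power `r ^ (-M)`, uniformly along the face. -/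
def HasPhgExpansionAtFace (E : IndexSet) (I : Set ℝ) (r : ℝ → ℝ) (A : Set (ℝ → ℂ))
    (F : ℝ → ℝ → ℂ) : Prop :=
  ∃ a : ℂ × ℕ → ℝ → ℂ, (∀ q ∈ E.carrier, a q ∈ A) ∧
    ∃ M : ℕ, ∀ N i j : ℕ, ∃ C δ : ℝ, 0 < δ ∧ ∀ x ∈ Ioo 0 δ, ∀ y ∈ I,
      ‖(bDerivNormal^[i] ((bDerivTangent r)^[j]
          (fun x y => F x y - ∑ q ∈ E.upTo N, phgTerm q x * a q y))) x y‖
        ≤ C * x ^ N * (r y ^ M)⁻¹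

/-- Polyhomogeneous functions on a side face of the blowup, parametrized by `t = |τ| ∈ (0, 1]`: they
are smooth up to `t = 1` and have an expansion over `E` at the corner `t = 0`. -/
def sideFacePhg (E : IndexSet) : Set (ℝ → ℂ) :=
  {a | ContDiffOn ℝ ∞ a (Ioc 0 1) ∧ HasPhgExpansionAtZero E a}

/-- Polyhomogeneous functions on the front face of the blowup, parametrized by the angle
`χ ∈ (0, π)`, with expansions over `E₁` at the corner `χ = 0` and over `E₂` at the corner
`χ = π`. -/
def frontFacePhg (E₁ E₂ : IndexSet) : Set (ℝ → ℂ) :=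
  {b | ContDiffOn ℝ ∞ b (Ioo 0 Real.pi) ∧ HasPhgExpansionAtZero E₁ b ∧
    HasPhgExpansionAtZero E₂ (fun x => b (Real.pi - x))}

/-- The function `f(ℓ, τ)`, `0 < ℓ < ℓ₀`, `|τ| ≤ 1`, lifts to a polyhomogeneous function on the
blowup of `[-1, 1]_τ × [0, ℓ₀)_ℓ` at `ℓ = τ = 0` (smooth up to `τ = ±1`). The front face `{ρ = 0}`
is described in the polar coordinates `ℓ = ρ sin χ`, `τ = ρ cos χ`, and the two side faces
(the lifts of `ℓ = 0` with `τ > 0`, respectively `τ < 0`) in the projective coordinates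
`s = ℓ / |τ|`, `t = |τ|`, in which the side face is `{s = 0}` and the front face `{t = 0}`. -/
def IsPolyhomogeneousOnBlowup (ℓ₀ : ℝ) (f : ℝ → ℝ → ℂ) : Prop :=
  ContDiffOn ℝ ∞ (fun x : ℝ × ℝ => f x.1 x.2) (Ioo 0 ℓ₀ ×ˢ Icc (-1) 1) ∧
  ∃ Efront Eplus Eminus : IndexSet,
    HasPhgExpansionAtFace Efront (Ioo 0 Real.pi) Real.sin (frontFacePhg Eplus Eminus)
      (fun ρ χ => f (ρ * Real.sin χ) (ρ * Real.cos χ)) ∧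
    HasPhgExpansionAtFace Eplus (Ioo 0 1) id (sideFacePhg Efront) (fun s t => f (s * t) t) ∧
    HasPhgExpansionAtFace Eminus (Ioo 0 1) id (sideFacePhg Efront) (fun s t => f (s * t) (-t))

/-- A function of `ℓ ∈ (0, ℓ₀)` alone that is polyhomogeneous at `ℓ = 0`. -/
def IsPolyhomogeneousInLength (ℓ₀ : ℝ) (η : ℝ → ℂ) : Prop :=
  ContDiffOn ℝ ∞ η (Ioo 0 ℓ₀) ∧ ∃ E : IndexSet, HasPhgExpansionAtZero E η

/-- The operator on the `k`-th Fourier mode on the hyperbolic cylinder,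
`-(τ² + ℓ²) d²/dτ² - 2τ d/dτ + 1 + (τ ± k)² / (τ² + ℓ²)`, where `ε` is the sign `±`. -/
def cylinderOp (ε : ℤˣ) (ℓ : ℝ) (k : ℤ) (w : ℝ → ℂ) (τ : ℝ) : ℂ :=
  -((τ ^ 2 + ℓ ^ 2 : ℝ) : ℂ) * iteratedDeriv 2 w τ - ((2 * τ : ℝ) : ℂ) * deriv w τ +
    ((1 + (τ + ((ε : ℤ) : ℝ) * (k : ℝ)) ^ 2 / (τ ^ 2 + ℓ ^ 2) : ℝ) : ℂ) * w τ

/-- `w` is a classical solution on `[-1, 1]` of the Dirichlet problem for the `k`-th Fourier mode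
with right hand side `h` and boundary values `w(1) = ηp`, `w(-1) = ηm`. -/
structure IsDirichletSolution (ε : ℤˣ) (ℓ : ℝ) (k : ℤ) (h : ℝ → ℂ) (ηp ηm : ℂ)
    (w : ℝ → ℂ) : Prop where
  continuousOn : ContinuousOn w (Icc (-1) 1)
  contDiffOn : ContDiffOn ℝ 2 w (Ioo (-1) 1)
  equation : ∀ τ ∈ Ioo (-1 : ℝ) 1, cylinderOp ε ℓ k w τ = h τ
  right_value : w 1 = ηp
  left_value : w (-1) = ηm

end

/-! ### Functions near a boundary face -/

open Filter Topology

/-! In the zero mode the sign drops out and the equation can be solved by quadrature. Write `R =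
√(τ² + ℓ²)`. Then `R` solves the homogeneous equation, and substituting `ω = R * Y` turns the
operator into `-R⁻¹ (R⁴ Y')'` (`cylinderOp_rad_mul`). The kernel is therefore spanned by `R` and `R
* angle`, where `angle' = 2ℓ³ / R⁴`, and `-R ∫ R⁻⁴ ∫ R h` is a particular solution. Matching the
boundary values gives explicit coefficients `evenCoeff` and `oddCoeff` depending on `ℓ` only.
Uniqueness is the maximum principle, the zeroth order coefficient being positive.

The particular solution with base point `0` vanishes for `|τ| ≤ c`, like `h`. It thus lives away
from the front face, where `ℓ` and `s = ℓ / |τ|` differ by a smooth positive factor. There an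
expansion in `ℓ` with coefficients smooth in `τ` may be integrated term by term
(`HasExp.primitive`), and the result extends by zero to the whole side face (`HasExp.extend`). Its
value at `τ = ±1` is polyhomogeneous in `ℓ`, hence so are the two coefficients: `angle ℓ 1` is
analytic up to `ℓ = 0` with the nonzero limit `π / 2`.

It remains to lift the homogeneous solutions. At the front face `R = ρ`, `angle = π / 2 - χ + sin χ
cos χ` and `ℓ = ρ sin χ`; at the side `τ > 0`, `R = t √(1 + s²)`, `angle` is analytic in `s`, and `ℓ
= s t`. A term `ℓ ^ z (log ℓ) ^ p` becomes by the binomial formula a sum of products of like terms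
in the two factors, so one index set serves all three faces. The side `τ < 0` follows by reflection.

The bookkeeping uses `Conormal` (weighted bounds stable under the vector fields tangent to the
boundary) and `HasExp`, a flexible form of expansion closed under sums, products and rescalings `x ↦
x * m y`. Only at the end are terms with equal exponents collected (`HasExp.hasPhgExpansionAtFace`).
-/

/-- Equality of functions of `(x, y)`, `y ∈ I`, for all sufficiently small `x > 0`. -/
def EqNear (I : Set ℝ) (F G : ℝ → ℝ → ℂ) : Prop := ∀ᶠ x in 𝓝[>] (0 : ℝ), ∀ y ∈ I, F x y = G x y

/-- Joint smoothness for `y ∈ I` and all sufficiently small `x > 0`. -/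
def SmoothNear (I : Set ℝ) (F : ℝ → ℝ → ℂ) : Prop :=
  ∃ δ : ℝ, 0 < δ ∧ ContDiffOn ℝ ∞ (fun p : ℝ × ℝ => F p.1 p.2) (Ioo 0 δ ×ˢ I)

/-- A bound by a multiple of the weight `w` for all sufficiently small `x > 0`. -/
def BoundNear (I : Set ℝ) (w : ℝ → ℝ → ℝ) (F : ℝ → ℝ → ℂ) : Prop :=
  ∃ C : ℝ, ∀ᶠ x in 𝓝[>] (0 : ℝ), ∀ y ∈ I, ‖F x y‖ ≤ C * w x y

/-- Smooth functions near `x = 0` that satisfy, together with all derivatives under `x ∂/∂x` and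
`r ∂/∂y`, bounds by multiples of the weight `w`. -/
def Conormal (I : Set ℝ) (r : ℝ → ℝ) (w : ℝ → ℝ → ℝ) (F : ℝ → ℝ → ℂ) : Prop :=
  SmoothNear I F ∧ ∀ i j : ℕ, BoundNear I w (bDerivNormal^[i] ((bDerivTangent r)^[j] F))

theorem eventually_Ioo_iff {p : ℝ → Prop} :
    (∀ᶠ x in 𝓝[>] (0 : ℝ), p x) ↔ ∃ δ : ℝ, 0 < δ ∧ ∀ x ∈ Ioo 0 δ, p x := by
  change {x | p x} ∈ 𝓝[>] (0 : ℝ) ↔ _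
  rw [mem_nhdsGT_iff_exists_Ioo_subset]
  rfl

/-- The closure of a class of functions under sums and equality near `x = 0`. -/
inductive AddClosureNear (I : Set ℝ) (P : (ℝ → ℝ → ℂ) → Prop) : (ℝ → ℝ → ℂ) → Prop
  | base {F : ℝ → ℝ → ℂ} : P F → AddClosureNear I P F
  | add {F G : ℝ → ℝ → ℂ} : AddClosureNear I P F → AddClosureNear I P G → AddClosureNear I P (F + G)
  | congr {F G : ℝ → ℝ → ℂ} : AddClosureNear I P F → EqNear I F G → AddClosureNear I P G

/-! ### Calculus of conormal functions -/

section Basic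

variable {I : Set ℝ} {r : ℝ → ℝ} {F G H : ℝ → ℝ → ℂ} {w w' : ℝ → ℝ → ℝ}

theorem EqNear.refl (I : Set ℝ) (F : ℝ → ℝ → ℂ) : EqNear I F F := .of_forall fun _ _ _ => rfl

theorem EqNear.symm (h : EqNear I F G) : EqNear I G F :=
  h.mono fun _ hx y hy => (hx y hy).symm

theorem EqNear.trans (h : EqNear I F G) (h' : EqNear I G H) : EqNear I F H := by
  filter_upwards [h, h'] with x hx hx' y hy using (hx y hy).trans (hx' y hy)

theorem EqNear.add {F' G' : ℝ → ℝ → ℂ} (h : EqNear I F G) (h' : EqNear I F' G') :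
    EqNear I (F + F') (G + G') := by
  filter_upwards [h, h'] with x hx hx' y hy
  simp only [Pi.add_apply, hx y hy, hx' y hy]

theorem EqNear.mul {F' G' : ℝ → ℝ → ℂ} (h : EqNear I F G) (h' : EqNear I F' G') :
    EqNear I (F * F') (G * G') := by
  filter_upwards [h, h'] with x hx hx' y hy
  simp only [Pi.mul_apply, hx y hy, hx' y hy]

theorem EqNear.normal (h : EqNear I F G) : EqNear I (bDerivNormal F) (bDerivNormal G) := by
  obtain ⟨δ, hδ, h⟩ := eventually_Ioo_iff.1 h
  refine eventually_Ioo_iff.2 ⟨δ, hδ, fun x hx y hy => ?_⟩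
  have : (fun x₁ => F x₁ y) =ᶠ[𝓝 x] fun x₁ => G x₁ y := by
    filter_upwards [isOpen_Ioo.mem_nhds hx] with x₁ hx₁ using h x₁ hx₁ y hy
  simp only [bDerivNormal, bDeriv, this.deriv_eq]

theorem EqNear.tangent (hI : IsOpen I) (h : EqNear I F G) :
    EqNear I (bDerivTangent r F) (bDerivTangent r G) := by
  filter_upwards [h] with x hx y hy
  have : F x =ᶠ[𝓝 y] G x := by
    filter_upwards [hI.mem_nhds hy] with y₁ hy₁ using hx y₁ hy₁
  simp only [bDerivTangent, bDeriv, this.deriv_eq]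

theorem EqNear.iterate (hI : IsOpen I) (h : EqNear I F G) (i j : ℕ) :
    EqNear I (bDerivNormal^[i] ((bDerivTangent r)^[j] F))
      (bDerivNormal^[i] ((bDerivTangent r)^[j] G)) := by
  have h1 : EqNear I ((bDerivTangent r)^[j] F) ((bDerivTangent r)^[j] G) := by
    induction j with
    | zero => exact h
    | succ j ih => simpa only [Function.iterate_succ_apply'] using ih.tangent hI
  induction i with
  | zero => exact h1
  | succ i ih => simpa only [Function.iterate_succ_apply'] using ih.normal

theorem BoundNear.congr (h : BoundNear I w F) (hFG : EqNear I F G) : BoundNear I w G := by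
  obtain ⟨C, hC⟩ := h
  refine ⟨C, ?_⟩
  filter_upwards [hC, hFG] with x hx hx' y hy
  rw [← hx' y hy]; exact hx y hy

theorem BoundNear.add (h : BoundNear I w F) (h' : BoundNear I w G) : BoundNear I w (F + G) := by
  obtain ⟨C, hC⟩ := h
  obtain ⟨C', hC'⟩ := h'
  refine ⟨C + C', ?_⟩
  filter_upwards [hC, hC'] with x hx hx' y hy
  rw [add_mul]
  exact (norm_add_le _ _).trans (add_le_add (hx y hy) (hx' y hy))

theorem BoundNear.mul (h : BoundNear I w F) (h' : BoundNear I w' G) :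
    BoundNear I (w * w') (F * G) := by
  obtain ⟨C, hC⟩ := h
  obtain ⟨C', hC'⟩ := h'
  refine ⟨C * C', ?_⟩
  filter_upwards [hC, hC'] with x hx hx' y hy
  have h1 := hx y hy
  have h2 := hx' y hy
  calc ‖F x y * G x y‖ = ‖F x y‖ * ‖G x y‖ := norm_mul _ _
    _ ≤ (C * w x y) * (C' * w' x y) :=
      mul_le_mul h1 h2 (norm_nonneg _) ((norm_nonneg _).trans h1)
    _ = C * C' * (w * w') x y := by simp only [Pi.mul_apply]; ring

/-- `w` is nonnegative and bounded by a multiple of `w'`. -/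
def WeightLE (I : Set ℝ) (w w' : ℝ → ℝ → ℝ) : Prop :=
  ∃ K : ℝ, ∀ᶠ x in 𝓝[>] (0 : ℝ), ∀ y ∈ I, 0 ≤ w x y ∧ w x y ≤ K * w' x y

theorem BoundNear.mono (h : BoundNear I w F) (hw : WeightLE I w w') : BoundNear I w' F := by
  obtain ⟨C, hC⟩ := h
  obtain ⟨K, hK⟩ := hw
  refine ⟨|C| * K, ?_⟩
  filter_upwards [hC, hK] with x hx hx' y hy
  calc ‖F x y‖ ≤ C * w x y := hx y hy
    _ ≤ |C| * w x y := mul_le_mul_of_nonneg_right (le_abs_self C) (hx' y hy).1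
    _ ≤ |C| * (K * w' x y) := mul_le_mul_of_nonneg_left (hx' y hy).2 (abs_nonneg C)
    _ = |C| * K * w' x y := by ring

theorem SmoothNear.congr (h : SmoothNear I F) (hFG : EqNear I F G) : SmoothNear I G := by
  obtain ⟨δ, hδ, h⟩ := h
  obtain ⟨δ', hδ', h'⟩ := eventually_Ioo_iff.1 hFG
  refine ⟨min δ δ', lt_min hδ hδ', ?_⟩
  refine (h.mono ?_).congr ?_
  · exact prod_mono (Ioo_subset_Ioo_right (min_le_left _ _)) le_rfl
  · rintro ⟨x, y⟩ ⟨hx, hy⟩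
    exact (h' x ⟨hx.1, hx.2.trans_le (min_le_right _ _)⟩ y hy).symm

theorem SmoothNear.both (h : SmoothNear I F) (h' : SmoothNear I G) : ∃ δ : ℝ, 0 < δ ∧
    ContDiffOn ℝ ∞ (fun p : ℝ × ℝ => F p.1 p.2) (Ioo 0 δ ×ˢ I) ∧
    ContDiffOn ℝ ∞ (fun p : ℝ × ℝ => G p.1 p.2) (Ioo 0 δ ×ˢ I) := by
  obtain ⟨δ, hδ, h⟩ := h
  obtain ⟨δ', hδ', h'⟩ := h'
  refine ⟨min δ δ', lt_min hδ hδ', h.mono ?_, h'.mono ?_⟩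
  · exact prod_mono (Ioo_subset_Ioo_right (min_le_left _ _)) le_rfl
  · exact prod_mono (Ioo_subset_Ioo_right (min_le_right _ _)) le_rfl

theorem SmoothNear.add (h : SmoothNear I F) (h' : SmoothNear I G) : SmoothNear I (F + G) := by
  obtain ⟨δ, hδ, h, h'⟩ := h.both h'
  exact ⟨δ, hδ, h.add h'⟩

theorem SmoothNear.mul (h : SmoothNear I F) (h' : SmoothNear I G) : SmoothNear I (F * G) := by
  obtain ⟨δ, hδ, h, h'⟩ := h.both h'
  exact ⟨δ, hδ, h.mul h'⟩

theorem hasDerivAt_fst_of_differentiableAt {F : ℝ → ℝ → ℂ} {x y : ℝ}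
    (h : DifferentiableAt ℝ (fun p : ℝ × ℝ => F p.1 p.2) (x, y)) :
    HasDerivAt (fun x₁ => F x₁ y) (fderiv ℝ (fun p : ℝ × ℝ => F p.1 p.2) (x, y) (1, 0)) x :=
  h.hasFDerivAt.comp_hasDerivAt (f := fun x₁ => (x₁, y)) x
    ((hasDerivAt_id x).prodMk (hasDerivAt_const x y))

theorem hasDerivAt_snd_of_differentiableAt {F : ℝ → ℝ → ℂ} {x y : ℝ}
    (h : DifferentiableAt ℝ (fun p : ℝ × ℝ => F p.1 p.2) (x, y)) :
    HasDerivAt (F x) (fderiv ℝ (fun p : ℝ × ℝ => F p.1 p.2) (x, y) (0, 1)) y :=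
  h.hasFDerivAt.comp_hasDerivAt y ((hasDerivAt_const y x).prodMk (hasDerivAt_id y))

theorem SmoothNear.differentiable (hI : IsOpen I) (h : SmoothNear I F) :
    ∀ᶠ x in 𝓝[>] (0 : ℝ), ∀ y ∈ I, DifferentiableAt ℝ (fun p : ℝ × ℝ => F p.1 p.2) (x, y) := by
  obtain ⟨δ, hδ, h⟩ := h
  refine eventually_Ioo_iff.2 ⟨δ, hδ, fun x hx y hy => ?_⟩
  exact (h.contDiffAt ((isOpen_Ioo.prod hI).mem_nhds ⟨hx, hy⟩)).differentiableAt (by simp)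

theorem SmoothNear.normal_eq (hI : IsOpen I) (h : SmoothNear I F) :
    EqNear I (bDerivNormal F) fun x y =>
      (x : ℂ) * fderiv ℝ (fun p : ℝ × ℝ => F p.1 p.2) (x, y) (1, 0) := by
  filter_upwards [h.differentiable hI] with x hx y hy
  simp only [bDerivNormal, bDeriv, id, (hasDerivAt_fst_of_differentiableAt (hx y hy)).deriv]

theorem SmoothNear.tangent_eq (hI : IsOpen I) (h : SmoothNear I F) :
    EqNear I (bDerivTangent r F) fun x y =>
      (r y : ℂ) * fderiv ℝ (fun p : ℝ × ℝ => F p.1 p.2) (x, y) (0, 1) := by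
  filter_upwards [h.differentiable hI] with x hx y hy
  simp only [bDerivTangent, bDeriv, (hasDerivAt_snd_of_differentiableAt (hx y hy)).deriv]

theorem SmoothNear.fderiv_apply (hI : IsOpen I) (h : SmoothNear I F) (v : ℝ × ℝ) :
    SmoothNear I fun x y => fderiv ℝ (fun p : ℝ × ℝ => F p.1 p.2) (x, y) v := by
  obtain ⟨δ, hδ, h⟩ := h
  exact ⟨δ, hδ, (h.fderiv_of_isOpen (isOpen_Ioo.prod hI) (by simp)).clm_apply contDiffOn_const⟩

theorem smoothNear_fst (I : Set ℝ) : SmoothNear I fun x _ => (x : ℂ) :=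
  ⟨1, one_pos, (Complex.ofRealCLM.contDiff.comp contDiff_fst).contDiffOn⟩

theorem smoothNear_snd {g : ℝ → ℂ} (hg : ContDiffOn ℝ ∞ g I) : SmoothNear I fun _ y => g y :=
  ⟨1, one_pos, hg.comp contDiffOn_snd fun _ hp => hp.2⟩

theorem SmoothNear.normal (hI : IsOpen I) (h : SmoothNear I F) : SmoothNear I (bDerivNormal F) :=
  ((smoothNear_fst I).mul (h.fderiv_apply hI (1, 0))).congr (h.normal_eq hI).symm

theorem SmoothNear.tangent (hI : IsOpen I) (hr : ContDiffOn ℝ ∞ r I) (h : SmoothNear I F) :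
    SmoothNear I (bDerivTangent r F) :=
  ((smoothNear_snd (Complex.ofRealCLM.contDiff.comp_contDiffOn hr)).mul
    (h.fderiv_apply hI (0, 1))).congr (h.tangent_eq hI).symm

theorem SmoothNear.normal_add (hI : IsOpen I) (h : SmoothNear I F) (h' : SmoothNear I G) :
    EqNear I (bDerivNormal (F + G)) (bDerivNormal F + bDerivNormal G) := by
  filter_upwards [h.differentiable hI, h'.differentiable hI] with x hx hx' y hy
  have := (hasDerivAt_fst_of_differentiableAt (hx y hy)).fun_add
    (hasDerivAt_fst_of_differentiableAt (hx' y hy))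
  simp only [bDerivNormal, bDeriv, Pi.add_apply, this.deriv,
    (hasDerivAt_fst_of_differentiableAt (hx y hy)).deriv,
    (hasDerivAt_fst_of_differentiableAt (hx' y hy)).deriv, mul_add]

theorem SmoothNear.tangent_add (hI : IsOpen I) (h : SmoothNear I F) (h' : SmoothNear I G) :
    EqNear I (bDerivTangent r (F + G)) (bDerivTangent r F + bDerivTangent r G) := by
  filter_upwards [h.differentiable hI, h'.differentiable hI] with x hx hx' y hy
  have := (hasDerivAt_snd_of_differentiableAt (hx y hy)).add
    (hasDerivAt_snd_of_differentiableAt (hx' y hy))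
  simp only [bDerivTangent, bDeriv, Pi.add_apply, this.deriv,
    (hasDerivAt_snd_of_differentiableAt (hx y hy)).deriv,
    (hasDerivAt_snd_of_differentiableAt (hx' y hy)).deriv, mul_add]

theorem SmoothNear.normal_mul (hI : IsOpen I) (h : SmoothNear I F) (h' : SmoothNear I G) :
    EqNear I (bDerivNormal (F * G)) (bDerivNormal F * G + F * bDerivNormal G) := by
  filter_upwards [h.differentiable hI, h'.differentiable hI] with x hx hx' y hy
  have := (hasDerivAt_fst_of_differentiableAt (hx y hy)).fun_mul
    (hasDerivAt_fst_of_differentiableAt (hx' y hy))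
  simp only [bDerivNormal, bDeriv, Pi.add_apply, Pi.mul_apply, this.deriv,
    (hasDerivAt_fst_of_differentiableAt (hx y hy)).deriv,
    (hasDerivAt_fst_of_differentiableAt (hx' y hy)).deriv]
  ring

theorem SmoothNear.tangent_mul (hI : IsOpen I) (h : SmoothNear I F) (h' : SmoothNear I G) :
    EqNear I (bDerivTangent r (F * G)) (bDerivTangent r F * G + F * bDerivTangent r G) := by
  filter_upwards [h.differentiable hI, h'.differentiable hI] with x hx hx' y hy
  have := (hasDerivAt_snd_of_differentiableAt (hx y hy)).mul
    (hasDerivAt_snd_of_differentiableAt (hx' y hy))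
  simp only [bDerivTangent, bDeriv, Pi.add_apply, Pi.mul_apply, this.deriv,
    (hasDerivAt_snd_of_differentiableAt (hx y hy)).deriv,
    (hasDerivAt_snd_of_differentiableAt (hx' y hy)).deriv]
  ring

theorem two_le_infty : (2 : WithTop ℕ∞) ≤ ∞ :=
  WithTop.coe_le_coe.2 (le_top : (2 : ℕ∞) ≤ ⊤)

/-- Second derivatives are symmetric, and each of the coefficients `x` and `r y` is constant along
the other vector field. -/
theorem SmoothNear.normal_tangent (hI : IsOpen I) (h : SmoothNear I F) :
    EqNear I (bDerivNormal (bDerivTangent r F)) (bDerivTangent r (bDerivNormal F)) := by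
  have h1 := (h.fderiv_apply hI (1, 0)).differentiable hI
  have h2 := (h.fderiv_apply hI (0, 1)).differentiable hI
  refine (h.tangent_eq hI).normal.trans (EqNear.trans ?_ ((h.normal_eq hI).tangent hI).symm)
  obtain ⟨δ, hδ, h⟩ := h
  filter_upwards [h1, h2, eventually_Ioo_iff.2 ⟨δ, hδ, fun _ => id⟩] with x hx1 hx2 hx y hy
  have hc := h.contDiffAt ((isOpen_Ioo.prod hI).mem_nhds (show (x, y) ∈ _ from ⟨hx, hy⟩))
  have hd : DifferentiableAt ℝ (fderiv ℝ fun p : ℝ × ℝ => F p.1 p.2) (x, y) :=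
    (hc.fderiv_right (m := 1) (by simpa only [one_add_one_eq_two] using two_le_infty)).differentiableAt
      (by simp)
  have e : ∀ v : ℝ × ℝ, fderiv ℝ (fun p : ℝ × ℝ => fderiv ℝ (fun p : ℝ × ℝ => F p.1 p.2) p v)
      (x, y) = (fderiv ℝ (fderiv ℝ fun p : ℝ × ℝ => F p.1 p.2) (x, y)).flip v := by
    intro v
    rw [fderiv_clm_apply hd (differentiableAt_const v)]
    simp
  have hs : IsSymmSndFDerivAt ℝ (fun p : ℝ × ℝ => F p.1 p.2) (x, y) :=
    hc.isSymmSndFDerivAt (by simpa using two_le_infty)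
  have d1 := (hasDerivAt_fst_of_differentiableAt (F := fun x y =>
    fderiv ℝ (fun p : ℝ × ℝ => F p.1 p.2) (x, y) (0, 1)) (hx2 y hy)).const_mul (r y : ℂ)
  have d2 := (hasDerivAt_snd_of_differentiableAt (F := fun x y =>
    fderiv ℝ (fun p : ℝ × ℝ => F p.1 p.2) (x, y) (1, 0)) (hx1 y hy)).const_mul (x : ℂ)
  simp only [bDerivNormal, bDerivTangent, bDeriv, id]
  rw [d1.deriv, d2.deriv]
  simp only [e, ContinuousLinearMap.flip_apply]
  rw [hs.eq]
  ring

theorem SmoothNear.tangent_iterate (hI : IsOpen I) (hr : ContDiffOn ℝ ∞ r I) (h : SmoothNear I F)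
    (j : ℕ) : SmoothNear I ((bDerivTangent r)^[j] F) := by
  induction j with
  | zero => exact h
  | succ j ih => simpa only [Function.iterate_succ_apply'] using ih.tangent hI hr

theorem SmoothNear.normal_tangent_iterate (hI : IsOpen I) (hr : ContDiffOn ℝ ∞ r I)
    (h : SmoothNear I F) (j : ℕ) : EqNear I ((bDerivTangent r)^[j] (bDerivNormal F))
      (bDerivNormal ((bDerivTangent r)^[j] F)) := by
  induction j with
  | zero => exact .refl _ _
  | succ j ih =>
    simp only [Function.iterate_succ_apply']
    exact (ih.tangent hI).trans ((h.tangent_iterate hI hr j).normal_tangent hI).symm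

theorem Conormal.congr (hI : IsOpen I) (h : Conormal I r w F) (hFG : EqNear I F G) :
    Conormal I r w G :=
  ⟨h.1.congr hFG, fun i j => (h.2 i j).congr (hFG.iterate hI i j)⟩

theorem Conormal.mono (h : Conormal I r w F) (hw : WeightLE I w w') : Conormal I r w' F :=
  ⟨h.1, fun i j => (h.2 i j).mono hw⟩

theorem Conormal.tangent (hI : IsOpen I) (hr : ContDiffOn ℝ ∞ r I) (h : Conormal I r w F) :
    Conormal I r w (bDerivTangent r F) :=
  ⟨h.1.tangent hI hr, fun i j => h.2 i (j + 1)⟩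

/-- In the definition the normal fields act last, so the additional innermost `x ∂/∂x` has to be
commuted past the tangential ones. -/
theorem Conormal.normal (hI : IsOpen I) (hr : ContDiffOn ℝ ∞ r I) (h : Conormal I r w F) :
    Conormal I r w (bDerivNormal F) := by
  refine ⟨h.1.normal hI, fun i j => ?_⟩
  refine (h.2 (i + 1) j).congr ?_
  simpa only [Function.iterate_succ_apply, Function.iterate_zero_apply] using
    ((h.1.normal_tangent_iterate hI hr j).iterate (r := r) hI i 0).symm

/-- A class of functions that satisfy a bound and that is stable under both vector fields consists
of conormal functions. -/
theorem Conormal.of_stable (hI : IsOpen I) (T : (ℝ → ℝ → ℂ) → Prop)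
    (hs : ∀ F, T F → SmoothNear I F) (hb : ∀ F, T F → BoundNear I w F)
    (h1 : ∀ F, T F → ∃ G, T G ∧ EqNear I (bDerivNormal F) G)
    (h2 : ∀ F, T F → ∃ G, T G ∧ EqNear I (bDerivTangent r F) G) (hF : T F) :
    Conormal I r w F := by
  refine ⟨hs F hF, fun i j => ?_⟩
  -- The innermost derivative is replaced by a member of the class each time, so no commutation is
  -- needed.
  induction j generalizing F with
  | zero =>
    induction i generalizing F with
    | zero => exact hb F hF
    | succ i ih =>
      obtain ⟨G, hG, hFG⟩ := h1 F hF
      exact (ih hG).congr (by simpa using (hFG.iterate (r := r) hI i 0).symm)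
  | succ j ih =>
    obtain ⟨G, hG, hFG⟩ := h2 F hF
    exact (ih hG).congr (by simpa using (hFG.iterate (r := r) hI i j).symm)

/-- A variant of `Conormal.of_stable` in which the derivatives need only be sums of members of the
class. -/
theorem Conormal.of_stable_sums (hI : IsOpen I) (P : (ℝ → ℝ → ℂ) → Prop)
    (hs : ∀ F, P F → SmoothNear I F) (hb : ∀ F, P F → BoundNear I w F)
    (h1 : ∀ F, P F → AddClosureNear I P (bDerivNormal F))
    (h2 : ∀ F, P F → AddClosureNear I P (bDerivTangent r F)) (hF : AddClosureNear I P F) :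
    Conormal I r w F := by
  have hs' : ∀ F, AddClosureNear I P F → SmoothNear I F := by
    intro F hF
    induction hF with
    | base h => exact hs _ h
    | add _ _ h h' => exact h.add h'
    | congr _ e h => exact h.congr e
  refine Conormal.of_stable hI (AddClosureNear I P) hs' ?_ ?_ ?_ hF
  · intro F hF
    induction hF with
    | base h => exact hb _ h
    | add _ _ h h' => exact h.add h'
    | congr _ e h => exact h.congr e
  · intro F hF
    induction hF with
    | base h => exact ⟨_, h1 _ h, .refl _ _⟩
    | add hF hG h h' =>
      obtain ⟨F', hF', e⟩ := h
      obtain ⟨G', hG', e'⟩ := h'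
      exact ⟨_, .add hF' hG', ((hs' _ hF).normal_add hI (hs' _ hG)).trans (e.add e')⟩
    | congr _ e h =>
      obtain ⟨F', hF', e'⟩ := h
      exact ⟨F', hF', e.normal.symm.trans e'⟩
  · intro F hF
    induction hF with
    | base h => exact ⟨_, h2 _ h, .refl _ _⟩
    | add hF hG h h' =>
      obtain ⟨F', hF', e⟩ := h
      obtain ⟨G', hG', e'⟩ := h'
      exact ⟨_, .add hF' hG', ((hs' _ hF).tangent_add hI (hs' _ hG)).trans (e.add e')⟩
    | congr _ e h =>
      obtain ⟨F', hF', e'⟩ := h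
      exact ⟨F', hF', (e.tangent hI).symm.trans e'⟩

theorem Conormal.add (hI : IsOpen I) (hr : ContDiffOn ℝ ∞ r I) (h : Conormal I r w F)
    (h' : Conormal I r w G) : Conormal I r w (F + G) :=
  Conormal.of_stable_sums hI (Conormal I r w) (fun _ h => h.1) (fun _ h => h.2 0 0)
    (fun _ h => .base (h.normal hI hr)) (fun _ h => .base (h.tangent hI hr))
    (.add (.base h) (.base h'))

/-- By the Leibniz rule, derivatives of products are sums of products of conormal functions with the
same two weights. -/
theorem Conormal.mul (hI : IsOpen I) (hr : ContDiffOn ℝ ∞ r I) (h : Conormal I r w F)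
    (h' : Conormal I r w' G) : Conormal I r (w * w') (F * G) := by
  refine Conormal.of_stable_sums hI
    (fun H => ∃ F G, Conormal I r w F ∧ Conormal I r w' G ∧ H = F * G) ?_ ?_ ?_ ?_
    (.base ⟨F, G, h, h', rfl⟩)
  · rintro _ ⟨F, G, h, h', rfl⟩
    exact h.1.mul h'.1
  · rintro _ ⟨F, G, h, h', rfl⟩
    exact (h.2 0 0).mul (h'.2 0 0)
  · rintro _ ⟨F, G, h, h', rfl⟩
    exact .congr (.add (.base ⟨_, _, h.normal hI hr, h', rfl⟩)
      (.base ⟨_, _, h, h'.normal hI hr, rfl⟩)) (h.1.normal_mul hI h'.1).symm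
  · rintro _ ⟨F, G, h, h', rfl⟩
    exact .congr (.add (.base ⟨_, _, h.tangent hI hr, h', rfl⟩)
      (.base ⟨_, _, h, h'.tangent hI hr, rfl⟩)) (h.1.tangent_mul hI h'.1).symm

end Basic

/-! ### Faces, weights and basic conormal functions -/

/-- Admissible data of a boundary face: an open parameter set and a defining function of its ends. -/
structure IsFace (I : Set ℝ) (r : ℝ → ℝ) : Prop where
  isOpen : IsOpen I
  smooth : ContDiffOn ℝ ∞ r I
  pos : ∀ y ∈ I, 0 < r y
  le_one : ∀ y ∈ I, r y ≤ 1

/-- The weight `x ^ N * r ^ (-M)`. -/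
noncomputable def wt (r : ℝ → ℝ) (N : ℝ) (M : ℕ) : ℝ → ℝ → ℝ := fun x y => x ^ N * (r y ^ M)⁻¹

theorem eventually_pos_lt {δ : ℝ} (hδ : 0 < δ) : ∀ᶠ x in 𝓝[>] (0 : ℝ), x ∈ Ioo 0 δ :=
  eventually_Ioo_iff.2 ⟨δ, hδ, fun _ => id⟩

section Weights

variable {I : Set ℝ} {r : ℝ → ℝ}

theorem IsFace.wt_nonneg (hf : IsFace I r) {N : ℝ} {M : ℕ} {x y : ℝ} (hx : 0 < x) (hy : y ∈ I) :
    0 ≤ wt r N M x y :=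
  mul_nonneg (Real.rpow_nonneg hx.le _) (inv_nonneg.2 (pow_nonneg (hf.pos y hy).le _))

theorem IsFace.wt_mono (hf : IsFace I r) {N N' : ℝ} {M M' : ℕ} (hN : N' ≤ N) (hM : M ≤ M') :
    WeightLE I (wt r N M) (wt r N' M') := by
  refine ⟨1, ?_⟩
  filter_upwards [eventually_pos_lt one_pos] with x hx y hy
  refine ⟨hf.wt_nonneg hx.1 hy, ?_⟩
  rw [one_mul]
  refine mul_le_mul (Real.rpow_le_rpow_of_exponent_ge hx.1 hx.2.le hN) ?_
    (inv_nonneg.2 (pow_nonneg (hf.pos y hy).le _)) (Real.rpow_nonneg hx.1.le _)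
  exact inv_anti₀ (pow_pos (hf.pos y hy) _)
    (pow_le_pow_of_le_one (hf.pos y hy).le (hf.le_one y hy) hM)

theorem IsFace.wt_mul (hf : IsFace I r) (N N' : ℝ) (M M' : ℕ) :
    WeightLE I (wt r N M * wt r N' M') (wt r (N + N') (M + M')) := by
  refine ⟨1, ?_⟩
  filter_upwards [eventually_pos_lt one_pos] with x hx y hy
  refine ⟨mul_nonneg (hf.wt_nonneg hx.1 hy) (hf.wt_nonneg hx.1 hy), le_of_eq ?_⟩
  simp only [Pi.mul_apply, wt, Real.rpow_add hx.1, pow_add, mul_inv]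
  ring

end Weights

section Conormal

variable {I I' : Set ℝ} {r : ℝ → ℝ} {F G : ℝ → ℝ → ℂ} {w w' : ℝ → ℝ → ℝ}

theorem bDerivNormal_of_snd (g : ℝ → ℂ) : bDerivNormal (fun _ y => g y) = fun _ _ => 0 := by
  funext x y
  simp [bDerivNormal, bDeriv]

theorem bDerivTangent_of_fst (g : ℝ → ℂ) : bDerivTangent r (fun x _ => g x) = fun _ _ => 0 := by
  funext x y
  simp [bDerivTangent, bDeriv]

theorem conormal_const (hI : IsOpen I) (c : ℂ) :
    Conormal I r (fun _ _ => 1) (fun _ _ => c) := by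
  refine Conormal.of_stable hI (fun F => ∃ c : ℂ, F = fun _ _ => c) ?_ ?_ ?_ ?_ ⟨c, rfl⟩
  · rintro _ ⟨c, rfl⟩
    exact ⟨1, one_pos, contDiffOn_const⟩
  · rintro _ ⟨c, rfl⟩
    exact ⟨‖c‖, .of_forall fun _ _ _ => by simp⟩
  · rintro _ ⟨c, rfl⟩
    exact ⟨_, ⟨0, rfl⟩, by rw [bDerivNormal_of_snd]; exact .refl _ _⟩
  · rintro _ ⟨c, rfl⟩
    exact ⟨_, ⟨0, rfl⟩, by rw [bDerivTangent_of_fst (fun _ => c)]; exact .refl _ _⟩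

theorem conormal_zero (hI : IsOpen I) : Conormal I r w (fun _ _ => 0) := by
  refine Conormal.of_stable hI (fun F => F = fun _ _ => 0) ?_ ?_ ?_ ?_ rfl
  · rintro _ rfl
    exact ⟨1, one_pos, contDiffOn_const⟩
  · rintro _ rfl
    exact ⟨0, .of_forall fun _ _ _ => by simp⟩
  · rintro _ rfl
    exact ⟨_, rfl, by rw [bDerivNormal_of_snd]; exact .refl _ _⟩
  · rintro _ rfl
    exact ⟨_, rfl, by rw [bDerivTangent_of_fst (fun _ => 0)]; exact .refl _ _⟩

theorem Conormal.const_mul (hf : IsFace I r) (c : ℂ) (h : Conormal I r w F) :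
    Conormal I r w (fun x y => c * F x y) := by
  have := (conormal_const (r := r) hf.isOpen c).mul hf.isOpen hf.smooth h
  have e : (fun _ _ => 1) * w = w := by funext x y; simp
  rwa [e] at this

theorem Conormal.mul_bounded (hf : IsFace I r) (h : Conormal I r w F)
    (h' : Conormal I r (fun _ _ => 1) G) : Conormal I r w (F * G) := by
  have := h.mul hf.isOpen hf.smooth h'
  have e : w * (fun _ _ => 1) = w := by funext x y; simp
  rwa [e] at this

theorem Conormal.mul_wt (hf : IsFace I r) {N N' : ℝ} {M M' : ℕ} (h : Conormal I r (wt r N M) F)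
    (h' : Conormal I r (wt r N' M') G) : Conormal I r (wt r (N + N') (M + M')) (F * G) :=
  (h.mul hf.isOpen hf.smooth h').mono (hf.wt_mul _ _ _ _)

theorem Conormal.sum (hf : IsFace I r) {ι : Type*} (S : Finset ι) {F : ι → ℝ → ℝ → ℂ}
    (h : ∀ k ∈ S, Conormal I r w (F k)) : Conormal I r w (fun x y => ∑ k ∈ S, F k x y) := by
  classical
  induction S using Finset.induction_on with
  | empty => simpa using conormal_zero hf.isOpen
  | insert k S hk ih =>
    simp only [Finset.sum_insert hk]
    exact (h k (Finset.mem_insert_self k S)).add hf.isOpen hf.smooth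
      (ih fun l hl => h l (Finset.mem_insert_of_mem hl))

theorem Conormal.union (hI : IsOpen I) (hI' : IsOpen I')
    (hw : ∀ᶠ x in 𝓝[>] (0 : ℝ), ∀ y ∈ I ∪ I', 0 ≤ w x y) (h : Conormal I r w F)
    (h' : Conormal I' r w F) : Conormal (I ∪ I') r w F := by
  obtain ⟨⟨δ, hδ, hs⟩, hb⟩ := h
  obtain ⟨⟨δ', hδ', hs'⟩, hb'⟩ := h'
  refine ⟨⟨min δ δ', lt_min hδ hδ', ?_⟩, fun i j => ?_⟩
  · rw [prod_union]
    refine ContDiffOn.union_of_isOpen (hs.mono ?_) (hs'.mono ?_) (isOpen_Ioo.prod hI)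
      (isOpen_Ioo.prod hI')
    · exact prod_mono (Ioo_subset_Ioo_right (min_le_left _ _)) le_rfl
    · exact prod_mono (Ioo_subset_Ioo_right (min_le_right _ _)) le_rfl
  · obtain ⟨C, hC⟩ := hb i j
    obtain ⟨C', hC'⟩ := hb' i j
    refine ⟨max C C', ?_⟩
    filter_upwards [hC, hC', hw] with x hx hx' hwx y hy
    rcases hy with hy | hy
    · exact (hx y hy).trans (mul_le_mul_of_nonneg_right (le_max_left _ _) (hwx y (.inl hy)))
    · exact (hx' y hy).trans (mul_le_mul_of_nonneg_right (le_max_right _ _) (hwx y (.inr hy)))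

theorem smoothNear_of_fst {g : ℝ → ℂ} {δ : ℝ} (hδ : 0 < δ) (hg : ContDiffOn ℝ ∞ g (Ioo 0 δ)) :
    SmoothNear I fun x _ => g x :=
  ⟨δ, hδ, hg.comp contDiffOn_fst fun _ hp => hp.1⟩

/-- Functions of `x` that are analytic at `0` are conormal. -/
theorem conormal_of_analyticAt (hI : IsOpen I) {g : ℝ → ℂ} (hg : AnalyticAt ℝ g 0) :
    Conormal I r (fun _ _ => 1) (fun x _ => g x) := by
  refine Conormal.of_stable hI (fun F => ∃ g : ℝ → ℂ, AnalyticAt ℝ g 0 ∧ F = fun x _ => g x)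
    ?_ ?_ ?_ ?_ ⟨g, hg, rfl⟩
  · rintro _ ⟨g, hg, rfl⟩
    obtain ⟨δ, hδ, h⟩ := Metric.eventually_nhds_iff.1 hg.eventually_analyticAt
    refine smoothNear_of_fst hδ fun x hx => ?_
    exact (h (by simpa [abs_of_pos hx.1] using hx.2)).contDiffAt.contDiffWithinAt
  · rintro _ ⟨g, hg, rfl⟩
    refine ⟨‖g 0‖ + 1, ?_⟩
    have := hg.continuousAt.norm.eventually (gt_mem_nhds (lt_add_one ‖g 0‖))
    filter_upwards [this.filter_mono nhdsWithin_le_nhds] with x hx y _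
    simpa using hx.le
  · rintro _ ⟨g, hg, rfl⟩
    refine ⟨_, ⟨fun x => (x : ℂ) * deriv g x, ?_, rfl⟩, .refl _ _⟩
    exact (Complex.ofRealCLM.analyticAt 0).mul hg.deriv
  · rintro _ ⟨g, hg, rfl⟩
    exact ⟨_, ⟨fun _ => 0, analyticAt_const, rfl⟩, by rw [bDerivTangent_of_fst]; exact .refl _ _⟩

/-- Functions of `y` that are smooth on a closed interval are conormal on its interior. -/
theorem conormal_of_contDiffOn_Icc {a b : ℝ} (hab : a < b) (hr : ContDiffOn ℝ ∞ r (Icc a b))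
    {g : ℝ → ℂ} (hg : ContDiffOn ℝ ∞ g (Icc a b)) :
    Conormal (Ioo a b) r (fun _ _ => 1) (fun _ y => g y) := by
  refine Conormal.of_stable isOpen_Ioo
    (fun F => ∃ g : ℝ → ℂ, ContDiffOn ℝ ∞ g (Icc a b) ∧ F = fun _ y => g y)
    ?_ ?_ ?_ ?_ ⟨g, hg, rfl⟩
  · rintro _ ⟨g, hg, rfl⟩
    exact smoothNear_snd (hg.mono Ioo_subset_Icc_self)
  · rintro _ ⟨g, hg, rfl⟩
    obtain ⟨C, hC⟩ := isCompact_Icc.exists_bound_of_continuousOn hg.continuousOn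
    exact ⟨C, .of_forall fun x y hy => by simpa using hC y (Ioo_subset_Icc_self hy)⟩
  · rintro _ ⟨g, hg, rfl⟩
    exact ⟨_, ⟨fun _ => 0, contDiffOn_const, rfl⟩, by rw [bDerivNormal_of_snd]; exact .refl _ _⟩
  · rintro _ ⟨g, hg, rfl⟩
    refine ⟨_, ⟨fun y => (r y : ℂ) * derivWithin g (Icc a b) y, ?_, rfl⟩, ?_⟩
    · exact (Complex.ofRealCLM.contDiff.comp_contDiffOn hr).mul
        (hg.derivWithin (uniqueDiffOn_Icc hab) (by simp))
    · refine .of_forall fun x y hy => ?_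
      simp only [bDerivTangent, bDeriv, derivWithin_of_mem_nhds (Icc_mem_nhds hy.1 hy.2)]

end Conormal

/-! ### The model terms -/

section Terms

theorem phgTerm_eq_exp (q : ℂ × ℕ) {x : ℝ} (hx : 0 < x) :
    phgTerm q x = Complex.exp (q.1 * (Real.log x : ℂ)) * (Real.log x : ℂ) ^ q.2 := by
  rw [phgTerm, Complex.cpow_def_of_ne_zero (by exact_mod_cast hx.ne'), Complex.ofReal_log hx.le,
    mul_comm q.1]

theorem phgTerm_add (q q' : ℂ × ℕ) {x : ℝ} (hx : 0 < x) :
    phgTerm (q + q') x = phgTerm q x * phgTerm q' x := by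
  rw [phgTerm_eq_exp _ hx, phgTerm_eq_exp _ hx, phgTerm_eq_exp _ hx, Prod.fst_add, Prod.snd_add,
    add_mul, Complex.exp_add, pow_add]
  ring

theorem phgTerm_natCast (n : ℕ) (x : ℝ) : phgTerm (n, 0) x = (x : ℂ) ^ n := by
  simp [phgTerm]

theorem contDiffOn_phgTerm (q : ℂ × ℕ) : ContDiffOn ℝ ∞ (phgTerm q) (Ioi 0) := by
  have hl : ContDiffOn ℝ ∞ (fun x : ℝ => (Real.log x : ℂ)) (Ioi 0) :=
    Complex.ofRealCLM.contDiff.comp_contDiffOn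
      (Real.contDiffOn_log.mono fun x hx => (ne_of_gt hx : x ≠ 0))
  refine ContDiffOn.congr ?_ fun x hx => phgTerm_eq_exp q hx
  exact (Complex.contDiff_exp.comp_contDiffOn (contDiffOn_const.mul hl)).mul (hl.pow _)

/-- The truncated `p - 1` is harmless: for `p = 0` its term carries the factor `p`. -/
theorem hasDerivAt_phgTerm (z : ℂ) (p : ℕ) {x : ℝ} (hx : 0 < x) :
    HasDerivAt (phgTerm (z, p))
      ((z * phgTerm (z, p) x + p * phgTerm (z, p - 1) x) * (x : ℂ)⁻¹) x := by
  have hl : HasDerivAt (fun x : ℝ => (Real.log x : ℂ)) ((x⁻¹ : ℝ) : ℂ) x :=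
    (Real.hasDerivAt_log hx.ne').ofReal_comp
  have h := (hl.const_mul z).cexp.fun_mul (hl.fun_pow p)
  have e : phgTerm (z, p) =ᶠ[𝓝 x]
      fun x => Complex.exp (z * (Real.log x : ℂ)) * (Real.log x : ℂ) ^ p := by
    filter_upwards [lt_mem_nhds hx] with t ht using phgTerm_eq_exp _ ht
  refine (h.congr_of_eventuallyEq e).congr_deriv ?_
  rw [phgTerm_eq_exp _ hx, phgTerm_eq_exp _ hx]
  push_cast
  ring

theorem abs_log_le_rpow {K : ℝ} (hK : 0 < K) {e : ℝ} (he : 0 < e) :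
    ∃ C : ℝ, ∀ t ∈ Ioc 0 K, |Real.log t| ≤ C * t ^ (-e) := by
  -- This comes from `log u ≤ u ^ e / e` at `u = t` and `u = t⁻¹`, where on `(0, K]` one has `t ^ e
  -- ≤ K ^ (2 * e) * t ^ (-e)`.
  refine ⟨(K ^ (2 * e) + 1) / e, fun t ht => ?_⟩
  have h1 := Real.log_le_rpow_div ht.1.le he
  have h2 := Real.log_le_rpow_div (inv_pos.2 ht.1).le he
  rw [Real.log_inv, Real.inv_rpow ht.1.le, ← Real.rpow_neg ht.1.le] at h2
  have h3 : t ^ e ≤ K ^ (2 * e) * t ^ (-e) := by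
    have : t ^ e = t ^ (2 * e) * t ^ (-e) := by rw [← Real.rpow_add ht.1]; ring_nf
    rw [this]
    exact mul_le_mul_of_nonneg_right (Real.rpow_le_rpow ht.1.le ht.2 (by positivity))
      (Real.rpow_nonneg ht.1.le _)
  have h4 : 0 ≤ K ^ (2 * e) * t ^ (-e) := by have := ht.1; positivity
  have h5 : 0 ≤ t ^ (-e) := Real.rpow_nonneg ht.1.le _
  have e1 : (K ^ (2 * e) + 1) / e * t ^ (-e) = (K ^ (2 * e) * t ^ (-e) + t ^ (-e)) / e := by ring
  rw [e1, abs_le']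
  constructor
  · exact h1.trans (div_le_div_of_nonneg_right (by linarith) he.le)
  · exact h2.trans (div_le_div_of_nonneg_right (by linarith) he.le)

theorem norm_phgTerm_le {z : ℂ} {N : ℝ} (hN : N < z.re) (p : ℕ) {K : ℝ} (hK : 0 < K) :
    ∃ C : ℝ, ∀ t ∈ Ioc 0 K, ‖phgTerm (z, p) t‖ ≤ C * t ^ N := by
  -- The gap between `N` and `Re z` is cut into `p + 1` equal parts: `p` of them absorb the
  -- logarithms, and the last leaves the factor `t ^ e ≤ K ^ e`.
  have he : 0 < (z.re - N) / (p + 1) := div_pos (sub_pos.2 hN) (by positivity)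
  set e := (z.re - N) / (p + 1) with he_def
  obtain ⟨C, hC⟩ := abs_log_le_rpow hK he
  refine ⟨C ^ p * K ^ e, fun t ht => ?_⟩
  have hC0 : 0 ≤ C * t ^ (-e) := (abs_nonneg _).trans (hC t ht)
  have h1 : ‖phgTerm (z, p) t‖ = t ^ z.re * |Real.log t| ^ p := by
    rw [phgTerm, norm_mul, norm_pow, Complex.norm_cpow_eq_rpow_re_of_pos ht.1, Complex.norm_real,
      Real.norm_eq_abs]
  have h2 : |Real.log t| ^ p ≤ (C * t ^ (-e)) ^ p :=
    pow_le_pow_left₀ (abs_nonneg _) (hC t ht) p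
  have hp1 : (p + 1 : ℝ) * e = z.re - N := by rw [he_def]; field_simp
  have h3 : t ^ z.re * (C * t ^ (-e)) ^ p = C ^ p * (t ^ e * t ^ N) := by
    rw [mul_pow, ← Real.rpow_natCast (t ^ (-e)), ← Real.rpow_mul ht.1.le, ← Real.rpow_add ht.1,
      mul_left_comm, ← Real.rpow_add ht.1]
    congr 2
    linarith
  have hCp : 0 ≤ C ^ p := by
    have : 0 ≤ C := by
      by_contra hc
      have := mul_neg_of_neg_of_pos (not_le.1 hc) (Real.rpow_pos_of_pos ht.1 (-e))
      linarith
    positivity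
  calc ‖phgTerm (z, p) t‖ ≤ t ^ z.re * (C * t ^ (-e)) ^ p := by
        rw [h1]; exact mul_le_mul_of_nonneg_left h2 (Real.rpow_nonneg ht.1.le _)
    _ = C ^ p * (t ^ e * t ^ N) := h3
    _ ≤ C ^ p * (K ^ e * t ^ N) := by
        refine mul_le_mul_of_nonneg_left (mul_le_mul_of_nonneg_right ?_ ?_) hCp
        · exact Real.rpow_le_rpow ht.1.le ht.2 he.le
        · exact Real.rpow_nonneg ht.1.le _
    _ = C ^ p * K ^ e * t ^ N := by ring

variable {I : Set ℝ} {r : ℝ → ℝ}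

/-- For fixed `z` the span of `x ^ z (log x) ^ k` is stable under `x ∂/∂x`. The strict inequality
leaves room for every power of the logarithm. -/
theorem conormal_phgTerm_fst (hf : IsFace I r) {z : ℂ} {N : ℝ} (hN : N < z.re) (p : ℕ) :
    Conormal I r (wt r N 0) (fun x _ => phgTerm (z, p) x) := by
  refine Conormal.of_stable_sums hf.isOpen
    (fun F => ∃ (c : ℂ) (k : ℕ), F = fun x _ => c * phgTerm (z, k) x) ?_ ?_ ?_ ?_
    (.base ⟨1, p, by simp⟩)
  · rintro _ ⟨c, k, rfl⟩
    exact smoothNear_of_fst one_pos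
      (contDiffOn_const.mul ((contDiffOn_phgTerm _).mono fun x hx => hx.1))
  · rintro _ ⟨c, k, rfl⟩
    obtain ⟨C, hC⟩ := norm_phgTerm_le hN k one_pos
    refine ⟨‖c‖ * C, ?_⟩
    filter_upwards [eventually_pos_lt one_pos] with x hx y _
    rw [norm_mul, mul_assoc]
    simpa [wt] using mul_le_mul_of_nonneg_left (hC x ⟨hx.1, hx.2.le⟩) (norm_nonneg c)
  · rintro _ ⟨c, k, rfl⟩
    refine .congr (.add (.base ⟨c * z, k, rfl⟩) (.base ⟨c * k, k - 1, rfl⟩)) ?_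
    filter_upwards [eventually_pos_lt one_pos] with x hx y _
    have hx0 : (x : ℂ) ≠ 0 := by exact_mod_cast hx.1.ne'
    simp only [bDerivNormal, bDeriv, id, Pi.add_apply,
      ((hasDerivAt_phgTerm z k hx.1).const_mul c).deriv]
    field_simp
  · rintro _ ⟨c, k, rfl⟩
    exact .base ⟨0, 0, by rw [bDerivTangent_of_fst]; simp⟩

end Terms

/-! ### Rescaling the normal variable by a function on the face -/

/-- A positive function `m` on the face, bounded above and bounded below by a multiple of `r`, with
bounded logarithmic derivative `n` under `r ∂/∂y`. -/
structure IsScale (I : Set ℝ) (r m : ℝ → ℝ) (n : ℝ → ℂ) : Prop where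
  smooth : ContDiffOn ℝ ∞ m I
  pos : ∀ y ∈ I, 0 < m y
  le : ∃ K : ℝ, 0 < K ∧ ∀ y ∈ I, m y ≤ K
  ge : ∃ K : ℝ, 0 < K ∧ ∀ y ∈ I, r y ≤ K * m y
  log_deriv : ∀ y ∈ I, (r y : ℂ) * ((deriv m y : ℝ) : ℂ) = (m y : ℂ) * n y
  conormal : Conormal I r (fun _ _ => 1) (fun _ y => n y)

section Pullback

variable {I : Set ℝ} {r m : ℝ → ℝ} {n : ℝ → ℂ}

theorem IsScale.hasDerivAt (hI : IsOpen I) (hm : IsScale I r m n) {y : ℝ} (hy : y ∈ I) :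
    HasDerivAt m (deriv m y) y :=
  ((hm.smooth.contDiffAt (hI.mem_nhds hy)).differentiableAt (by simp)).hasDerivAt

theorem IsScale.norm_phgTerm_le (hf : IsFace I r) (hm : IsScale I r m n) {z : ℂ} {M : ℕ}
    (hM : -(M : ℝ) < z.re) (p : ℕ) :
    ∃ C : ℝ, ∀ y ∈ I, ‖phgTerm (z, p) (m y)‖ ≤ C * (r y ^ M)⁻¹ := by
  obtain ⟨K, hK, hle⟩ := hm.le
  obtain ⟨K', hK', hge⟩ := hm.ge
  obtain ⟨C, hC⟩ := _root_.norm_phgTerm_le hM p hK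
  refine ⟨|C| * K' ^ M, fun y hy => ?_⟩
  have hmy := hm.pos y hy
  have hry := hf.pos y hy
  refine (hC _ ⟨hmy, hle y hy⟩).trans ?_
  rw [Real.rpow_neg hmy.le, Real.rpow_natCast, mul_assoc]
  have h1 : (m y ^ M)⁻¹ ≤ K' ^ M * (r y ^ M)⁻¹ := by
    rw [← div_eq_mul_inv, le_div_iff₀ (pow_pos hry M), inv_mul_le_iff₀ (pow_pos hmy M), ← mul_pow,
      mul_comm (m y)]
    exact pow_le_pow_left₀ hry.le (hge y hy) M
  calc C * (m y ^ M)⁻¹ ≤ |C| * (m y ^ M)⁻¹ :=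
        mul_le_mul_of_nonneg_right (le_abs_self C) (inv_nonneg.2 (pow_pos hmy M).le)
    _ ≤ _ := mul_le_mul_of_nonneg_left h1 (abs_nonneg C)

theorem IsScale.contDiffOn_phgTerm (hm : IsScale I r m n) (q : ℂ × ℕ) :
    ContDiffOn ℝ ∞ (fun y => phgTerm q (m y)) I :=
  (_root_.contDiffOn_phgTerm q).comp hm.smooth hm.pos

/-- Differentiating a term in `m y` produces only the bounded factor `n`, by `log_deriv`. So the
multiples of such terms by bounded conormal functions form, up to sums, a stable class; the lower
bound of `m` by `r` converts negative powers of `m` into powers of `r⁻¹`. -/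
theorem IsScale.conormal_phgTerm (hf : IsFace I r) (hm : IsScale I r m n) {z : ℂ} {M : ℕ}
    (hM : -(M : ℝ) < z.re) (p : ℕ) :
    Conormal I r (wt r 0 M) (fun _ y => phgTerm (z, p) (m y)) := by
  refine Conormal.of_stable_sums hf.isOpen
    (fun F => ∃ (G : ℝ → ℝ → ℂ) (k : ℕ), Conormal I r (fun _ _ => 1) G ∧
      F = G * fun _ y => phgTerm (z, k) (m y)) ?_ ?_ ?_ ?_
    (.base ⟨fun _ _ => 1, p, conormal_const hf.isOpen 1, by funext x y; simp⟩)
  · rintro _ ⟨G, k, hG, rfl⟩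
    exact hG.1.mul (smoothNear_snd (hm.contDiffOn_phgTerm _))
  · rintro _ ⟨G, k, hG, rfl⟩
    obtain ⟨C, hC⟩ := hm.norm_phgTerm_le hf hM k
    obtain ⟨C', hC'⟩ := hG.2 0 0
    refine ⟨C' * C, ?_⟩
    filter_upwards [hC'] with x hx y hy
    have h1 := hx y hy
    simp only [Function.iterate_zero, id] at h1
    calc ‖G x y * phgTerm (z, k) (m y)‖ = ‖G x y‖ * ‖phgTerm (z, k) (m y)‖ := norm_mul _ _
      _ ≤ (C' * 1) * (C * (r y ^ M)⁻¹) :=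
        mul_le_mul h1 (hC y hy) (norm_nonneg _) ((norm_nonneg _).trans h1)
      _ = C' * C * wt r 0 M x y := by simp only [wt, Real.rpow_zero]; ring
  · rintro _ ⟨G, k, hG, rfl⟩
    refine .congr (.base ⟨_, k, hG.normal hf.isOpen hf.smooth, rfl⟩) (EqNear.symm ?_)
    refine (hG.1.normal_mul hf.isOpen (smoothNear_snd (hm.contDiffOn_phgTerm _))).trans ?_
    rw [bDerivNormal_of_snd]
    exact .of_forall fun x y _ => by simp
  · rintro _ ⟨G, k, hG, rfl⟩
    refine .congr (.add (.base ⟨_, k, hG.tangent hf.isOpen hf.smooth, rfl⟩)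
      (.add (.base ⟨fun x y => z * (G x y * n y), k, ?_, rfl⟩)
        (.base ⟨fun x y => k * (G x y * n y), k - 1, ?_, rfl⟩))) (EqNear.symm ?_)
    · exact (hG.mul_bounded hf hm.conormal).const_mul hf z
    · exact (hG.mul_bounded hf hm.conormal).const_mul hf k
    refine (hG.1.tangent_mul hf.isOpen (smoothNear_snd (hm.contDiffOn_phgTerm _))).trans ?_
    refine EqNear.add (.refl _ _) (.of_forall fun x y hy => ?_)
    have hmy := hm.pos y hy
    have hmy0 : (m y : ℂ) ≠ 0 := by exact_mod_cast hmy.ne'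
    have hd := (hasDerivAt_phgTerm z k hmy).scomp y (hm.hasDerivAt hf.isOpen hy)
    have hl := hm.log_deriv y hy
    have e : bDerivTangent r (fun _ y => phgTerm (z, k) (m y)) x y =
        n y * (z * phgTerm (z, k) (m y) + k * phgTerm (z, k - 1) (m y)) := by
      change (r y : ℂ) * deriv (phgTerm (z, k) ∘ m) y = _
      rw [hd.deriv, Complex.real_smul, ← mul_assoc, hl]
      field_simp
    simp only [Pi.mul_apply, Pi.add_apply, e]
    ring

theorem IsScale.smoothNear_comp (hm : IsScale I r m n) {F : ℝ → ℝ → ℂ} (hF : SmoothNear I F) :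
    SmoothNear I fun x y => F (x * m y) y := by
  obtain ⟨K, hK, hle⟩ := hm.le
  obtain ⟨δ, hδ, hF⟩ := hF
  refine ⟨δ / K, div_pos hδ hK, ?_⟩
  refine hF.comp (g := fun p : ℝ × ℝ => F p.1 p.2) (f := fun p : ℝ × ℝ => (p.1 * m p.2, p.2)) ?_ ?_
  · exact (contDiffOn_fst.mul (hm.smooth.comp contDiffOn_snd fun _ hp => hp.2)).prodMk contDiffOn_snd
  · rintro ⟨x, y⟩ ⟨hx, hy⟩
    refine ⟨⟨mul_pos hx.1 (hm.pos y hy), ?_⟩, hy⟩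
    calc x * m y ≤ x * K := mul_le_mul_of_nonneg_left (hle y hy) hx.1.le
      _ < δ := (lt_div_iff₀ hK).1 hx.2

theorem IsScale.eventually_comp (hm : IsScale I r m n) {P : ℝ → ℝ → Prop}
    (h : ∀ᶠ x in 𝓝[>] (0 : ℝ), ∀ y ∈ I, P x y) :
    ∀ᶠ x in 𝓝[>] (0 : ℝ), ∀ y ∈ I, P (x * m y) y := by
  obtain ⟨K, hK, hle⟩ := hm.le
  obtain ⟨δ, hδ, h⟩ := eventually_Ioo_iff.1 h
  filter_upwards [eventually_pos_lt (div_pos hδ hK)] with x hx y hy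
  refine h _ ⟨mul_pos hx.1 (hm.pos y hy), ?_⟩ y hy
  calc x * m y ≤ x * K := mul_le_mul_of_nonneg_left (hle y hy) hx.1.le
    _ < δ := (lt_div_iff₀ hK).1 hx.2

/-- The field `x ∂/∂x` is invariant under dilations of `x`. No differentiability is needed, because
`deriv_comp_mul_left` holds without it. -/
theorem bDerivNormal_comp_mul (F : ℝ → ℝ → ℂ) (m : ℝ → ℝ) :
    bDerivNormal (fun x y => F (x * m y) y) = fun x y => bDerivNormal F (x * m y) y := by
  funext x y
  simp only [bDerivNormal, bDeriv, id]
  have h := deriv_comp_mul_left (m y) (fun x₁ => F x₁ y) x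
  simp only [mul_comm (m y)] at h
  rw [h, Complex.real_smul]
  push_cast
  ring

/-- Chain rule: moving along the face also changes the first argument `x * m y`, at the logarithmic
rate `n`. -/
theorem IsScale.tangent_comp (hf : IsFace I r) (hm : IsScale I r m n) {F : ℝ → ℝ → ℂ}
    (hF : SmoothNear I F) : EqNear I (bDerivTangent r fun x y => F (x * m y) y)
      ((fun _ y => n y) * (fun x y => bDerivNormal F (x * m y) y) +
        fun x y => bDerivTangent r F (x * m y) y) := by
  filter_upwards [hm.eventually_comp (hF.differentiable hf.isOpen)] with x hx y hy
  have hd := hx y hy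
  have h1 := hasDerivAt_fst_of_differentiableAt hd
  have h2 := hasDerivAt_snd_of_differentiableAt hd
  have h3 : HasDerivAt (fun y => F (x * m y) y) _ y :=
    hd.hasFDerivAt.comp_hasDerivAt (f := fun y => (x * m y, y)) y
      (((hm.hasDerivAt hf.isOpen hy).const_mul x).prodMk (hasDerivAt_id y))
  have e : ((x * deriv m y, 1) : ℝ × ℝ) = (x * deriv m y) • ((1, 0) : ℝ × ℝ) + (0, 1) := by simp
  have hl := hm.log_deriv y hy
  simp only [bDerivTangent, bDerivNormal, bDeriv, id, Pi.add_apply, Pi.mul_apply, h1.deriv,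
    h2.deriv, h3.deriv, e, map_add, map_smul, Complex.real_smul]
  push_cast
  linear_combination (x : ℂ) * (fderiv ℝ (fun p : ℝ × ℝ => F p.1 p.2) (x * m y, y)) (1, 0) * hl

theorem Conormal.comp_scale (hf : IsFace I r) (hm : IsScale I r m n) {F : ℝ → ℝ → ℂ}
    {w : ℝ → ℝ → ℝ} (hF : Conormal I r w F) :
    Conormal I r (fun x y => w (x * m y) y) (fun x y => F (x * m y) y) := by
  refine Conormal.of_stable_sums hf.isOpen
    (fun H => ∃ (G F : ℝ → ℝ → ℂ), Conormal I r (fun _ _ => 1) G ∧ Conormal I r w F ∧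
      H = G * fun x y => F (x * m y) y) ?_ ?_ ?_ ?_
    (.base ⟨fun _ _ => 1, F, conormal_const hf.isOpen 1, hF, by funext x y; simp⟩)
  · rintro _ ⟨G, F, hG, hF, rfl⟩
    exact hG.1.mul (hm.smoothNear_comp hF.1)
  · rintro _ ⟨G, F, hG, hF, rfl⟩
    obtain ⟨C, hC⟩ := hF.2 0 0
    have h := (hG.2 0 0).mul (w' := fun x y => w (x * m y) y) (G := fun x y => F (x * m y) y)
      ⟨C, hm.eventually_comp hC⟩
    obtain ⟨C', h⟩ := h
    exact ⟨C', h.mono fun x hx y hy => by simpa using hx y hy⟩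
  · rintro _ ⟨G, F, hG, hF, rfl⟩
    refine .congr (.add (.base ⟨_, F, hG.normal hf.isOpen hf.smooth, hF, rfl⟩)
      (.base ⟨G, _, hG, hF.normal hf.isOpen hf.smooth, rfl⟩)) (EqNear.symm ?_)
    have := hG.1.normal_mul hf.isOpen (hm.smoothNear_comp hF.1)
    rwa [bDerivNormal_comp_mul] at this
  · rintro _ ⟨G, F, hG, hF, rfl⟩
    refine .congr (.add (.base ⟨_, F, hG.tangent hf.isOpen hf.smooth, hF, rfl⟩)
      (.add (.base ⟨G * fun _ y => n y, _, hG.mul_bounded hf hm.conormal,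
          hF.normal hf.isOpen hf.smooth, rfl⟩)
        (.base ⟨G, _, hG, hF.tangent hf.isOpen hf.smooth, rfl⟩))) (EqNear.symm ?_)
    refine (hG.1.tangent_mul hf.isOpen (hm.smoothNear_comp hF.1)).trans ?_
    refine EqNear.add (.refl _ _) (((EqNear.refl I G).mul (hm.tangent_comp hf hF.1)).trans ?_)
    exact .of_forall fun x y _ => by simp only [Pi.mul_apply, Pi.add_apply]; ring

/-- The order `N` is nonnegative, so the upper bound `m ≤ K` costs only a constant `K ^ N` and `M`
does not grow. -/
theorem Conormal.comp_scale_wt (hf : IsFace I r) (hm : IsScale I r m n) {F : ℝ → ℝ → ℂ} {N M : ℕ}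
    (hF : Conormal I r (wt r N M) F) : Conormal I r (wt r N M) (fun x y => F (x * m y) y) := by
  refine (hF.comp_scale hf hm).mono ?_
  obtain ⟨K, hK, hle⟩ := hm.le
  refine ⟨K ^ N, ?_⟩
  filter_upwards [eventually_pos_lt one_pos] with x hx y hy
  have hmy := hm.pos y hy
  refine ⟨hf.wt_nonneg (mul_pos hx.1 hmy) hy, ?_⟩
  simp only [wt, Real.rpow_natCast]
  rw [← mul_assoc, mul_pow, mul_comm (x ^ N)]
  refine mul_le_mul_of_nonneg_right (mul_le_mul_of_nonneg_right ?_ (pow_nonneg hx.1.le _))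
    (inv_nonneg.2 (pow_nonneg (hf.pos y hy).le _))
  exact pow_le_pow_left₀ hmy.le (hle y hy) N

end Pullback

/-! ### Algebra of expansions -/

/-- An expansion over the index set `E` at the face `x = 0` in which the terms are indexed by an
arbitrary type, so that several terms may have the same exponent. -/
def HasExp (E : IndexSet) (I : Set ℝ) (r : ℝ → ℝ) (A : Set (ℝ → ℂ)) (F : ℝ → ℝ → ℂ) : Prop :=
  ∃ (ι : Type) (q : ι → ℂ × ℕ) (a : ι → ℝ → ℂ) (M : ℕ), (∀ k, q k ∈ E.carrier) ∧
    (∀ C : ℝ, {k | (q k).1.re ≤ C}.Finite) ∧ (∀ k, a k ∈ A) ∧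
    (∀ k, Conormal I r (wt r 0 M) fun _ y => a k y) ∧
    ∀ N : ℕ, ∃ S : Finset ι, (∀ k, (q k).1.re ≤ N → k ∈ S) ∧
      Conormal I r (wt r N M) fun x y => F x y - ∑ k ∈ S, phgTerm (q k) x * a k y

/-- The index set of smooth functions. -/
def natIndex : IndexSet where
  carrier := {q | q.2 = 0 ∧ ∃ n : ℕ, q.1 = n}
  finite_le C := by
    refine ((finite_le_nat ⌈C⌉₊).image fun n : ℕ => ((n : ℂ), 0)).subset ?_
    rintro ⟨z, p⟩ ⟨⟨hp, n, hz⟩, hC⟩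
    simp only at hp hz hC
    subst hp hz
    refine ⟨n, ?_, rfl⟩
    rw [Complex.natCast_re] at hC
    exact_mod_cast hC.trans (Nat.le_ceil C)
  lower_log z p q h hq := ⟨Nat.le_zero.1 (hq.trans h.1.le), h.2⟩
  add_one z p h := by
    obtain ⟨h1, n, h2⟩ := h
    exact ⟨h1, n + 1, by simpa using h2⟩

theorem IndexSet.add_natIndex (E : IndexSet) {q q' : ℂ × ℕ} (hq : q ∈ E.carrier)
    (hq' : q' ∈ natIndex.carrier) : q + q' ∈ E.carrier := by
  obtain ⟨z, p⟩ := q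
  obtain ⟨z', p'⟩ := q'
  obtain ⟨h1, n, h2⟩ := hq'
  simp only at h1 h2
  subst h1 h2
  induction n with
  | zero => simpa using hq
  | succ n ih => simpa [add_assoc] using E.add_one _ _ ih

section

variable {E E' E'' : IndexSet} {I I' : Set ℝ} {r : ℝ → ℝ} {A A' A'' : Set (ℝ → ℂ)}
  {F G : ℝ → ℝ → ℂ}

theorem conormal_term (hf : IsFace I r) {q : ℂ × ℕ} {N : ℝ} {M : ℕ} (hN : N < q.1.re) {a : ℝ → ℂ}
    (ha : Conormal I r (wt r 0 M) fun _ y => a y) :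
    Conormal I r (wt r N M) fun x y => phgTerm q x * a y := by
  have := (conormal_phgTerm_fst hf (z := q.1) hN q.2).mul_wt hf ha
  rwa [add_zero, zero_add] at this

/-- Only finitely many exponents have nonpositive real part. The resulting uniform lower bound is
what lets a single power of `r⁻¹` serve all orders of an expansion. -/
theorem exists_nat_neg_lt_re {ι : Type*} {q : ι → ℂ × ℕ}
    (hq : ∀ C : ℝ, {k | (q k).1.re ≤ C}.Finite) : ∃ m : ℕ, ∀ k, -(m : ℝ) < (q k).1.re := by
  obtain ⟨B, hB⟩ := ((hq 0).image fun k => (q k).1.re).bddBelow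
  obtain ⟨m, hm⟩ := exists_nat_gt (max (-B) 0)
  refine ⟨m, fun k => ?_⟩
  rcases le_or_gt (q k).1.re 0 with h | h
  · have := hB ⟨k, h, rfl⟩
    have := (le_max_left (-B) 0).trans_lt hm
    simp only at *
    linarith
  · have := (le_max_right (-B) 0).trans_lt hm
    linarith

theorem HasExp.congr (hf : IsFace I r) (h : HasExp E I r A F) (hFG : EqNear I F G) :
    HasExp E I r A G := by
  obtain ⟨ι, q, a, M, hq, hfin, hA, ha, hN⟩ := h
  refine ⟨ι, q, a, M, hq, hfin, hA, ha, fun N => ?_⟩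
  obtain ⟨S, hS, hR⟩ := hN N
  refine ⟨S, hS, hR.congr hf.isOpen ?_⟩
  filter_upwards [hFG] with x hx y hy
  rw [hx y hy]

theorem HasExp.mono (h : HasExp E I r A F) (hE : E.carrier ⊆ E'.carrier) (hA' : A ⊆ A') :
    HasExp E' I r A' F := by
  obtain ⟨ι, q, a, M, hq, hfin, hA, ha, hN⟩ := h
  exact ⟨ι, q, a, M, fun k => hE (hq k), hfin, fun k => hA' (hA k), ha, hN⟩

theorem HasExp.add (hf : IsFace I r) (h : HasExp E I r A F) (h' : HasExp E I r A G) :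
    HasExp E I r A (F + G) := by
  obtain ⟨ι, q, a, M, hq, hfin, hA, ha, hN⟩ := h
  obtain ⟨ι', q', a', M', hq', hfin', hA', ha', hN'⟩ := h'
  refine ⟨ι ⊕ ι', Sum.elim q q', Sum.elim a a', max M M', ?_, ?_, ?_, ?_, ?_⟩
  · rintro (k | k)
    exacts [hq k, hq' k]
  · intro C
    refine (((hfin C).image Sum.inl).union ((hfin' C).image Sum.inr)).subset ?_
    rintro (k | k) hk
    exacts [.inl ⟨k, hk, rfl⟩, .inr ⟨k, hk, rfl⟩]
  · rintro (k | k)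
    exacts [hA k, hA' k]
  · rintro (k | k)
    exacts [(ha k).mono (hf.wt_mono le_rfl (le_max_left _ _)),
      (ha' k).mono (hf.wt_mono le_rfl (le_max_right _ _))]
  · intro N
    obtain ⟨S, hS, hR⟩ := hN N
    obtain ⟨S', hS', hR'⟩ := hN' N
    refine ⟨S.disjSum S', ?_, ?_⟩
    · rintro (k | k) hk
      exacts [Finset.inl_mem_disjSum.2 (hS k hk), Finset.inr_mem_disjSum.2 (hS' k hk)]
    · refine ((hR.mono (hf.wt_mono le_rfl (le_max_left _ _))).add hf.isOpen hf.smooth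
        (hR'.mono (hf.wt_mono le_rfl (le_max_right _ _)))).congr hf.isOpen ?_
      refine .of_forall fun x y _ => ?_
      simp only [Pi.add_apply, Finset.sum_disjSum, Sum.elim_inl, Sum.elim_inr]
      ring

theorem conormal_sum_terms (hf : IsFace I r) {ι : Type*} {q : ι → ℂ × ℕ} {a : ι → ℝ → ℂ}
    {N : ℝ} {M : ℕ} (S : Finset ι) (hN : ∀ k ∈ S, N < (q k).1.re)
    (ha : ∀ k, Conormal I r (wt r 0 M) fun _ y => a k y) :
    Conormal I r (wt r N M) fun x y => ∑ k ∈ S, phgTerm (q k) x * a k y :=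
  Conormal.sum hf S fun k hk => conormal_term hf (hN k hk) (ha k)

theorem HasExp.mul (hf : IsFace I r) (h : HasExp E I r A F) (h' : HasExp E' I r A' G)
    (hE : ∀ q ∈ E.carrier, ∀ q' ∈ E'.carrier, q + q' ∈ E''.carrier)
    (hAA : ∀ a ∈ A, ∀ a' ∈ A', (fun y => a y * a' y) ∈ A'') : HasExp E'' I r A'' (F * G) := by
  obtain ⟨ι, q, a, M, hq, hfin, hA, ha, hN⟩ := h
  obtain ⟨ι', q', a', M', hq', hfin', hA', ha', hN'⟩ := h'
  obtain ⟨m₁, hm₁⟩ := exists_nat_neg_lt_re hfin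
  obtain ⟨m₂, hm₂⟩ := exists_nat_neg_lt_re hfin'
  obtain ⟨m, hm₁, hm₂⟩ : ∃ m : ℕ, (∀ k, -(m : ℝ) < (q k).1.re) ∧ ∀ k, -(m : ℝ) < (q' k).1.re := by
    refine ⟨m₁ + m₂, fun k => ?_, fun k => ?_⟩
    · push_cast
      linarith [hm₁ k, (Nat.cast_nonneg m₂ : (0 : ℝ) ≤ m₂)]
    · push_cast
      linarith [hm₂ k, (Nat.cast_nonneg m₁ : (0 : ℝ) ≤ m₁)]
  -- The remainder at order `0` plus finitely many terms gives a crude growth bound for `G`.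
  have grow : Conormal I r (wt r (-m) M') G := by
    obtain ⟨S, -, hR⟩ := hN' 0
    refine ((hR.mono (hf.wt_mono (by simp) le_rfl)).add hf.isOpen hf.smooth
      (conormal_sum_terms hf S (fun k _ => hm₂ k) ha')).congr hf.isOpen ?_
    exact .of_forall fun x y _ => by simp
  refine ⟨ι × ι', fun k => q k.1 + q' k.2, fun k y => a k.1 y * a' k.2 y, M + M', ?_, ?_, ?_, ?_, ?_⟩
  · exact fun k => hE _ (hq _) _ (hq' _)
  · intro C
    refine ((hfin (C + m)).prod (hfin' (C + m))).subset ?_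
    rintro ⟨k, k'⟩ hk
    simp only [mem_ofPred_eq, Prod.fst_add, Complex.add_re] at hk
    exact ⟨by simp only [mem_ofPred_eq]; linarith [hm₂ k'],
      by simp only [mem_ofPred_eq]; linarith [hm₁ k]⟩
  · exact fun k => hAA _ (hA _) _ (hA' _)
  · intro k
    have := (ha k.1).mul_wt hf (ha' k.2)
    rwa [add_zero] at this
  · intro N
    -- Write `F G - A B = (F - A) G + A (G - B)` with partial sums `A`, `B`. The factors `G` and `A`
    -- grow at most like `x ^ (-m)`, so remainders of order `N + m` are needed; they also ensure
    -- that `S ×ˢ S'` contains every product term with real part at most `N`.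
    obtain ⟨S, hS, hR⟩ := hN (N + m)
    obtain ⟨S', hS', hR'⟩ := hN' (N + m)
    refine ⟨S ×ˢ S', ?_, ?_⟩
    · rintro ⟨k, k'⟩ hk
      simp only [Prod.fst_add, Complex.add_re] at hk
      refine Finset.mem_product.2 ⟨hS _ ?_, hS' _ ?_⟩
      · push_cast
        linarith [hm₂ k']
      · push_cast
        linarith [hm₁ k]
    · have h1 := (hR.mul_wt hf grow).mono (hf.wt_mono (N' := N) (by push_cast; linarith) le_rfl)
      have h2 := ((conormal_sum_terms hf S (fun k _ => hm₁ k) ha).mul_wt hf hR').mono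
        (hf.wt_mono (N' := N) (by push_cast; linarith) le_rfl)
      refine (h1.add hf.isOpen hf.smooth h2).congr hf.isOpen ?_
      filter_upwards [eventually_pos_lt one_pos] with x hx y _
      have e : ∑ k ∈ S ×ˢ S', phgTerm (q k.1 + q' k.2) x * (a k.1 y * a' k.2 y) =
          (∑ k ∈ S, phgTerm (q k) x * a k y) * ∑ k ∈ S', phgTerm (q' k) x * a' k y := by
        rw [Finset.sum_mul_sum, Finset.sum_product]
        refine Finset.sum_congr rfl fun k _ => Finset.sum_congr rfl fun k' _ => ?_
        rw [phgTerm_add _ _ hx.1]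
        ring
      rw [e]
      simp only [Pi.add_apply, Pi.mul_apply]
      ring

/-- The binomial formula for `log (x * t) = log x + log t`. -/
theorem phgTerm_mul (z : ℂ) (p : ℕ) {x t : ℝ} (hx : 0 < x) (ht : 0 < t) :
    phgTerm (z, p) (x * t) = ∑ i : Fin (p + 1),
      phgTerm (z, i) x * ((p.choose i : ℂ) * phgTerm (z, p - i) t) := by
  rw [phgTerm_eq_exp _ (mul_pos hx ht), Real.log_mul hx.ne' ht.ne', Complex.ofReal_add, mul_add,
    Complex.exp_add, add_pow, Fin.sum_univ_eq_sum_range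
      (fun i => phgTerm (z, i) x * ((p.choose i : ℂ) * phgTerm (z, p - i) t)), Finset.mul_sum]
  refine Finset.sum_congr rfl fun i _ => ?_
  rw [phgTerm_eq_exp _ hx, phgTerm_eq_exp _ ht]
  ring

/-- Each term splits binomially into terms with the same `z` and lower powers of the logarithm,
which stay in `E`. The powers of `m` go into the coefficients, and the lower bound on the exponents
gives one weight for all of them. -/
theorem HasExp.comp_scale (hf : IsFace I r) {m : ℝ → ℝ} {n : ℝ → ℂ} (hm : IsScale I r m n)
    (h : HasExp E I r A F)
    (hA' : ∀ a ∈ A, ∀ z j, (z, j) ∈ E.carrier → ∀ c : ℂ,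
      (fun y => c * phgTerm (z, j) (m y) * a y) ∈ A') :
    HasExp E I r A' (fun x y => F (x * m y) y) := by
  obtain ⟨ι, q, a, M, hq, hfin, hA, ha, hN⟩ := h
  obtain ⟨m₀, hm₀⟩ := exists_nat_neg_lt_re hfin
  refine ⟨Σ k, Fin ((q k).2 + 1), fun k => ((q k.1).1, k.2),
    fun k y => ((q k.1).2.choose k.2 : ℂ) * phgTerm ((q k.1).1, (q k.1).2 - k.2) (m y) * a k.1 y,
    m₀ + M, ?_, ?_, ?_, ?_, ?_⟩
  · exact fun k => E.lower_log _ _ _ (hq k.1) (Nat.lt_succ_iff.1 k.2.2)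
  · intro C
    refine ((hfin C).toFinset.sigma fun k => (Finset.univ : Finset (Fin ((q k).2 + 1)))).finite_toSet.subset
      fun k hk => ?_
    exact Finset.mem_coe.2 (Finset.mem_sigma.2 ⟨(hfin C).mem_toFinset.2 hk, Finset.mem_univ _⟩)
  · exact fun k => hA' _ (hA _) _ _ (E.lower_log _ _ _ (hq k.1) (Nat.sub_le _ _)) _
  · intro k
    have := ((hm.conormal_phgTerm hf (hm₀ k.1) ((q k.1).2 - k.2)).const_mul hf
      ((q k.1).2.choose k.2 : ℂ)).mul_wt hf (ha k.1)
    rwa [add_zero] at this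
  · intro N
    obtain ⟨S, hS, hR⟩ := hN N
    refine ⟨S.sigma fun _ => Finset.univ, ?_, ?_⟩
    · exact fun k hk => Finset.mem_sigma.2 ⟨hS _ hk, Finset.mem_univ _⟩
    · refine ((hR.comp_scale_wt hf hm).mono (hf.wt_mono le_rfl (Nat.le_add_left M m₀))).congr
        hf.isOpen ?_
      filter_upwards [eventually_pos_lt one_pos] with x hx y hy
      rw [Finset.sum_sigma]
      congr 1
      refine Finset.sum_congr rfl fun k _ => ?_
      have e := phgTerm_mul (q k).1 (q k).2 hx.1 (hm.pos y hy)
      rw [Prod.mk.eta] at e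
      rw [e, Finset.sum_mul]
      refine Finset.sum_congr rfl fun i _ => ?_
      ring

/-- The terms with a given exponent are finite in number and are added up to a single coefficient,
which stays in `A` as `A` is closed under sums. -/
theorem HasExp.hasPhgExpansionAtFace (hf : IsFace I r) (h : HasExp E I r A F)
    (hA0 : (fun _ => 0) ∈ A) (hAadd : ∀ a ∈ A, ∀ b ∈ A, (fun y => a y + b y) ∈ A) :
    HasPhgExpansionAtFace E I r A F := by
  classical
  obtain ⟨ι, q, a, M, hq, hfin, hA, ha, hN⟩ := h
  have hfib : ∀ e : ℂ × ℕ, {k | q k = e}.Finite := fun e =>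
    (hfin e.1.re).subset fun k hk => by
      rw [mem_ofPred_eq] at hk ⊢
      rw [hk]
  have hsum : ∀ S : Finset ι, (fun y => ∑ k ∈ S, a k y) ∈ A := by
    intro S
    induction S using Finset.induction_on with
    | empty => simpa using hA0
    | insert k S hk ih =>
      simp only [Finset.sum_insert hk]
      exact hAadd _ (hA k) _ ih
  refine ⟨fun e y => ∑ k ∈ (hfib e).toFinset, a k y, fun e _ => hsum _, M, fun N i j => ?_⟩
  obtain ⟨S, hS, hR⟩ := hN N
  -- The set `S` may contain terms beyond order `N`; they are moved into the remainder.
  have hT : Conormal I r (wt r N M) (fun x y => ∑ k ∈ S.filter fun k => ¬(q k).1.re ≤ N,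
      phgTerm (q k) x * a k y) :=
    conormal_sum_terms hf _ (fun k hk => not_le.1 (Finset.mem_filter.1 hk).2) ha
  have key : ∀ x y, ∑ e ∈ E.upTo N, phgTerm e x * ∑ k ∈ (hfib e).toFinset, a k y =
      ∑ k ∈ S.filter fun k => (q k).1.re ≤ N, phgTerm (q k) x * a k y := by
    intro x y
    rw [← Finset.sum_fiberwise_of_maps_to (s := S.filter fun k => (q k).1.re ≤ N) (t := E.upTo N)
      (g := q)]
    · refine Finset.sum_congr rfl fun e he => ?_
      rw [Finset.mul_sum]
      have hset : (hfib e).toFinset = {k ∈ S.filter fun k => (q k).1.re ≤ N | q k = e} := by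
        ext k
        simp only [Finite.mem_toFinset, mem_ofPred_eq, Finset.mem_filter]
        refine ⟨fun hk => ?_, fun hk => hk.2⟩
        have hre : (q k).1.re ≤ N := by
          rw [hk]
          exact ((E.finite_le N).mem_toFinset.1 he).2
        exact ⟨⟨hS k hre, hre⟩, hk⟩
      rw [hset]
      refine Finset.sum_congr rfl fun k hk => ?_
      rw [(Finset.mem_filter.1 hk).2]
    · intro k hk
      exact (E.finite_le N).mem_toFinset.2 ⟨hq k, (Finset.mem_filter.1 hk).2⟩
  obtain ⟨C, hC⟩ := (hR.add hf.isOpen hf.smooth hT).2 i j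
  obtain ⟨δ, hδ, hC⟩ := eventually_Ioo_iff.1 hC
  refine ⟨C, δ, hδ, fun x hx y hy => ?_⟩
  have hfun : (fun x y => F x y - ∑ e ∈ E.upTo N, phgTerm e x * ∑ k ∈ (hfib e).toFinset, a k y) =
      (fun x y => F x y - ∑ k ∈ S, phgTerm (q k) x * a k y) +
      fun x y => ∑ k ∈ S.filter fun k => ¬(q k).1.re ≤ N, phgTerm (q k) x * a k y := by
    funext x y
    rw [key, Pi.add_apply, Pi.add_apply,
      ← Finset.sum_filter_add_sum_filter_not S fun k => (q k).1.re ≤ N]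
    ring
  rw [hfun]
  refine (hC x hx y hy).trans_eq ?_
  rw [wt, Real.rpow_natCast, mul_assoc]

/-- The set of constant functions. -/
def constFunctions : Set (ℝ → ℂ) := {a | ∃ c : ℂ, a = fun _ => c}

theorem bDerivNormal_iterate_fst (g : ℝ → ℂ) (i : ℕ) :
    bDerivNormal^[i] (fun x _ => g x) = fun x _ => (bDeriv id)^[i] g x := by
  induction i generalizing g with
  | zero => rfl
  | succ i ih => exact ih (bDeriv id g)

theorem isFace_Ioo_one : IsFace (Ioo 0 1) id :=
  ⟨isOpen_Ioo, contDiff_id.contDiffOn, fun _ hy => hy.1, fun _ hy => hy.2.le⟩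

/-- A function of `x` alone is treated as constant along a face. Evaluating at one point `y` turns
the weight into a constant. -/
theorem HasExp.hasPhgExpansionAtZero (hf : IsFace I r) (hI : I.Nonempty) {g : ℝ → ℂ}
    (h : HasExp E I r constFunctions fun x _ => g x) : HasPhgExpansionAtZero E g := by
  obtain ⟨y, hy⟩ := hI
  obtain ⟨a, ha, M, hN⟩ := h.hasPhgExpansionAtFace hf ⟨0, rfl⟩ <| by
    rintro _ ⟨c, rfl⟩ _ ⟨d, rfl⟩
    exact ⟨c + d, rfl⟩
  choose! c hc using ha
  refine ⟨c, fun N i => ?_⟩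
  obtain ⟨C, δ, hδ, hC⟩ := hN N i 0
  refine ⟨C * (r y ^ M)⁻¹, δ, hδ, fun x hx => ?_⟩
  have h := hC x hx y hy
  have e : (fun x y => g x - ∑ q ∈ E.upTo N, phgTerm q x * a q y) =
      fun x _ => g x - ∑ q ∈ E.upTo N, phgTerm q x * c q := by
    funext x y
    congr 1
    refine Finset.sum_congr rfl fun q hq => ?_
    rw [hc q ((E.finite_le N).mem_toFinset.1 hq).1]
  rw [Function.iterate_zero, id, e, bDerivNormal_iterate_fst] at h
  exact h.trans_eq (by ring)

/-- Expansions in the sense of `HasExp` from expansions indexed by the index set itself. -/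
theorem HasExp.of_upTo (hf : IsFace I r) {a : ℂ × ℕ → ℝ → ℂ} (hA : ∀ q ∈ E.carrier, a q ∈ A)
    {M : ℕ} (ha : ∀ q ∈ E.carrier, Conormal I r (wt r 0 M) fun _ y => a q y)
    (hF : SmoothNear I F)
    (hN : ∀ N i j : ℕ, BoundNear I (wt r N M) (bDerivNormal^[i] ((bDerivTangent r)^[j]
      (fun x y => F x y - ∑ q ∈ E.upTo N, phgTerm q x * a q y)))) : HasExp E I r A F := by
  classical
  refine ⟨E.carrier, Subtype.val, fun k => a k, M, fun k => k.2, fun C => ?_, fun k => hA _ k.2,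
    fun k => ha _ k.2, fun N => ⟨(E.upTo N).subtype (· ∈ E.carrier), ?_, ?_⟩⟩
  · refine Finite.of_finite_image ((E.finite_le C).subset ?_) Subtype.val_injective.injOn
    rintro _ ⟨k, hk, rfl⟩
    exact ⟨k.2, hk⟩
  · intro k hk
    exact Finset.mem_subtype.2 ((E.finite_le N).mem_toFinset.2 ⟨k.2, hk⟩)
  · have e : ∀ x y, ∑ k ∈ (E.upTo N).subtype (· ∈ E.carrier), phgTerm k x * a k y =
        ∑ q ∈ E.upTo N, phgTerm q x * a q y := fun x y =>
      Finset.sum_subtype_of_mem (fun q => phgTerm q x * a q y) fun q hq =>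
        ((E.finite_le N).mem_toFinset.1 hq).1
    simp only [e]
    refine ⟨?_, hN N⟩
    -- Only the smoothness of the partial sum is used, so any exponent below all the real parts that
    -- occur will do.
    have hs : Conormal I r (wt r (-(N + 1 : ℕ) - ∑ q ∈ E.upTo N, |q.1.re|) M)
        fun x y => ∑ q ∈ E.upTo N, phgTerm q x * a q y := by
      refine Conormal.sum hf _ fun q hq => conormal_term hf ?_
        (ha q ((E.finite_le N).mem_toFinset.1 hq).1)
      have h1 := Finset.single_le_sum (f := fun q : ℂ × ℕ => |q.1.re|)
        (fun q _ => abs_nonneg _) hq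
      have h2 := neg_abs_le q.1.re
      have h3 : (0 : ℝ) < (N + 1 : ℕ) := by positivity
      linarith
    refine (hF.add (hs.const_mul hf (-1)).1).congr (.of_forall fun x y _ => ?_)
    simp [sub_eq_add_neg]

/-- Meant for a part `I'` of the face away from the corner, where the coefficients are bounded with
all derivatives. -/
theorem HasExp.of_hasPhgExpansionAtFace (hf : IsFace I' r) (hI : I' ⊆ I)
    (h : HasPhgExpansionAtFace E I r A F) (hF : SmoothNear I' F)
    (hA : ∀ a ∈ A, Conormal I' r (wt r 0 0) fun _ y => a y) : HasExp E I' r A F := by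
  obtain ⟨a, ha, M, hN⟩ := h
  refine HasExp.of_upTo hf ha (M := M)
    (fun q hq => (hA _ (ha q hq)).mono (hf.wt_mono le_rfl (Nat.zero_le M))) hF fun N i j => ?_
  obtain ⟨C, δ, hδ, hC⟩ := hN N i j
  refine ⟨C, eventually_Ioo_iff.2 ⟨δ, hδ, fun x hx y hy => ?_⟩⟩
  rw [wt, Real.rpow_natCast, ← mul_assoc]
  exact hC x hx y (hI hy)

theorem IsFace.conormal_const_wt (hf : IsFace I r) (c : ℂ) (M : ℕ) :
    Conormal I r (wt r 0 M) fun _ _ => c := by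
  have e : (fun _ _ => 1) = wt r 0 0 := by funext x y; simp [wt]
  have := conormal_const (r := r) hf.isOpen c
  rw [e] at this
  exact this.mono (hf.wt_mono le_rfl (Nat.zero_le M))

theorem HasPhgExpansionAtZero.hasExp (hf : IsFace I r) {g : ℝ → ℂ} (h : HasPhgExpansionAtZero E g)
    {δ : ℝ} (hδ : 0 < δ) (hg : ContDiffOn ℝ ∞ g (Ioo 0 δ)) :
    HasExp E I r constFunctions fun x _ => g x := by
  obtain ⟨c, hc⟩ := h
  refine HasExp.of_upTo hf (a := fun q _ => c q) (M := 0) (fun q _ => ⟨c q, rfl⟩)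
    (fun q _ => hf.conormal_const_wt _ _) (smoothNear_of_fst hδ hg) fun N i j => ?_
  cases j with
  | zero =>
    obtain ⟨C, δ, hδ, hC⟩ := hc N i
    refine ⟨C, eventually_Ioo_iff.2 ⟨δ, hδ, fun x hx y _ => ?_⟩⟩
    rw [Function.iterate_zero, id,
      bDerivNormal_iterate_fst fun x => g x - ∑ q ∈ E.upTo N, phgTerm q x * c q]
    simpa [wt] using hC x hx
  | succ j =>
    have := (conormal_zero (r := r) (w := wt r N 0) hf.isOpen).2 i j
    rwa [Function.iterate_succ_apply, bDerivTangent_of_fst fun x =>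
      g x - ∑ q ∈ E.upTo N, phgTerm q x * c q]

theorem hasExp_term (hf : IsFace I r) {q : ℂ × ℕ} (hq : q ∈ E.carrier) {a : ℝ → ℂ} {M : ℕ}
    (ha : Conormal I r (wt r 0 M) fun _ y => a y) :
    HasExp E I r {a} fun x y => phgTerm q x * a y := by
  refine ⟨Unit, fun _ => q, fun _ => a, M, fun _ => hq, fun C => toFinite _, fun _ => rfl,
    fun _ => ha, fun N => ⟨Finset.univ, fun _ _ => Finset.mem_univ _, ?_⟩⟩
  simpa using conormal_zero hf.isOpen

theorem hasExp_snd (hf : IsFace I r) {a : ℝ → ℂ} {M : ℕ}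
    (ha : Conormal I r (wt r 0 M) fun _ y => a y) : HasExp natIndex I r {a} fun _ y => a y := by
  have := hasExp_term hf (E := natIndex) (q := (0, 0)) ⟨rfl, 0, by simp⟩ ha
  simpa [phgTerm] using this

theorem analyticAt_dslope {f : ℝ → ℂ} (hf : AnalyticAt ℝ f 0) : AnalyticAt ℝ (dslope f 0) 0 := by
  obtain ⟨p, hp⟩ := hf
  exact ⟨_, hp.has_fpower_series_dslope_fslope⟩

/-- Iterating `dslope` at `0` gives Taylor polynomials whose remainders are `x ^ n` times functions
that are again analytic at `0`. -/
theorem exists_taylor {f : ℝ → ℂ} (hf : AnalyticAt ℝ f 0) : ∃ (c : ℕ → ℂ) (g : ℕ → ℝ → ℂ),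
    (∀ n, AnalyticAt ℝ (g n) 0) ∧
      ∀ n x, f x = ∑ k ∈ Finset.range n, (x : ℂ) ^ k * c k + (x : ℂ) ^ n * g n x := by
  refine ⟨fun n => ((fun h => dslope h 0)^[n] f) 0, fun n => (fun h => dslope h 0)^[n] f, ?_, ?_⟩
  · intro n
    induction n with
    | zero => exact hf
    | succ n ih =>
      simp only [Function.iterate_succ_apply']
      exact analyticAt_dslope ih
  · intro n x
    induction n with
    | zero => simp
    | succ n ih =>
      set g := (fun h => dslope h 0)^[n] f with hg
      have h1 : g x = g 0 + x * dslope g 0 x := by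
        have := sub_smul_dslope g 0 x
        rw [sub_zero, Complex.real_smul] at this
        rw [this]
        ring
      simp only [ih, Finset.sum_range_succ, Function.iterate_succ_apply', ← hg, h1]
      ring

theorem hasExp_of_analyticAt (hf : IsFace I r) {f : ℝ → ℂ} (h : AnalyticAt ℝ f 0) :
    HasExp natIndex I r constFunctions fun x _ => f x := by
  obtain ⟨c, g, hg, hfg⟩ := exists_taylor h
  refine ⟨ℕ, fun n => (n, 0), fun n _ => c n, 0, fun n => ⟨rfl, n, rfl⟩, fun C => ?_,
    fun n => ⟨c n, rfl⟩, fun n => hf.conormal_const_wt _ _, fun N => ⟨Finset.range (N + 1), ?_, ?_⟩⟩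
  · refine (finite_le_nat ⌈C⌉₊).subset fun n hn => ?_
    simp only [mem_ofPred_eq, Complex.natCast_re] at hn
    exact_mod_cast hn.trans (Nat.le_ceil C)
  · intro n hn
    simp only [Complex.natCast_re, Nat.cast_le] at hn
    exact Finset.mem_range.2 (Nat.lt_succ_iff.2 hn)
  -- The expansion is taken one order further, since the conormal bound of a term asks for a real
  -- part strictly above `N`.
  · refine ((conormal_phgTerm_fst hf (z := (N + 1 : ℕ)) (N := N) ?_ 0).mul_bounded hf
      (conormal_of_analyticAt hf.isOpen (hg (N + 1)))).congr hf.isOpen ?_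
    · rw [Complex.natCast_re]
      push_cast
      linarith
    · refine .of_forall fun x y _ => ?_
      simp only [Pi.mul_apply, phgTerm_natCast]
      rw [hfg (N + 1) x]
      ring

end

/-! ### Smoothness of integrals depending on a parameter -/

/-- The primitive in the second variable, with base point `a`. -/
noncomputable def primitive (a : ℝ) (F : ℝ → ℝ → ℂ) : ℝ → ℝ → ℂ := fun x t => ∫ σ in a..t, F x σ

section Smooth

variable {U : Set ℝ} {a b c : ℝ} {F : ℝ → ℝ → ℂ}

theorem continuousOn_slice {S : Set (ℝ × ℝ)} {x : ℝ}
    (hF : ContinuousOn (fun p : ℝ × ℝ => F p.1 p.2) S) {J : Set ℝ} (hJ : ∀ t ∈ J, (x, t) ∈ S) :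
    ContinuousOn (F x) J :=
  hF.comp (f := fun t => (x, t)) (Continuous.prodMk_right x).continuousOn hJ

theorem hasDerivAt_slice (hU : IsOpen U)
    (hF : ContDiffOn ℝ 1 (fun p : ℝ × ℝ => F p.1 p.2) (U ×ˢ Icc a b)) {x t : ℝ} (hx : x ∈ U)
    (ht : t ∈ Icc a b) : HasDerivAt (fun x₁ => F x₁ t)
      (fderivWithin ℝ (fun p : ℝ × ℝ => F p.1 p.2) (U ×ˢ Icc a b) (x, t) (1, 0)) x := by
  have h1 := (hF.differentiableOn (by simp) (x, t) ⟨hx, ht⟩).hasFDerivWithinAt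
  have h2 : HasDerivWithinAt (fun x₁ : ℝ => (x₁, t)) (1, 0) U x :=
    ((hasDerivAt_id x).prodMk (hasDerivAt_const x t)).hasDerivWithinAt
  exact (h1.comp_hasDerivWithinAt (f := fun x₁ : ℝ => (x₁, t)) x h2
    fun x₁ hx₁ => ⟨hx₁, ht⟩).hasDerivAt (hU.mem_nhds hx)

theorem uniqueDiffOn_prod_Icc (hU : IsOpen U) (hab : a < b) : UniqueDiffOn ℝ (U ×ˢ Icc a b) :=
  hU.uniqueDiffOn.prod (uniqueDiffOn_Icc hab)

theorem uIcc_subset_Icc_of_mem {t : ℝ} (hc : c ∈ Icc a b) (ht : t ∈ Icc a b) :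
    uIcc c t ⊆ Icc a b := ordConnected_Icc.uIcc_subset hc ht

/-- Differentiation under the integral sign; the derivative is dominated by its maximum over a
compact neighbourhood in `x` times `[a, b]`. -/
theorem hasDerivAt_primitive_fst (hU : IsOpen U) (hab : a < b) (hc : c ∈ Icc a b)
    (hF : ContDiffOn ℝ 1 (fun p : ℝ × ℝ => F p.1 p.2) (U ×ˢ Icc a b)) {x t : ℝ} (hx : x ∈ U)
    (ht : t ∈ Icc a b) : HasDerivAt (fun x₁ => primitive c F x₁ t)
      (primitive c (fun x σ => fderivWithin ℝ (fun p : ℝ × ℝ => F p.1 p.2) (U ×ˢ Icc a b)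
        (x, σ) (1, 0)) x t) x := by
  have hsub := uIcc_subset_Icc_of_mem hc ht
  have hF' : ContinuousOn (fun p : ℝ × ℝ => fderivWithin ℝ (fun p : ℝ × ℝ => F p.1 p.2)
      (U ×ˢ Icc a b) p (1, 0)) (U ×ˢ Icc a b) :=
    (hF.continuousOn_fderivWithin (uniqueDiffOn_prod_Icc hU hab) le_rfl).clm_apply
      continuousOn_const
  obtain ⟨ε, hε, hball⟩ := Metric.nhds_basis_closedBall.mem_iff.1 (hU.mem_nhds hx)
  obtain ⟨C, hC⟩ := ((isCompact_closedBall x ε).prod isCompact_Icc).exists_bound_of_continuousOn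
    (hF'.mono (prod_mono hball (le_refl (Icc a b))))
  have hs : ∀ x ∈ U, ContinuousOn (F x) (uIcc c t) := fun x hx =>
    continuousOn_slice hF.continuousOn fun σ hσ => ⟨hx, hsub hσ⟩
  have hs' : ContinuousOn (fun σ => fderivWithin ℝ (fun p : ℝ × ℝ => F p.1 p.2)
      (U ×ˢ Icc a b) (x, σ) (1, 0)) (uIcc c t) :=
    hF'.comp (f := fun σ => (x, σ)) (Continuous.prodMk_right x).continuousOn
      fun σ hσ => ⟨hx, hsub hσ⟩
  refine (intervalIntegral.hasDerivAt_integral_of_dominated_loc_of_deriv_le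
    (μ := MeasureTheory.volume) (F := F) (F' := fun x σ => fderivWithin ℝ
      (fun p : ℝ × ℝ => F p.1 p.2) (U ×ˢ Icc a b) (x, σ) (1, 0)) (Metric.ball_mem_nhds x hε) ?_ (hs x hx).intervalIntegrable ?_ (bound := fun _ => C) ?_
    intervalIntegrable_const ?_).2
  · filter_upwards [hU.mem_nhds hx] with x₁ hx₁
    exact ((hs x₁ hx₁).mono uIoc_subset_uIcc).aestronglyMeasurable measurableSet_uIoc
  · exact (hs'.mono uIoc_subset_uIcc).aestronglyMeasurable measurableSet_uIoc
  · refine .of_forall fun σ hσ x₁ hx₁ => hC (x₁, σ) ⟨Metric.ball_subset_closedBall hx₁, ?_⟩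
    exact hsub (uIoc_subset_uIcc hσ)
  · refine .of_forall fun σ hσ x₁ hx₁ => ?_
    exact hasDerivAt_slice hU hF (hball (Metric.ball_subset_closedBall hx₁))
      (hsub (uIoc_subset_uIcc hσ))

/-- With the base point at `t` itself the primitive vanishes at `(x, t)`, and continuity of `F`
there gives the linear part. -/
theorem hasFDerivWithinAt_primitive_snd
    (hF : ContinuousOn (fun p : ℝ × ℝ => F p.1 p.2) (U ×ˢ Icc a b)) {x t : ℝ} (hx : x ∈ U)
    (ht : t ∈ Icc a b) : HasFDerivWithinAt (fun p : ℝ × ℝ => primitive t F p.1 p.2)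
      ((ContinuousLinearMap.snd ℝ ℝ ℝ).smulRight (F x t)) (U ×ˢ Icc a b) (x, t) := by
  refine .of_isLittleO (Asymptotics.isLittleO_iff.2 fun ε hε => ?_)
  obtain ⟨δ, hδ, h⟩ := Metric.continuousWithinAt_iff.1 (hF (x, t) ⟨hx, ht⟩) ε hε
  filter_upwards [self_mem_nhdsWithin, mem_nhdsWithin_of_mem_nhds (Metric.ball_mem_nhds (x, t) hδ)]
    with ⟨x₁, t₁⟩ ⟨hx₁, ht₁⟩ hd
  have hsub := uIcc_subset_Icc_of_mem ht ht₁
  have hi : IntervalIntegrable (F x₁) MeasureTheory.volume t t₁ :=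
    (continuousOn_slice hF fun σ hσ => ⟨hx₁, hsub hσ⟩).intervalIntegrable
  have e : primitive t F x₁ t₁ - primitive t F x t -
      ((ContinuousLinearMap.snd ℝ ℝ ℝ).smulRight (F x t)) ((x₁, t₁) - (x, t)) =
      ∫ σ in t..t₁, (F x₁ σ - F x t) := by
    rw [intervalIntegral.integral_sub hi intervalIntegrable_const]
    simp [primitive]
  rw [e]
  have hd' : dist x₁ x < δ ∧ dist t₁ t < δ := by
    simpa [Prod.dist_eq, max_lt_iff] using hd
  calc ‖∫ σ in t..t₁, (F x₁ σ - F x t)‖ ≤ ε * |t₁ - t| := by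
        refine intervalIntegral.norm_integral_le_of_norm_le_const fun σ hσ => ?_
        have hσ' := uIoc_subset_uIcc hσ
        have h2 : dist σ t < δ := by
          rw [Real.dist_eq]
          exact (abs_sub_left_of_mem_uIcc hσ').trans_lt hd'.2
        rw [← dist_eq_norm]
        refine (h (x := (x₁, σ)) ⟨hx₁, hsub hσ'⟩ ?_).le
        rw [Prod.dist_eq]
        exact max_lt hd'.1 h2
    _ ≤ ε * ‖(x₁, t₁) - (x, t)‖ := by
        refine mul_le_mul_of_nonneg_left ?_ hε.le
        exact norm_snd_le ((x₁, t₁) - (x, t))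

/-- Splitting the integral at the fixed `t` leaves a function of `x₁` alone plus a primitive based
at `t`. -/
theorem hasFDerivWithinAt_primitive (hU : IsOpen U) (hab : a < b) (hc : c ∈ Icc a b)
    (hF : ContDiffOn ℝ 1 (fun p : ℝ × ℝ => F p.1 p.2) (U ×ˢ Icc a b)) {x t : ℝ} (hx : x ∈ U)
    (ht : t ∈ Icc a b) : HasFDerivWithinAt (fun p : ℝ × ℝ => primitive c F p.1 p.2)
      ((ContinuousLinearMap.fst ℝ ℝ ℝ).smulRight (primitive c (fun x σ => fderivWithin ℝ
        (fun p : ℝ × ℝ => F p.1 p.2) (U ×ˢ Icc a b) (x, σ) (1, 0)) x t) +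
      (ContinuousLinearMap.snd ℝ ℝ ℝ).smulRight (F x t)) (U ×ˢ Icc a b) (x, t) := by
  have h1 : HasFDerivAt (fun p : ℝ × ℝ => primitive c F p.1 t) _ (x, t) :=
    HasFDerivAt.comp (g := fun x₁ => primitive c F x₁ t) (f := Prod.fst) (x, t)
      (hasDerivAt_primitive_fst hU hab hc hF hx ht).hasFDerivAt hasFDerivAt_fst
  have h2 := h1.hasFDerivWithinAt.add (hasFDerivWithinAt_primitive_snd hF.continuousOn hx ht)
  refine (h2.congr_fderiv ?_).congr ?_ ?_
  · ext <;> simp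
  · rintro ⟨x₁, t₁⟩ ⟨hx₁, ht₁⟩
    refine (intervalIntegral.integral_add_adjacent_intervals ?_ ?_).symm
    · exact (continuousOn_slice hF.continuousOn
        fun σ hσ => ⟨hx₁, uIcc_subset_Icc_of_mem hc ht hσ⟩).intervalIntegrable
    · exact (continuousOn_slice hF.continuousOn
        fun σ hσ => ⟨hx₁, uIcc_subset_Icc_of_mem ht ht₁ hσ⟩).intervalIntegrable
  · simp [primitive]

/-- The differential consists of `F` and the primitive of `∂F/∂x`, which allows induction on the
order of differentiability, up to the ends of `[a, b]`. -/
theorem contDiffOn_primitive (hU : IsOpen U) (hab : a < b) (hc : c ∈ Icc a b)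
    (hF : ContDiffOn ℝ ∞ (fun p : ℝ × ℝ => F p.1 p.2) (U ×ˢ Icc a b)) :
    ContDiffOn ℝ ∞ (fun p : ℝ × ℝ => primitive c F p.1 p.2) (U ×ˢ Icc a b) := by
  rw [contDiffOn_infty] at hF ⊢
  intro n
  induction n generalizing F with
  | zero =>
    refine contDiffOn_zero.2 fun ⟨x, t⟩ h => ?_
    exact (hasFDerivWithinAt_primitive hU hab hc (hF 1) h.1 h.2).continuousWithinAt
  | succ n ih =>
    have hu := uniqueDiffOn_prod_Icc (a := a) (b := b) hU hab
    push_cast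
    rw [contDiffOn_succ_iff_hasFDerivWithinAt_of_uniqueDiffOn hu]
    refine ⟨by simp, fun p => (ContinuousLinearMap.fst ℝ ℝ ℝ).smulRight (primitive c (fun x σ =>
        fderivWithin ℝ (fun p : ℝ × ℝ => F p.1 p.2) (U ×ˢ Icc a b) (x, σ) (1, 0)) p.1 p.2) +
      (ContinuousLinearMap.snd ℝ ℝ ℝ).smulRight (F p.1 p.2), ?_,
      fun ⟨x, t⟩ h => hasFDerivWithinAt_primitive hU hab hc (hF 1) h.1 h.2⟩
    have h1 := ih (F := fun x σ => fderivWithin ℝ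
        (fun p : ℝ × ℝ => F p.1 p.2) (U ×ˢ Icc a b) (x, σ) (1, 0)) fun m =>
      ((hF (m + 1)).fderivWithin hu (by simp)).clm_apply contDiffOn_const
    exact (contDiffOn_const.smulRight h1).add (contDiffOn_const.smulRight (hF n))

theorem contDiffOn_integral {g : ℝ → ℂ} (hab : a < b) (hc : c ∈ Icc a b)
    (hg : ContDiffOn ℝ ∞ g (Icc a b)) : ContDiffOn ℝ ∞ (fun t => ∫ σ in c..t, g σ) (Icc a b) := by
  have h := contDiffOn_primitive (U := univ) (F := fun _ σ => g σ) isOpen_univ hab hc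
    (hg.comp contDiffOn_snd fun _ hp => hp.2)
  exact h.comp (f := fun t : ℝ => ((0 : ℝ), t)) (contDiff_prodMk_right 0).contDiffOn
    fun t ht => ⟨mem_univ _, ht⟩

end Smooth

/-! ### Termwise integration away from the front face -/

section Expansion

variable {a b δ : ℝ} {F : ℝ → ℝ → ℂ}

theorem isFace_Ioo (ha : 0 < a) (hb : b ≤ 1) : IsFace (Ioo a b) id :=
  ⟨isOpen_Ioo, contDiff_id.contDiffOn, fun _ hy => ha.trans hy.1, fun _ hy => hy.2.le.trans hb⟩

theorem contDiffOn_bDerivNormal (hab : a < b)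
    (hF : ContDiffOn ℝ ∞ (fun p : ℝ × ℝ => F p.1 p.2) (Ioo 0 δ ×ˢ Icc a b)) :
    ContDiffOn ℝ ∞ (fun p : ℝ × ℝ => bDerivNormal F p.1 p.2) (Ioo 0 δ ×ˢ Icc a b) := by
  have hu := uniqueDiffOn_prod_Icc (U := Ioo 0 δ) (a := a) (b := b) isOpen_Ioo hab
  have h1 : ContDiffOn ℝ ∞ (fun p : ℝ × ℝ => (p.1 : ℂ) * fderivWithin ℝ
      (fun p : ℝ × ℝ => F p.1 p.2) (Ioo 0 δ ×ˢ Icc a b) p (1, 0)) (Ioo 0 δ ×ˢ Icc a b) :=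
    (Complex.ofRealCLM.contDiff.comp contDiff_fst).contDiffOn.mul
      ((hF.fderivWithin hu (by simp)).clm_apply contDiffOn_const)
  refine h1.congr fun ⟨x, t⟩ h => ?_
  simp only [bDerivNormal, bDeriv, id,
    (hasDerivAt_slice isOpen_Ioo (hF.of_le (by simp)) h.1 h.2).deriv]

theorem bDerivNormal_primitive (hab : a < b)
    (hF : ContDiffOn ℝ ∞ (fun p : ℝ × ℝ => F p.1 p.2) (Ioo 0 δ ×ˢ Icc a b)) {x t : ℝ}
    (hx : x ∈ Ioo 0 δ) (ht : t ∈ Icc a b) :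
    bDerivNormal (primitive a F) x t = primitive a (bDerivNormal F) x t := by
  have hF1 : ContDiffOn ℝ 1 _ _ := hF.of_le (by simp)
  have ha := left_mem_Icc.2 hab.le
  simp only [bDerivNormal, bDeriv, id,
    (hasDerivAt_primitive_fst isOpen_Ioo hab ha hF1 hx ht).deriv]
  rw [primitive, primitive, ← intervalIntegral.integral_const_mul]
  refine intervalIntegral.integral_congr fun σ hσ => ?_
  simp only [bDerivNormal, bDeriv, id,
    (hasDerivAt_slice isOpen_Ioo hF1 hx (uIcc_subset_Icc_of_mem ha ht hσ)).deriv]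

theorem bDerivTangent_primitive
    (hF : ContDiffOn ℝ ∞ (fun p : ℝ × ℝ => F p.1 p.2) (Ioo 0 δ ×ˢ Icc a b)) {x t : ℝ}
    (hx : x ∈ Ioo 0 δ) (ht : t ∈ Ioo a b) :
    bDerivTangent id (primitive a F) x t = t * F x t := by
  have hc : ContinuousOn (F x) (Icc a b) := continuousOn_slice hF.continuousOn fun σ hσ => ⟨hx, hσ⟩
  have hn : Icc a b ∈ 𝓝 t := Icc_mem_nhds ht.1 ht.2
  have : HasDerivAt (primitive a F x) (F x t) t := by
    refine intervalIntegral.integral_hasDerivAt_right ?_ ?_ (hc.continuousAt hn)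
    · exact (hc.mono (uIcc_subset_Icc_of_mem (left_mem_Icc.2 (ht.1.trans ht.2).le)
        (Ioo_subset_Icc_self ht))).intervalIntegrable
    · exact hc.stronglyMeasurableAtFilter_nhdsWithin measurableSet_Icc t |>.filter_mono
        (le_of_eq (nhdsWithin_eq_nhds.2 hn).symm)
  simp only [bDerivTangent, bDeriv, id, this.deriv]

theorem exists_bound_primitive (ha : 0 < a) {N M : ℕ}
    (hB : BoundNear (Ioo a b) (wt id N M) F) :
    ∃ C : ℝ, ∀ᶠ x in 𝓝[>] (0 : ℝ), ∀ t ∈ Icc a b, ‖primitive a F x t‖ ≤ C * x ^ N := by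
  obtain ⟨C, hC⟩ := hB
  refine ⟨|C| * (a ^ M)⁻¹ * (b - a), ?_⟩
  filter_upwards [hC, eventually_pos_lt one_pos] with x hx hx1 t ht
  have hpos : 0 ≤ |C| * (a ^ M)⁻¹ * x ^ N := by
    have := hx1.1
    positivity
  calc ‖primitive a F x t‖ ≤ |C| * (a ^ M)⁻¹ * x ^ N * |t - a| := by
        refine intervalIntegral.norm_integral_le_of_norm_le_const_ae ?_
        -- The bound on `F` is known on the open interval only, so the endpoint `b` is discarded as
        -- a null set.
        filter_upwards [MeasureTheory.Measure.ae_ne MeasureTheory.volume b] with σ hσb hσ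
        rw [uIoc_of_le ht.1] at hσ
        have hσ' : σ ∈ Ioo a b := ⟨hσ.1, lt_of_le_of_ne (hσ.2.trans ht.2) hσb⟩
        have h1 : (σ ^ M)⁻¹ ≤ (a ^ M)⁻¹ :=
          inv_anti₀ (pow_pos ha M) (pow_le_pow_left₀ ha.le hσ.1.le M)
        have h2 : (0 : ℝ) ≤ x ^ N := pow_nonneg hx1.1.le _
        have h3 : (0 : ℝ) ≤ (σ ^ M)⁻¹ := inv_nonneg.2 (pow_nonneg (ha.trans hσ.1).le _)
        calc ‖F x σ‖ ≤ C * wt id N M x σ := hx σ hσ'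
          _ = C * (x ^ N * (σ ^ M)⁻¹) := by rw [wt, Real.rpow_natCast, id]
          _ ≤ |C| * (x ^ N * (σ ^ M)⁻¹) :=
            mul_le_mul_of_nonneg_right (le_abs_self C) (mul_nonneg h2 h3)
          _ ≤ |C| * (x ^ N * (a ^ M)⁻¹) :=
            mul_le_mul_of_nonneg_left (mul_le_mul_of_nonneg_left h1 h2) (abs_nonneg C)
          _ = |C| * (a ^ M)⁻¹ * x ^ N := by ring
    _ ≤ |C| * (a ^ M)⁻¹ * x ^ N * (b - a) := by
        refine mul_le_mul_of_nonneg_left ?_ hpos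
        rw [abs_of_nonneg (sub_nonneg.2 ht.1)]
        linarith [ht.2]
    _ = _ := by ring

theorem le_wt_id (ha : 0 < a) (hb : b ≤ 1) {N M : ℕ} {x t : ℝ} (hx : 0 < x) (ht : t ∈ Ioo a b) :
    x ^ N ≤ wt id N M x t := by
  rw [wt, Real.rpow_natCast]
  refine le_mul_of_one_le_right (pow_nonneg hx.le _) ((one_le_inv₀ ?_).2 ?_)
  · exact pow_pos (ha.trans ht.1) _
  · exact pow_le_one₀ (ha.trans ht.1).le (ht.2.le.trans hb)

theorem boundNear_of_le_pow (ha : 0 < a) (hb : b ≤ 1) {N M : ℕ} {C : ℝ}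
    (hC : ∀ᶠ x in 𝓝[>] (0 : ℝ), ∀ t ∈ Ioo a b, ‖F x t‖ ≤ C * x ^ N) :
    BoundNear (Ioo a b) (wt id N M) F := by
  refine ⟨|C|, ?_⟩
  filter_upwards [hC, eventually_pos_lt one_pos] with x hx hx1 t ht
  calc ‖F x t‖ ≤ C * x ^ N := hx t ht
    _ ≤ |C| * x ^ N := mul_le_mul_of_nonneg_right (le_abs_self C) (pow_nonneg hx1.1.le _)
    _ ≤ |C| * wt id N M x t := mul_le_mul_of_nonneg_left (le_wt_id ha hb hx1.1 ht) (abs_nonneg C)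

theorem conormal_id (hab : a < b) :
    Conormal (Ioo a b) id (fun _ _ => 1) (fun _ y => (y : ℂ)) :=
  conormal_of_contDiffOn_Icc hab contDiff_id.contDiffOn Complex.ofRealCLM.contDiff.contDiffOn

/-- The field `x ∂/∂x` passes under the integral, while `t ∂/∂t` of the primitive is `t * F`, which
is already conormal. Since `a > 0`, the weight in `t` is harmless. -/
theorem Conormal.primitive (ha : 0 < a) (hab : a < b) (hb : b ≤ 1) (hδ : 0 < δ) {N M : ℕ}
    (hF : ContDiffOn ℝ ∞ (fun p : ℝ × ℝ => F p.1 p.2) (Ioo 0 δ ×ˢ Icc a b))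
    (h : Conormal (Ioo a b) id (wt id N M) F) :
    Conormal (Ioo a b) id (wt id N M) (primitive a F) := by
  have hf := isFace_Ioo ha hb
  refine Conormal.of_stable hf.isOpen (fun G => (∃ F : ℝ → ℝ → ℂ,
    ContDiffOn ℝ ∞ (fun p : ℝ × ℝ => F p.1 p.2) (Ioo 0 δ ×ˢ Icc a b) ∧
    Conormal (Ioo a b) id (wt id N M) F ∧ G = _root_.primitive a F) ∨
    Conormal (Ioo a b) id (wt id N M) G) ?_ ?_ ?_ ?_ (.inl ⟨F, hF, h, rfl⟩)
  · rintro _ (⟨F, hF, h, rfl⟩ | h)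
    · exact ⟨δ, hδ, (contDiffOn_primitive isOpen_Ioo hab (left_mem_Icc.2 hab.le) hF).mono
        (prod_mono le_rfl Ioo_subset_Icc_self)⟩
    · exact h.1
  · rintro _ (⟨F, hF, h, rfl⟩ | h)
    · obtain ⟨C, hC⟩ := exists_bound_primitive ha (h.2 0 0)
      exact boundNear_of_le_pow ha hb (hC.mono fun x hx t ht => hx t (Ioo_subset_Icc_self ht))
    · exact h.2 0 0
  · rintro _ (⟨F, hF, h, rfl⟩ | h)
    · refine ⟨_, .inl ⟨_, contDiffOn_bDerivNormal hab hF, h.normal hf.isOpen hf.smooth, rfl⟩, ?_⟩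
      filter_upwards [eventually_pos_lt hδ] with x hx t ht
      exact bDerivNormal_primitive hab hF hx (Ioo_subset_Icc_self ht)
    · exact ⟨_, .inr (h.normal hf.isOpen hf.smooth), .refl _ _⟩
  · rintro _ (⟨F, hF, h, rfl⟩ | h)
    · refine ⟨_, .inr (h.mul_bounded hf (conormal_id hab)), ?_⟩
      filter_upwards [eventually_pos_lt hδ] with x hx t ht
      rw [bDerivTangent_primitive hF hx ht, Pi.mul_apply, Pi.mul_apply, mul_comm]
    · exact ⟨_, .inr (h.tangent hf.isOpen hf.smooth), .refl _ _⟩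

theorem Conormal.integral (ha : 0 < a) (hab : a < b) (hb : b ≤ 1) (hδ : 0 < δ) {N M : ℕ}
    (hF : ContDiffOn ℝ ∞ (fun p : ℝ × ℝ => F p.1 p.2) (Ioo 0 δ ×ˢ Icc a b))
    (h : Conormal (Ioo a b) id (wt id N M) F) :
    Conormal (Ioo a b) id (wt id N M) (fun x _ => _root_.primitive a F x b) := by
  have hf := isFace_Ioo ha hb
  have hbm := right_mem_Icc.2 hab.le
  refine Conormal.of_stable hf.isOpen (fun G => ∃ F : ℝ → ℝ → ℂ,
    ContDiffOn ℝ ∞ (fun p : ℝ × ℝ => F p.1 p.2) (Ioo 0 δ ×ˢ Icc a b) ∧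
    Conormal (Ioo a b) id (wt id N M) F ∧ G = fun x _ => _root_.primitive a F x b)
    ?_ ?_ ?_ ?_ ⟨F, hF, h, rfl⟩
  · rintro _ ⟨F, hF, h, rfl⟩
    have := contDiffOn_primitive isOpen_Ioo hab (left_mem_Icc.2 hab.le) hF
    exact smoothNear_of_fst hδ (this.comp (f := fun x : ℝ => (x, b))
      (contDiff_prodMk_left b).contDiffOn fun x hx => ⟨hx, hbm⟩)
  · rintro _ ⟨F, hF, h, rfl⟩
    obtain ⟨C, hC⟩ := exists_bound_primitive ha (h.2 0 0)
    exact boundNear_of_le_pow ha hb (hC.mono fun x hx t _ => hx b hbm)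
  · rintro _ ⟨F, hF, h, rfl⟩
    refine ⟨_, ⟨_, contDiffOn_bDerivNormal hab hF, h.normal hf.isOpen hf.smooth, rfl⟩, ?_⟩
    filter_upwards [eventually_pos_lt hδ] with x hx t _
    exact bDerivNormal_primitive hab hF hx hbm
  · rintro _ ⟨F, hF, h, rfl⟩
    refine ⟨_, ⟨fun _ _ => 0, contDiffOn_const, conormal_zero hf.isOpen, rfl⟩, ?_⟩
    rw [bDerivTangent_of_fst]
    exact .of_forall fun x y _ => by simp [_root_.primitive]

/-- The functions that are smooth on a closed interval. -/
def smoothIcc (a b : ℝ) : Set (ℝ → ℂ) := {g | ContDiffOn ℝ ∞ g (Icc a b)}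

theorem contDiffOn_remainder {ι : Type*} (q : ι → ℂ × ℕ) {g : ι → ℝ → ℂ}
    (hg : ∀ k, g k ∈ smoothIcc a b) (S : Finset ι)
    (hF : ContDiffOn ℝ ∞ (fun p : ℝ × ℝ => F p.1 p.2) (Ioo 0 δ ×ˢ Icc a b)) :
    ContDiffOn ℝ ∞ (fun p : ℝ × ℝ => F p.1 p.2 - ∑ k ∈ S, phgTerm (q k) p.1 * g k p.2)
      (Ioo 0 δ ×ˢ Icc a b) :=
  hF.sub (ContDiffOn.sum fun k _ => ((contDiffOn_phgTerm (q k)).comp contDiffOn_fst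
    fun _ hp => hp.1.1).mul ((hg k).comp contDiffOn_snd fun _ hp => hp.2))

theorem primitive_remainder {ι : Type*} (q : ι → ℂ × ℕ) {g : ι → ℝ → ℂ}
    (hg : ∀ k, g k ∈ smoothIcc a b) (S : Finset ι)
    (hF : ContDiffOn ℝ ∞ (fun p : ℝ × ℝ => F p.1 p.2) (Ioo 0 δ ×ˢ Icc a b)) {x t : ℝ}
    (hx : x ∈ Ioo 0 δ) (ht : t ∈ Icc a b) :
    primitive a (fun x t => F x t - ∑ k ∈ S, phgTerm (q k) x * g k t) x t =
      primitive a F x t - ∑ k ∈ S, phgTerm (q k) x * ∫ σ in a..t, g k σ := by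
  have hsub := uIcc_subset_Icc_of_mem (left_mem_Icc.2 (ht.1.trans ht.2)) ht
  have hi : ∀ k ∈ S, IntervalIntegrable (fun t => phgTerm (q k) x * g k t)
      MeasureTheory.volume a t := fun k _ =>
    (((hg k).continuousOn.mono hsub).intervalIntegrable).const_mul _
  have hs := IntervalIntegrable.sum S hi
  rw [Finset.sum_fn] at hs
  simp only [primitive]
  rw [intervalIntegral.integral_sub _ hs, intervalIntegral.integral_finsetSum hi]
  · simp only [intervalIntegral.integral_const_mul]
  · exact (continuousOn_slice hF.continuousOn fun σ hσ => ⟨hx, hsub hσ⟩).intervalIntegrable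

variable {E : IndexSet}

theorem conormal_of_smoothIcc (hab : a < b) {g : ℝ → ℂ} (hg : g ∈ smoothIcc a b) :
    Conormal (Ioo a b) id (wt id 0 0) fun _ y => g y := by
  have e : (fun _ _ => 1) = wt id 0 0 := by funext x y; simp [wt]
  rw [← e]
  exact conormal_of_contDiffOn_Icc hab contDiff_id.contDiffOn hg

/-- Coefficients and remainders are integrated separately. The new coefficients are smooth on the
closed interval, hence bounded with all derivatives. -/
theorem HasExp.primitive (ha : 0 < a) (hab : a < b) (hb : b ≤ 1) (hδ : 0 < δ)
    (hF : ContDiffOn ℝ ∞ (fun p : ℝ × ℝ => F p.1 p.2) (Ioo 0 δ ×ˢ Icc a b))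
    (h : HasExp E (Ioo a b) id (smoothIcc a b) F) :
    HasExp E (Ioo a b) id (smoothIcc a b) (primitive a F) := by
  have hf := isFace_Ioo ha hb
  obtain ⟨ι, q, g, M, hq, hfin, hA, -, hN⟩ := h
  have hg : ∀ k, (fun t => ∫ σ in a..t, g k σ) ∈ smoothIcc a b := fun k =>
    contDiffOn_integral hab (left_mem_Icc.2 hab.le) (hA k)
  refine ⟨ι, q, fun k t => ∫ σ in a..t, g k σ, M, hq, hfin, hg,
    fun k => (conormal_of_smoothIcc hab (hg k)).mono (hf.wt_mono le_rfl (Nat.zero_le M)),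
    fun N => ?_⟩
  obtain ⟨S, hS, hR⟩ := hN N
  refine ⟨S, hS, (hR.primitive ha hab hb hδ (contDiffOn_remainder q hA S hF)).congr hf.isOpen ?_⟩
  filter_upwards [eventually_pos_lt hδ] with x hx t ht
  exact primitive_remainder q hA S hF hx (Ioo_subset_Icc_self ht)

theorem HasExp.integral (ha : 0 < a) (hab : a < b) (hb : b ≤ 1) (hδ : 0 < δ)
    (hF : ContDiffOn ℝ ∞ (fun p : ℝ × ℝ => F p.1 p.2) (Ioo 0 δ ×ˢ Icc a b))
    (h : HasExp E (Ioo a b) id (smoothIcc a b) F) :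
    HasExp E (Ioo a b) id constFunctions (fun x _ => _root_.primitive a F x b) := by
  have hf := isFace_Ioo ha hb
  obtain ⟨ι, q, g, M, hq, hfin, hA, -, hN⟩ := h
  refine ⟨ι, q, fun k _ => ∫ σ in a..b, g k σ, M, hq, hfin, fun k => ⟨_, rfl⟩,
    fun k => hf.conormal_const_wt _ _, fun N => ?_⟩
  obtain ⟨S, hS, hR⟩ := hN N
  refine ⟨S, hS, (hR.integral ha hab hb hδ (contDiffOn_remainder q hA S hF)).congr hf.isOpen ?_⟩
  filter_upwards [eventually_pos_lt hδ] with x hx t ht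
  exact primitive_remainder q hA S hF hx (right_mem_Icc.2 hab.le)

end Expansion

/-! ### The explicit solution: symmetry, support and smoothness -/

/-- The even solution `√(τ² + ℓ²)` of the homogeneous equation. -/
noncomputable def rad (ℓ τ : ℝ) : ℝ := √(τ ^ 2 + ℓ ^ 2)

/-- The quotient of the odd and the even solution of the homogeneous equation. -/
noncomputable def angle (ℓ τ : ℝ) : ℝ := Real.arctan (τ / ℓ) + ℓ * τ / (τ ^ 2 + ℓ ^ 2)

/-- The first step of the reduction of order. -/
noncomputable def reducedSource (h : ℝ → ℝ → ℂ) : ℝ → ℝ → ℂ :=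
  fun ℓ τ => (rad ℓ τ : ℂ) * h ℓ τ

/-- The derivative of the quotient of a particular solution and `rad`, up to sign. -/
noncomputable def reducedSlope (b : ℝ) (h : ℝ → ℝ → ℂ) : ℝ → ℝ → ℂ :=
  fun ℓ τ => ((((τ ^ 2 + ℓ ^ 2) ^ 2)⁻¹ : ℝ) : ℂ) * primitive b (reducedSource h) ℓ τ

/-- The solution of the inhomogeneous equation with vanishing Cauchy data at `τ = b`. -/
noncomputable def particular (b : ℝ) (h : ℝ → ℝ → ℂ) : ℝ → ℝ → ℂ :=
  fun ℓ τ => -(rad ℓ τ : ℂ) * primitive b (reducedSlope b h) ℓ τ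

/-- The coefficient of the even solution. -/
noncomputable def evenCoeff (h : ℝ → ℝ → ℂ) (ηp ηm : ℝ → ℂ) : ℝ → ℂ := fun ℓ =>
  ((ηp ℓ - particular 0 h ℓ 1) + (ηm ℓ - particular 0 h ℓ (-1))) * (((2 * rad ℓ 1)⁻¹ : ℝ) : ℂ)

/-- The coefficient of the odd solution. -/
noncomputable def oddCoeff (h : ℝ → ℝ → ℂ) (ηp ηm : ℝ → ℂ) : ℝ → ℂ := fun ℓ =>
  ((ηp ℓ - particular 0 h ℓ 1) - (ηm ℓ - particular 0 h ℓ (-1))) *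
    (((2 * rad ℓ 1 * angle ℓ 1)⁻¹ : ℝ) : ℂ)

/-- The part of the solution of the Dirichlet problem that solves the homogeneous equation. -/
noncomputable def homogeneousPart (h : ℝ → ℝ → ℂ) (ηp ηm : ℝ → ℂ) : ℝ → ℝ → ℂ := fun ℓ τ =>
  evenCoeff h ηp ηm ℓ * (rad ℓ τ : ℂ) + oddCoeff h ηp ηm ℓ * ((rad ℓ τ * angle ℓ τ : ℝ) : ℂ)

/-- The solution of the Dirichlet problem. -/
noncomputable def dirichletSolution (h : ℝ → ℝ → ℂ) (ηp ηm : ℝ → ℂ) : ℝ → ℝ → ℂ := fun ℓ τ =>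
  homogeneousPart h ηp ηm ℓ τ + particular 0 h ℓ τ

section Reflection

theorem rad_neg (ℓ τ : ℝ) : rad ℓ (-τ) = rad ℓ τ := by simp [rad]

theorem angle_neg (ℓ τ : ℝ) : angle ℓ (-τ) = -angle ℓ τ := by
  simp only [angle, neg_div, Real.arctan_neg, neg_sq, mul_neg]
  ring

theorem primitive_zero_neg (F : ℝ → ℝ → ℂ) (ℓ τ : ℝ) :
    primitive 0 (fun ℓ τ => F ℓ (-τ)) ℓ τ = -primitive 0 F ℓ (-τ) := by
  simp only [primitive]
  rw [intervalIntegral.integral_comp_neg fun σ => F ℓ σ, neg_zero,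
    intervalIntegral.integral_symm]

/-- Each of the two integrations from `0` changes sign under `τ ↦ -τ`, and the signs cancel. This
reduces the side `τ < 0` to `τ > 0`. -/
theorem particular_reflect (h : ℝ → ℝ → ℂ) (ℓ τ : ℝ) :
    particular 0 (fun ℓ τ => h ℓ (-τ)) ℓ τ = particular 0 h ℓ (-τ) := by
  have h1 : reducedSource (fun ℓ τ => h ℓ (-τ)) = fun ℓ τ => reducedSource h ℓ (-τ) := by
    funext ℓ τ
    simp only [reducedSource, rad_neg]
  have h2 : reducedSlope 0 (fun ℓ τ => h ℓ (-τ)) =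
      fun ℓ τ => (fun ℓ τ => -reducedSlope 0 h ℓ τ) ℓ (-τ) := by
    funext ℓ τ
    simp only [reducedSlope, h1, primitive_zero_neg, neg_sq, mul_neg]
  rw [particular, h2, primitive_zero_neg fun ℓ τ => -reducedSlope 0 h ℓ τ, particular, rad_neg]
  simp [primitive]

end Reflection

section Vanishing

variable {h : ℝ → ℝ → ℂ} {c ℓ : ℝ}

theorem primitive_eq_zero {F : ℝ → ℝ → ℂ} (hF : ∀ τ, |τ| ≤ c → F ℓ τ = 0) {b τ : ℝ} (hb : |b| ≤ c)
    (hτ : |τ| ≤ c) : primitive b F ℓ τ = 0 := by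
  refine intervalIntegral.integral_zero_ae (.of_forall fun σ hσ => hF σ ?_)
  have := (ordConnected_Icc.uIcc_subset (abs_le.1 hb) (abs_le.1 hτ)) (uIoc_subset_uIcc hσ)
  exact abs_le.2 this

/-- Base points inside the interval where the integrand vanishes are interchangeable, so the
integration can start at a positive `τ`, away from the front face. -/
theorem primitive_zero_eq {F : ℝ → ℝ → ℂ} (hF : ∀ τ, |τ| ≤ c → F ℓ τ = 0) {b τ : ℝ} (hb : |b| ≤ c)
    (hi : IntervalIntegrable (F ℓ) MeasureTheory.volume b τ) :
    primitive 0 F ℓ τ = primitive b F ℓ τ := by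
  have h0 : primitive 0 F ℓ b = 0 :=
    primitive_eq_zero hF (by simpa using (abs_nonneg b).trans hb) hb
  have hi0 : IntervalIntegrable (F ℓ) MeasureTheory.volume 0 b := by
    refine (intervalIntegrable_const (c := (0 : ℂ))).congr fun σ hσ => (hF σ ?_).symm
    have := (ordConnected_Icc.uIcc_subset (abs_le.1 (show |(0 : ℝ)| ≤ c by
      simpa using (abs_nonneg b).trans hb)) (abs_le.1 hb)) (uIoc_subset_uIcc hσ)
    exact abs_le.2 this
  have := intervalIntegral.integral_add_adjacent_intervals hi0 hi
  simp only [primitive] at h0 ⊢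
  rw [← this, h0, zero_add]

theorem reducedSource_eq_zero (hv : ∀ τ, |τ| ≤ c → h ℓ τ = 0) {τ : ℝ} (hτ : |τ| ≤ c) :
    reducedSource h ℓ τ = 0 := by rw [reducedSource, hv τ hτ, mul_zero]

theorem reducedSlope_eq_zero (hv : ∀ τ, |τ| ≤ c → h ℓ τ = 0) {b τ : ℝ} (hb : |b| ≤ c)
    (hτ : |τ| ≤ c) : reducedSlope b h ℓ τ = 0 := by
  rw [reducedSlope, primitive_eq_zero (fun τ => reducedSource_eq_zero hv) hb hτ, mul_zero]

theorem particular_eq_zero (hv : ∀ τ, |τ| ≤ c → h ℓ τ = 0) {b τ : ℝ} (hb : |b| ≤ c)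
    (hτ : |τ| ≤ c) : particular b h ℓ τ = 0 := by
  rw [particular, primitive_eq_zero (fun τ => reducedSlope_eq_zero hv hb) hb hτ, mul_zero]

end Vanishing

section Smoothness

theorem add_sq_pos {ℓ : ℝ} (hℓ : 0 < ℓ) (τ : ℝ) : 0 < τ ^ 2 + ℓ ^ 2 := by positivity

theorem rad_pos {ℓ : ℝ} (hℓ : 0 < ℓ) (τ : ℝ) : 0 < rad ℓ τ := Real.sqrt_pos.2 (add_sq_pos hℓ τ)

theorem rad_sq (ℓ τ : ℝ) : rad ℓ τ ^ 2 = τ ^ 2 + ℓ ^ 2 := Real.sq_sqrt (by positivity)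

variable {ℓ₀ : ℝ} {h : ℝ → ℝ → ℂ} {S : Set (ℝ × ℝ)}

theorem contDiffOn_ofReal {f : ℝ × ℝ → ℝ} (hf : ContDiffOn ℝ ∞ f S) :
    ContDiffOn ℝ ∞ (fun p => (f p : ℂ)) S := Complex.ofRealCLM.contDiff.comp_contDiffOn hf

theorem contDiffOn_add_sq : ContDiffOn ℝ ∞ (fun p : ℝ × ℝ => p.2 ^ 2 + p.1 ^ 2) S :=
  ((contDiff_snd.pow 2).add (contDiff_fst.pow 2)).contDiffOn

theorem contDiffOn_rad (hS : ∀ p ∈ S, 0 < p.1) :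
    ContDiffOn ℝ ∞ (fun p : ℝ × ℝ => rad p.1 p.2) S :=
  contDiffOn_add_sq.sqrt fun p hp => (add_sq_pos (hS p hp) p.2).ne'

theorem contDiffOn_angle (hS : ∀ p ∈ S, 0 < p.1) :
    ContDiffOn ℝ ∞ (fun p : ℝ × ℝ => angle p.1 p.2) S := by
  refine ContDiffOn.add ?_ ?_
  · exact Real.contDiff_arctan.comp_contDiffOn
      (contDiffOn_snd.div contDiffOn_fst fun p hp => (hS p hp).ne')
  · exact (contDiffOn_fst.mul contDiffOn_snd).div contDiffOn_add_sq
      fun p hp => (add_sq_pos (hS p hp) p.2).ne'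

theorem fst_pos_of_mem {a b : ℝ} : ∀ p ∈ Ioo 0 ℓ₀ ×ˢ Icc a b, 0 < p.1 := fun _ hp => hp.1.1

theorem contDiffOn_reducedSource {a b : ℝ}
    (hh : ContDiffOn ℝ ∞ (fun p : ℝ × ℝ => h p.1 p.2) (Ioo 0 ℓ₀ ×ˢ Icc a b)) :
    ContDiffOn ℝ ∞ (fun p : ℝ × ℝ => reducedSource h p.1 p.2) (Ioo 0 ℓ₀ ×ˢ Icc a b) :=
  (contDiffOn_ofReal (contDiffOn_rad fst_pos_of_mem)).mul hh

theorem contDiffOn_reducedSlope {a b d : ℝ} (hab : a < b) (hd : d ∈ Icc a b)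
    (hh : ContDiffOn ℝ ∞ (fun p : ℝ × ℝ => h p.1 p.2) (Ioo 0 ℓ₀ ×ˢ Icc a b)) :
    ContDiffOn ℝ ∞ (fun p : ℝ × ℝ => reducedSlope d h p.1 p.2) (Ioo 0 ℓ₀ ×ˢ Icc a b) :=
  (contDiffOn_ofReal ((contDiffOn_add_sq.pow 2).inv
    fun p hp => (pow_pos (add_sq_pos (fst_pos_of_mem p hp) p.2) 2).ne')).mul
    (contDiffOn_primitive isOpen_Ioo hab hd (contDiffOn_reducedSource hh))

theorem contDiffOn_particular {a b d : ℝ} (hab : a < b) (hd : d ∈ Icc a b)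
    (hh : ContDiffOn ℝ ∞ (fun p : ℝ × ℝ => h p.1 p.2) (Ioo 0 ℓ₀ ×ˢ Icc a b)) :
    ContDiffOn ℝ ∞ (fun p : ℝ × ℝ => particular d h p.1 p.2) (Ioo 0 ℓ₀ ×ˢ Icc a b) :=
  (contDiffOn_ofReal (contDiffOn_rad fst_pos_of_mem)).neg.mul
    (contDiffOn_primitive isOpen_Ioo hab hd (contDiffOn_reducedSlope hab hd hh))

theorem angle_one_pos {ℓ : ℝ} (hℓ : 0 < ℓ) : 0 < angle ℓ 1 := by
  have := Real.arctan_pos.2 (show 0 < 1 / ℓ by positivity)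
  rw [angle]
  positivity

theorem contDiffOn_particular_right {t : ℝ} (ht : t ∈ Icc (-1 : ℝ) 1)
    (hh : ContDiffOn ℝ ∞ (fun p : ℝ × ℝ => h p.1 p.2) (Ioo 0 ℓ₀ ×ˢ Icc (-1) 1)) :
    ContDiffOn ℝ ∞ (fun ℓ => particular 0 h ℓ t) (Ioo 0 ℓ₀) :=
  (contDiffOn_particular (by norm_num) (by simp) hh).comp (f := fun x : ℝ => (x, t))
    (contDiff_prodMk_left t).contDiffOn fun _ hx => ⟨hx, ht⟩

variable {ηp ηm : ℝ → ℂ}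

theorem contDiffOn_evenCoeff (hp : ContDiffOn ℝ ∞ ηp (Ioo 0 ℓ₀)) (hm : ContDiffOn ℝ ∞ ηm (Ioo 0 ℓ₀))
    (hh : ContDiffOn ℝ ∞ (fun p : ℝ × ℝ => h p.1 p.2) (Ioo 0 ℓ₀ ×ˢ Icc (-1) 1)) :
    ContDiffOn ℝ ∞ (evenCoeff h ηp ηm) (Ioo 0 ℓ₀) := by
  have hr : ContDiffOn ℝ ∞ (fun ℓ => rad ℓ 1) (Ioo 0 ℓ₀) :=
    (contDiffOn_rad (S := Ioi 0 ×ˢ univ) fun p hp => hp.1).comp (f := fun x : ℝ => (x, 1))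
      (contDiff_prodMk_left 1).contDiffOn fun _ hx => ⟨hx.1, mem_univ _⟩
  refine ((hp.sub (contDiffOn_particular_right (by simp) hh)).add
    (hm.sub (contDiffOn_particular_right (by simp) hh))).mul
    (Complex.ofRealCLM.contDiff.comp_contDiffOn ((contDiffOn_const.mul hr).inv fun ℓ hℓ => ?_))
  exact (mul_pos two_pos (rad_pos hℓ.1 1)).ne'

theorem contDiffOn_oddCoeff (hp : ContDiffOn ℝ ∞ ηp (Ioo 0 ℓ₀)) (hm : ContDiffOn ℝ ∞ ηm (Ioo 0 ℓ₀))
    (hh : ContDiffOn ℝ ∞ (fun p : ℝ × ℝ => h p.1 p.2) (Ioo 0 ℓ₀ ×ˢ Icc (-1) 1)) :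
    ContDiffOn ℝ ∞ (oddCoeff h ηp ηm) (Ioo 0 ℓ₀) := by
  have hr : ContDiffOn ℝ ∞ (fun ℓ => rad ℓ 1) (Ioo 0 ℓ₀) :=
    (contDiffOn_rad (S := Ioi 0 ×ˢ univ) fun p hp => hp.1).comp (f := fun x : ℝ => (x, 1))
      (contDiff_prodMk_left 1).contDiffOn fun _ hx => ⟨hx.1, mem_univ _⟩
  have ha : ContDiffOn ℝ ∞ (fun ℓ => angle ℓ 1) (Ioo 0 ℓ₀) :=
    (contDiffOn_angle (S := Ioi 0 ×ˢ univ) fun p hp => hp.1).comp (f := fun x : ℝ => (x, 1))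
      (contDiff_prodMk_left 1).contDiffOn fun _ hx => ⟨hx.1, mem_univ _⟩
  refine ((hp.sub (contDiffOn_particular_right (by simp) hh)).sub
    (hm.sub (contDiffOn_particular_right (by simp) hh))).mul
    (Complex.ofRealCLM.contDiff.comp_contDiffOn
      (((contDiffOn_const.mul hr).mul ha).inv fun ℓ hℓ => ?_))
  exact (mul_pos (mul_pos two_pos (rad_pos hℓ.1 1)) (angle_one_pos hℓ.1)).ne'

theorem contDiffOn_homogeneousPart (hp : ContDiffOn ℝ ∞ ηp (Ioo 0 ℓ₀))
    (hm : ContDiffOn ℝ ∞ ηm (Ioo 0 ℓ₀))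
    (hh : ContDiffOn ℝ ∞ (fun p : ℝ × ℝ => h p.1 p.2) (Ioo 0 ℓ₀ ×ˢ Icc (-1) 1)) :
    ContDiffOn ℝ ∞ (fun p : ℝ × ℝ => homogeneousPart h ηp ηm p.1 p.2) (Ioo 0 ℓ₀ ×ˢ univ) := by
  have hS : ∀ p ∈ Ioo 0 ℓ₀ ×ˢ (univ : Set ℝ), 0 < p.1 := fun _ hp => hp.1.1
  refine ContDiffOn.add (ContDiffOn.mul ?_ ?_) (ContDiffOn.mul ?_ ?_)
  · exact (contDiffOn_evenCoeff hp hm hh).comp contDiffOn_fst fun _ hp => hp.1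
  · exact contDiffOn_ofReal (contDiffOn_rad hS)
  · exact (contDiffOn_oddCoeff hp hm hh).comp contDiffOn_fst fun _ hp => hp.1
  · exact contDiffOn_ofReal ((contDiffOn_rad hS).mul (contDiffOn_angle hS))

theorem contDiffOn_dirichletSolution (hp : ContDiffOn ℝ ∞ ηp (Ioo 0 ℓ₀))
    (hm : ContDiffOn ℝ ∞ ηm (Ioo 0 ℓ₀))
    (hh : ContDiffOn ℝ ∞ (fun p : ℝ × ℝ => h p.1 p.2) (Ioo 0 ℓ₀ ×ˢ Icc (-1) 1)) :
    ContDiffOn ℝ ∞ (fun p : ℝ × ℝ => dirichletSolution h ηp ηm p.1 p.2)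
      (Ioo 0 ℓ₀ ×ˢ Icc (-1) 1) :=
  ((contDiffOn_homogeneousPart hp hm hh).mono (prod_mono le_rfl (subset_univ _))).add
    (contDiffOn_particular (by norm_num) (by simp) hh)

end Smoothness

/-! ### Solving the equation -/

section Equation

variable {ℓ : ℝ}

theorem hasDerivAt_rad (hℓ : 0 < ℓ) (τ : ℝ) :
    HasDerivAt (fun τ => (rad ℓ τ : ℂ)) ((τ : ℂ) / (rad ℓ τ : ℂ)) τ := by
  have h1 : HasDerivAt (fun τ : ℝ => τ ^ 2 + ℓ ^ 2) (2 * τ) τ := by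
    simpa using (hasDerivAt_pow 2 τ).add_const (ℓ ^ 2)
  have h2 := (h1.sqrt (add_sq_pos hℓ τ).ne').ofReal_comp
  refine h2.congr_deriv ?_
  have := rad_pos hℓ τ
  rw [← Complex.ofReal_div]
  congr 1
  change 2 * τ / (2 * rad ℓ τ) = τ / rad ℓ τ
  field_simp

theorem hasDerivAt_angle (hℓ : 0 < ℓ) (τ : ℝ) :
    HasDerivAt (angle ℓ) (2 * ℓ ^ 3 / (τ ^ 2 + ℓ ^ 2) ^ 2) τ := by
  have hq := add_sq_pos hℓ τ
  have h1 : HasDerivAt (fun τ : ℝ => τ ^ 2 + ℓ ^ 2) (2 * τ) τ := by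
    simpa using (hasDerivAt_pow 2 τ).add_const (ℓ ^ 2)
  have h2 := ((hasDerivAt_id τ).div_const ℓ).arctan
  have h3 := ((hasDerivAt_id τ).const_mul ℓ).div h1 hq.ne'
  refine (h2.add h3).congr_deriv ?_
  have : 1 + (τ / ℓ) ^ 2 = (τ ^ 2 + ℓ ^ 2) / ℓ ^ 2 := by field_simp; ring
  simp only [id, this]
  field_simp
  ring

/-- Reduction of order: `P (R Y) = -R⁻¹ (R⁴ Y')'`, where `V` stands for `R⁴ Y'`. -/
theorem cylinderOp_rad_mul {ε : ℤˣ} (hℓ : 0 < ℓ) {U : Set ℝ} (hU : IsOpen U) {Y V g : ℝ → ℂ}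
    (hY : ∀ τ ∈ U, HasDerivAt Y (V τ / ((rad ℓ τ : ℂ) ^ 4)) τ)
    (hV : ∀ τ ∈ U, HasDerivAt V (-((rad ℓ τ : ℂ) * g τ)) τ) {τ : ℝ} (hτ : τ ∈ U) :
    cylinderOp ε ℓ 0 (fun τ => (rad ℓ τ : ℂ) * Y τ) τ = g τ := by
  have hR : ∀ τ, (rad ℓ τ : ℂ) ≠ 0 := fun τ => by exact_mod_cast (rad_pos hℓ τ).ne'
  have d1 : ∀ τ ∈ U, HasDerivAt (fun τ => (rad ℓ τ : ℂ) * Y τ)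
      ((τ : ℂ) / rad ℓ τ * Y τ + V τ / (rad ℓ τ : ℂ) ^ 3) τ := fun τ hτ =>
    ((hasDerivAt_rad hℓ τ).fun_mul (hY τ hτ)).congr_deriv (by
      have := hR τ
      field_simp)
  have e1 : deriv (fun τ => (rad ℓ τ : ℂ) * Y τ) =ᶠ[𝓝 τ]
      fun τ => (τ : ℂ) / rad ℓ τ * Y τ + V τ / (rad ℓ τ : ℂ) ^ 3 := by
    filter_upwards [hU.mem_nhds hτ] with σ hσ using (d1 σ hσ).deriv
  have d2 := ((((hasDerivAt_id τ).ofReal_comp.fun_div (hasDerivAt_rad hℓ τ) (hR τ)).fun_mul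
    (hY τ hτ)).fun_add ((hV τ hτ).fun_div ((hasDerivAt_rad hℓ τ).fun_pow 3) (pow_ne_zero 3 (hR τ))))
  have e2 : iteratedDeriv 2 (fun τ => (rad ℓ τ : ℂ) * Y τ) τ =
      deriv (deriv fun τ => (rad ℓ τ : ℂ) * Y τ) τ := by
    rw [iteratedDeriv_succ, iteratedDeriv_one]
  replace e2 := e2.trans (e1.deriv_eq.trans d2.deriv)
  rw [cylinderOp, e2, (d1 τ hτ).deriv, ← rad_sq ℓ τ]
  have := hR τ
  simp only [id, Int.cast_zero, mul_zero, add_zero]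
  push_cast
  field_simp
  ring

variable {ℓ₀ : ℝ} {h : ℝ → ℝ → ℂ} {ηp ηm : ℝ → ℂ}

theorem hasDerivAt_primitive_zero {F : ℝ → ℝ → ℂ} (hF : ContinuousOn (F ℓ) (Icc (-1) 1)) {τ : ℝ}
    (hτ : τ ∈ Ioo (-1 : ℝ) 1) : HasDerivAt (primitive 0 F ℓ) (F ℓ τ) τ := by
  have hn : Icc (-1 : ℝ) 1 ∈ 𝓝 τ := Icc_mem_nhds hτ.1 hτ.2
  refine intervalIntegral.integral_hasDerivAt_right ?_ ?_ (hF.continuousAt hn)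
  · exact (hF.mono (uIcc_subset_Icc_of_mem (by simp) (Ioo_subset_Icc_self hτ))).intervalIntegrable
  · exact hF.stronglyMeasurableAtFilter_nhdsWithin measurableSet_Icc τ |>.filter_mono
      (le_of_eq (nhdsWithin_eq_nhds.2 hn).symm)

theorem cylinderOp_dirichletSolution (ε : ℤˣ)
    (hh : ContDiffOn ℝ ∞ (fun p : ℝ × ℝ => h p.1 p.2) (Ioo 0 ℓ₀ ×ˢ Icc (-1) 1))
    (hℓ : ℓ ∈ Ioo 0 ℓ₀) {τ : ℝ} (hτ : τ ∈ Ioo (-1 : ℝ) 1) :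
    cylinderOp ε ℓ 0 (dirichletSolution h ηp ηm ℓ) τ = h ℓ τ := by
  have hs : ∀ {F : ℝ → ℝ → ℂ}, ContDiffOn ℝ ∞ (fun p : ℝ × ℝ => F p.1 p.2)
      (Ioo 0 ℓ₀ ×ˢ Icc (-1) 1) → ContinuousOn (F ℓ) (Icc (-1) 1) := fun hF =>
    continuousOn_slice hF.continuousOn fun σ hσ => ⟨hℓ, hσ⟩
  have c1 := hs (contDiffOn_reducedSource hh)
  have c2 := hs (contDiffOn_reducedSlope (d := 0) (by norm_num) (by simp) hh)
  set α := evenCoeff h ηp ηm ℓ with hα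
  set β := oddCoeff h ηp ηm ℓ with hβ
  have e : dirichletSolution h ηp ηm ℓ = fun τ => (rad ℓ τ : ℂ) *
      (α + β * (angle ℓ τ : ℂ) - primitive 0 (reducedSlope 0 h) ℓ τ) := by
    funext τ
    simp only [dirichletSolution, homogeneousPart, particular, ← hα, ← hβ]
    push_cast
    ring
  rw [e]
  -- Here `R⁴ angle' = 2ℓ³`, so `β * angle` adds a constant to `V`; the rest of `V` comes from the
  -- inner integral of the particular solution.
  refine cylinderOp_rad_mul hℓ.1 isOpen_Ioo
    (V := fun τ => β * (2 * ℓ ^ 3 : ℝ) - primitive 0 (reducedSource h) ℓ τ) ?_ ?_ hτ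
  · intro τ hτ
    refine (((hasDerivAt_angle hℓ.1 τ).ofReal_comp.const_mul β).const_add α).fun_sub
      (hasDerivAt_primitive_zero c2 hτ) |>.congr_deriv ?_
    have hR : (rad ℓ τ : ℂ) ≠ 0 := by exact_mod_cast (rad_pos hℓ.1 τ).ne'
    rw [reducedSlope, ← rad_sq ℓ τ]
    push_cast
    field_simp
  · intro τ hτ
    refine ((hasDerivAt_primitive_zero c1 hτ).const_sub _).congr_deriv ?_
    rw [reducedSource]

theorem isDirichletSolution_dirichletSolution (ε : ℤˣ) (hp : ContDiffOn ℝ ∞ ηp (Ioo 0 ℓ₀))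
    (hm : ContDiffOn ℝ ∞ ηm (Ioo 0 ℓ₀))
    (hh : ContDiffOn ℝ ∞ (fun p : ℝ × ℝ => h p.1 p.2) (Ioo 0 ℓ₀ ×ˢ Icc (-1) 1))
    (hℓ : ℓ ∈ Ioo 0 ℓ₀) :
    IsDirichletSolution ε ℓ 0 (h ℓ) (ηp ℓ) (ηm ℓ) (dirichletSolution h ηp ηm ℓ) := by
  have hs : ContDiffOn ℝ ∞ (dirichletSolution h ηp ηm ℓ) (Icc (-1) 1) :=
    (contDiffOn_dirichletSolution hp hm hh).comp (f := fun t : ℝ => (ℓ, t))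
      (contDiff_prodMk_right ℓ).contDiffOn fun t ht => ⟨hℓ, ht⟩
  have hR : (rad ℓ 1 : ℂ) ≠ 0 := by exact_mod_cast (rad_pos hℓ.1 1).ne'
  have hA : (angle ℓ 1 : ℂ) ≠ 0 := by exact_mod_cast (angle_one_pos hℓ.1).ne'
  refine ⟨hs.continuousOn, (hs.mono Ioo_subset_Icc_self).of_le two_le_infty,
    fun τ hτ => cylinderOp_dirichletSolution ε hh hℓ hτ, ?_, ?_⟩
  · simp only [dirichletSolution, homogeneousPart, evenCoeff, oddCoeff]
    push_cast
    field_simp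
    ring
  · simp only [dirichletSolution, homogeneousPart, evenCoeff, oddCoeff, rad_neg, angle_neg]
    push_cast
    field_simp
    ring

end Equation

/-! ### Uniqueness -/

section Uniqueness

/-- The maximum principle. -/
theorem nonpos_of_deriv_eq {f q p v : ℝ → ℝ} (hc : ContinuousOn f (Icc (-1) 1))
    (hq : ∀ τ, 0 < q τ) (hv : ∀ τ, 0 < v τ)
    (he : ∀ τ ∈ Ioo (-1 : ℝ) 1, q τ * deriv (deriv f) τ + p τ * deriv f τ = v τ * f τ)
    (h1 : f 1 = 0) (h2 : f (-1) = 0) {τ : ℝ} (hτ : τ ∈ Icc (-1 : ℝ) 1) : f τ ≤ 0 := by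
  obtain ⟨m, hm, hmax⟩ := isCompact_Icc.exists_isMaxOn (nonempty_Icc.2 (by norm_num)) hc
  refine (hmax hτ).trans (not_lt.1 fun (hpos : 0 < f m) => ?_)
  have hm1 : m ≠ 1 := fun h => by rw [h, h1] at hpos; exact lt_irrefl _ hpos
  have hm2 : m ≠ -1 := fun h => by rw [h, h2] at hpos; exact lt_irrefl _ hpos
  have hmo : m ∈ Ioo (-1 : ℝ) 1 := ⟨lt_of_le_of_ne hm.1 hm2.symm, lt_of_le_of_ne hm.2 hm1⟩
  have hn : Icc (-1 : ℝ) 1 ∈ 𝓝 m := Icc_mem_nhds hmo.1 hmo.2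
  have hlm : IsLocalMax f m := hmax.isLocalMax hn
  have hd := hlm.deriv_eq_zero
  have hdd : 0 < deriv (deriv f) m := by
    have := he m hmo
    rw [hd, mul_zero, add_zero] at this
    exact (mul_pos_iff_of_pos_left (hq m)).1 (this ▸ mul_pos (hv m) hpos)
  -- At a positive interior maximum the equation forces a positive second derivative. The point is
  -- then also a local minimum, so `f` is locally constant, contradicting that positivity.
  have hmin := isLocalMin_of_deriv_deriv_pos hdd hd (hc.continuousAt hn)
  have hconst : f =ᶠ[𝓝 m] fun _ => f m := by
    filter_upwards [hlm, hmin] with σ hσ hσ' using le_antisymm hσ hσ'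
  have h0 : deriv f =ᶠ[𝓝 m] fun _ => 0 := hconst.deriv.trans (by simp)
  rw [h0.deriv_eq] at hdd
  simp at hdd

/-- The operator has real coefficients, so the maximum principle applies to any real linear
functional of the difference; the functionals `±re` and `±im` suffice. -/
theorem IsDirichletSolution.eqOn {ε : ℤˣ} {ℓ : ℝ} (hℓ : 0 < ℓ) {h : ℝ → ℂ} {a b : ℂ} {u w : ℝ → ℂ}
    (hu : IsDirichletSolution ε ℓ 0 h a b u) (hw : IsDirichletSolution ε ℓ 0 h a b w) :
    EqOn w u (Icc (-1) 1) := by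
  have key : ∀ L : ℂ →L[ℝ] ℝ, ∀ τ ∈ Icc (-1 : ℝ) 1, L (w τ - u τ) ≤ 0 := by
    intro L τ hτ
    have hD : ContDiffOn ℝ 2 (fun τ => w τ - u τ) (Ioo (-1) 1) := hw.contDiffOn.sub hu.contDiffOn
    have d1 : ∀ {v : ℝ → ℂ}, ContDiffOn ℝ 2 v (Ioo (-1) 1) → ∀ τ ∈ Ioo (-1 : ℝ) 1,
        HasDerivAt v (deriv v τ) τ := fun hv τ hτ =>
      ((hv.contDiffAt (isOpen_Ioo.mem_nhds hτ)).differentiableAt (by simp)).hasDerivAt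
    have d2 : ∀ {v : ℝ → ℂ}, ContDiffOn ℝ 2 v (Ioo (-1) 1) → ∀ τ ∈ Ioo (-1 : ℝ) 1,
        HasDerivAt (deriv v) (iteratedDeriv 2 v τ) τ := fun hv τ hτ => by
      rw [iteratedDeriv_succ, iteratedDeriv_one]
      exact (((hv.deriv_of_isOpen isOpen_Ioo (m := 1) (by rw [one_add_one_eq_two])).contDiffAt
        (isOpen_Ioo.mem_nhds hτ)).differentiableAt (by simp)).hasDerivAt
    have e1 : ∀ τ ∈ Ioo (-1 : ℝ) 1, deriv (fun τ => L (w τ - u τ)) τ =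
        L (deriv w τ - deriv u τ) := fun τ hτ =>
      (L.hasFDerivAt.comp_hasDerivAt τ
        ((d1 hw.contDiffOn τ hτ).fun_sub (d1 hu.contDiffOn τ hτ))).deriv
    have e2 : ∀ τ ∈ Ioo (-1 : ℝ) 1, deriv (deriv fun τ => L (w τ - u τ)) τ =
        L (iteratedDeriv 2 w τ - iteratedDeriv 2 u τ) := fun τ hτ => by
      have : deriv (fun τ => L (w τ - u τ)) =ᶠ[𝓝 τ] fun τ => L (deriv w τ - deriv u τ) := by
        filter_upwards [isOpen_Ioo.mem_nhds hτ] with σ hσ using e1 σ hσ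
      rw [this.deriv_eq]
      exact (L.hasFDerivAt.comp_hasDerivAt τ
        ((d2 hw.contDiffOn τ hτ).fun_sub (d2 hu.contDiffOn τ hτ))).deriv
    refine nonpos_of_deriv_eq (f := fun τ => L (w τ - u τ)) (q := fun τ => τ ^ 2 + ℓ ^ 2)
      (p := fun τ => 2 * τ) (v := fun τ => 1 + τ ^ 2 / (τ ^ 2 + ℓ ^ 2))
      (L.continuous.comp_continuousOn (hw.continuousOn.sub hu.continuousOn))
      (fun τ => add_sq_pos hℓ τ) (fun τ => by positivity) (fun τ hτ => ?_) ?_ ?_ hτ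
    · have hc := (hw.equation τ hτ).trans (hu.equation τ hτ).symm
      simp only [cylinderOp, Int.cast_zero, mul_zero, add_zero] at hc
      rw [e1 τ hτ, e2 τ hτ]
      simp only [← smul_eq_mul, ← map_smul, ← map_add]
      congr 1
      simp only [smul_eq_mul, Complex.real_smul]
      linear_combination -hc
    · simp only [hw.right_value, hu.right_value, sub_self, map_zero]
    · simp only [hw.left_value, hu.left_value, sub_self, map_zero]
  intro τ hτ
  have h1 := key Complex.reCLM τ hτ
  have h2 := key (-Complex.reCLM) τ hτ
  have h3 := key Complex.imCLM τ hτ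
  have h4 := key (-Complex.imCLM) τ hτ
  simp only [neg_apply, Complex.reCLM_apply, Complex.imCLM_apply, Complex.sub_re,
    Complex.sub_im] at h1 h2 h3 h4
  exact Complex.ext (by linarith) (by linarith)

end Uniqueness

/-! ### The coordinate changes of the blowup -/

section Scales

/-- This scale gives `s = ℓ / t` and is bounded only for `t > a > 0`; the scales `t` and `sin χ`
below give `ℓ = s t` and `ℓ = ρ sin χ` on whole faces. -/
theorem isScale_inv {a : ℝ} (ha : 0 < a) : IsScale (Ioo a 1) id (fun t => t⁻¹) fun _ => -1 := by
  refine ⟨contDiff_id.contDiffOn.inv fun t ht => (ha.trans ht.1).ne',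
    fun t ht => inv_pos.2 (ha.trans ht.1), ⟨a⁻¹, inv_pos.2 ha, fun t ht => ?_⟩,
    ⟨1, one_pos, fun t ht => ?_⟩, fun t ht => ?_, conormal_const isOpen_Ioo _⟩
  · exact inv_anti₀ ha ht.1.le
  · rw [one_mul]
    exact ht.2.le.trans ((one_le_inv₀ (ha.trans ht.1)).2 ht.2.le)
  · have : (t : ℂ) ≠ 0 := by exact_mod_cast (ha.trans ht.1).ne'
    rw [deriv_inv]
    push_cast
    simp only [id]
    field_simp

theorem isScale_id {a : ℝ} (ha : 0 ≤ a) : IsScale (Ioo a 1) id id fun _ => 1 :=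
  ⟨contDiff_id.contDiffOn, fun _ ht => ha.trans_lt ht.1, ⟨1, one_pos, fun _ ht => ht.2.le⟩,
    ⟨1, one_pos, fun _ _ => (one_mul _).ge⟩, fun t _ => by simp, conormal_const isOpen_Ioo _⟩

theorem isFace_sin : IsFace (Ioo 0 Real.pi) Real.sin :=
  ⟨isOpen_Ioo, Real.contDiff_sin.contDiffOn, fun _ hy => Real.sin_pos_of_mem_Ioo hy,
    fun y _ => Real.sin_le_one y⟩

theorem isScale_sin : IsScale (Ioo 0 Real.pi) Real.sin Real.sin fun χ => (Real.cos χ : ℂ) :=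
  ⟨Real.contDiff_sin.contDiffOn, fun _ hy => Real.sin_pos_of_mem_Ioo hy,
    ⟨1, one_pos, fun y _ => Real.sin_le_one y⟩, ⟨1, one_pos, fun _ _ => (one_mul _).ge⟩,
    fun y _ => by rw [Real.deriv_sin], conormal_of_contDiffOn_Icc Real.pi_pos
      Real.contDiff_sin.contDiffOn
      (Complex.ofRealCLM.contDiff.comp Real.contDiff_cos).contDiffOn⟩

end Scales

section Analytic

theorem analyticAt_ofReal_comp {f : ℝ → ℝ} (hf : ContDiffAt ℝ ω f 0) :
    AnalyticAt ℝ (fun x => (f x : ℂ)) 0 :=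
  (Complex.ofRealCLM.contDiff.contDiffAt.comp 0 hf).analyticAt

theorem contDiffAt_sqrt_one_add_sq : ContDiffAt ℝ ω (fun s : ℝ => √(1 + s ^ 2)) 0 :=
  ContDiffAt.sqrt (by fun_prop) (by norm_num)

theorem contDiffAt_inv_one_add_sq_sq : ContDiffAt ℝ ω (fun s : ℝ => ((1 + s ^ 2) ^ 2)⁻¹) 0 :=
  ContDiffAt.inv (by fun_prop) (by norm_num)

/-- The function `angle ℓ τ` in terms of `s = ℓ / τ`, `τ > 0`. -/
noncomputable def sideAngle (s : ℝ) : ℝ := Real.pi / 2 - Real.arctan s + s / (1 + s ^ 2)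

/-- The function `angle ℓ τ` in terms of the polar angle. -/
noncomputable def frontAngle (χ : ℝ) : ℝ := Real.pi / 2 - χ + Real.sin χ * Real.cos χ

theorem contDiffAt_sideAngle : ContDiffAt ℝ ω sideAngle 0 := by
  refine (contDiffAt_const.sub Real.contDiff_arctan.contDiffAt).add (contDiffAt_id.div ?_ ?_)
  · fun_prop
  · norm_num

theorem contDiff_frontAngle {n : WithTop ℕ∞} : ContDiff ℝ n frontAngle :=
  (contDiff_const.sub contDiff_id).add (Real.contDiff_sin.mul Real.contDiff_cos)

theorem rad_mul {s t : ℝ} (ht : 0 < t) : rad (s * t) t = t * √(1 + s ^ 2) := by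
  have : t ^ 2 + (s * t) ^ 2 = t ^ 2 * (1 + s ^ 2) := by ring
  rw [rad, this, Real.sqrt_mul (sq_nonneg t), Real.sqrt_sq ht.le]

/-- The identity `arctan (1 / s) = π / 2 - arctan s` for `s > 0` exhibits the analytic continuation
across `s = 0`. -/
theorem angle_mul {s t : ℝ} (hs : 0 < s) (ht : 0 < t) : angle (s * t) t = sideAngle s := by
  have h1 : t / (s * t) = s⁻¹ := by field_simp
  have h2 : s * t * t / (t ^ 2 + (s * t) ^ 2) = s / (1 + s ^ 2) := by
    have : t ^ 2 + (s * t) ^ 2 = t ^ 2 * (1 + s ^ 2) := by ring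
    rw [this]
    field_simp
  rw [angle, h1, h2, Real.arctan_inv_of_pos hs, sideAngle]

theorem rad_polar {ρ : ℝ} (hρ : 0 < ρ) (χ : ℝ) : rad (ρ * Real.sin χ) (ρ * Real.cos χ) = ρ := by
  have : (ρ * Real.cos χ) ^ 2 + (ρ * Real.sin χ) ^ 2 = ρ ^ 2 := by
    linear_combination ρ ^ 2 * Real.sin_sq_add_cos_sq χ
  rw [rad, this, Real.sqrt_sq hρ.le]

theorem angle_polar {ρ χ : ℝ} (hρ : 0 < ρ) (hχ : χ ∈ Ioo 0 Real.pi) :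
    angle (ρ * Real.sin χ) (ρ * Real.cos χ) = frontAngle χ := by
  have hs := Real.sin_pos_of_mem_Ioo hχ
  have h1 : ρ * Real.cos χ / (ρ * Real.sin χ) = Real.tan (Real.pi / 2 - χ) := by
    rw [Real.tan_eq_sin_div_cos, Real.sin_pi_div_two_sub, Real.cos_pi_div_two_sub,
      mul_div_mul_left _ _ hρ.ne']
  have h2 : (ρ * Real.cos χ) ^ 2 + (ρ * Real.sin χ) ^ 2 = ρ ^ 2 := by
    linear_combination ρ ^ 2 * Real.sin_sq_add_cos_sq χ
  rw [angle, h1, h2, Real.arctan_tan (by linarith [hχ.2]) (by linarith [hχ.1]), frontAngle]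
  field_simp

end Analytic

/-! ### The particular solution for `τ` bounded away from `0` -/

section Interior

variable {E E' : IndexSet} {a : ℝ} {F G : ℝ → ℝ → ℂ} {I : Set ℝ} {r : ℝ → ℝ}

theorem HasExp.mul_const (hf : IsFace I r) (h : HasExp E I r constFunctions F)
    (h' : HasExp natIndex I r constFunctions G) : HasExp E I r constFunctions (F * G) :=
  h.mul hf h' (fun _ hq _ hq' => E.add_natIndex hq hq') <| by
    rintro _ ⟨c, rfl⟩ _ ⟨d, rfl⟩
    exact ⟨c * d, rfl⟩

theorem HasExp.mul_smoothIcc (ha : 0 < a) (h : HasExp E (Ioo a 1) id (smoothIcc a 1) F)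
    (h' : HasExp natIndex (Ioo a 1) id (smoothIcc a 1) G) :
    HasExp E (Ioo a 1) id (smoothIcc a 1) (F * G) :=
  h.mul (isFace_Ioo ha le_rfl) h' (fun _ hq _ hq' => E.add_natIndex hq hq')
    fun _ hb _ hb' => ContDiffOn.mul hb hb'

/-- Covers `rad` and the factor `(t² + ℓ²)⁻²`: both are homogeneous, hence a power of `t` times an
analytic function of `ℓ / t`. -/
theorem hasExp_homogeneous (ha : 0 < a) (ha1 : a < 1) {g p : ℝ → ℂ} (hg : AnalyticAt ℝ g 0)
    (hp : p ∈ smoothIcc a 1) :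
    HasExp natIndex (Ioo a 1) id (smoothIcc a 1) fun ℓ t => g (ℓ * t⁻¹) * p t := by
  have hf := isFace_Ioo ha le_rfl
  have h1 : HasExp natIndex (Ioo a 1) id (smoothIcc a 1) fun ℓ t => g (ℓ * t⁻¹) := by
    refine (hasExp_of_analyticAt hf hg).comp_scale hf (isScale_inv ha) ?_
    rintro _ ⟨c, rfl⟩ z j _ d
    refine (contDiffOn_const.mul ((contDiffOn_phgTerm _).comp ?_ fun t ht => ?_)).mul
      contDiffOn_const
    · exact contDiff_id.contDiffOn.inv fun t ht => (ha.trans_le ht.1).ne'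
    · exact inv_pos.2 (ha.trans_le ht.1)
  refine h1.mul_smoothIcc ha (HasExp.mono (hasExp_snd hf (conormal_of_smoothIcc ha1 hp)) le_rfl ?_)
  exact singleton_subset_iff.2 hp

theorem hasExp_rad (ha : 0 < a) (ha1 : a < 1) {c : ℂ} :
    HasExp natIndex (Ioo a 1) id (smoothIcc a 1) fun ℓ t => (rad ℓ t : ℂ) * c := by
  refine (hasExp_homogeneous ha ha1 (p := fun t => (t : ℂ) * c)
    (analyticAt_ofReal_comp contDiffAt_sqrt_one_add_sq)
    (Complex.ofRealCLM.contDiff.contDiffOn.mul contDiffOn_const)).congr (isFace_Ioo ha le_rfl)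
    (.of_forall fun ℓ t ht => ?_)
  have ht0 := ha.trans ht.1
  have e := rad_mul (s := ℓ * t⁻¹) ht0
  rw [inv_mul_cancel_right₀ ht0.ne'] at e
  beta_reduce
  rw [e]
  push_cast
  ring

theorem hasExp_inv_sq (ha : 0 < a) (ha1 : a < 1) :
    HasExp natIndex (Ioo a 1) id (smoothIcc a 1)
      fun ℓ t => ((((t ^ 2 + ℓ ^ 2) ^ 2)⁻¹ : ℝ) : ℂ) := by
  refine (hasExp_homogeneous ha ha1 (p := fun t => (((t ^ 4)⁻¹ : ℝ) : ℂ))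
    (analyticAt_ofReal_comp contDiffAt_inv_one_add_sq_sq) ?_).congr (isFace_Ioo ha le_rfl)
    (.of_forall fun ℓ t ht => ?_)
  · exact Complex.ofRealCLM.contDiff.comp_contDiffOn
      ((contDiff_id.pow 4).contDiffOn.inv fun t ht => (pow_pos (ha.trans_le ht.1) 4).ne')
  · have ht0 := ha.trans ht.1
    beta_reduce
    rw [← Complex.ofReal_mul, ← mul_inv]
    congr 2
    field_simp

variable {h : ℝ → ℝ → ℂ} {ℓ₀ c : ℝ}

theorem contDiffOn_mono_Icc (ha : 0 < a)
    (hh : ContDiffOn ℝ ∞ (fun p : ℝ × ℝ => h p.1 p.2) (Ioo 0 ℓ₀ ×ˢ Icc (-1) 1)) :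
    ContDiffOn ℝ ∞ (fun p : ℝ × ℝ => h p.1 p.2) (Ioo 0 ℓ₀ ×ˢ Icc a 1) :=
  hh.mono (prod_mono le_rfl (Icc_subset_Icc_left (by linarith)))

/-- The expansion in `s` is restricted to `t > a` and rescaled by `s = ℓ / t`, becoming an expansion
in `ℓ` at fixed `t`, the form needed for integration in `t`. -/
theorem hasExp_source (ha : 0 < a) (ha1 : a < 1) (hℓ₀ : 0 < ℓ₀)
    (hh : ContDiffOn ℝ ∞ (fun p : ℝ × ℝ => h p.1 p.2) (Ioo 0 ℓ₀ ×ˢ Icc (-1) 1))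
    (hE : HasPhgExpansionAtFace E (Ioo 0 1) id (sideFacePhg E') fun s t => h (s * t) t) :
    HasExp E (Ioo a 1) id (smoothIcc a 1) h := by
  have hf := isFace_Ioo ha le_rfl
  have hc : ∀ b ∈ sideFacePhg E', b ∈ smoothIcc a 1 := fun b hb =>
    hb.1.mono fun t ht => ⟨ha.trans_le ht.1, ht.2⟩
  have h1 : SmoothNear (Ioo a 1) fun s t => h (s * t) t := by
    refine (isScale_id ha.le).smoothNear_comp (F := h) ⟨ℓ₀, hℓ₀, hh.mono (prod_mono le_rfl ?_)⟩
    exact fun t ht => ⟨by linarith [ht.1], ht.2.le⟩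
  have h2 : HasExp E (Ioo a 1) id (sideFacePhg E') fun s t => h (s * t) t :=
    HasExp.of_hasPhgExpansionAtFace hf (Ioo_subset_Ioo_left ha.le) hE h1 fun b hb =>
      conormal_of_smoothIcc ha1 (hc b hb)
  refine (h2.comp_scale (A' := smoothIcc a 1) hf (isScale_inv ha) ?_).congr hf
    (.of_forall fun ℓ t ht => ?_)
  · intro b hb z j _ d
    refine (contDiffOn_const.mul ((contDiffOn_phgTerm _).comp ?_ fun t ht => ?_)).mul (hc b hb)
    · exact contDiff_id.contDiffOn.inv fun t ht => (ha.trans_le ht.1).ne'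
    · exact inv_pos.2 (ha.trans_le ht.1)
  · beta_reduce
    rw [inv_mul_cancel_right₀ (ha.trans ht.1).ne']

theorem hasExp_reducedSlope (ha : 0 < a) (ha1 : a < 1) (hℓ₀ : 0 < ℓ₀)
    (hh : ContDiffOn ℝ ∞ (fun p : ℝ × ℝ => h p.1 p.2) (Ioo 0 ℓ₀ ×ˢ Icc (-1) 1))
    (hE : HasPhgExpansionAtFace E (Ioo 0 1) id (sideFacePhg E') fun s t => h (s * t) t) :
    HasExp E (Ioo a 1) id (smoothIcc a 1) (reducedSlope a h) := by
  have hf := isFace_Ioo ha le_rfl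
  have h1 := contDiffOn_mono_Icc ha hh
  have h2 : HasExp E (Ioo a 1) id (smoothIcc a 1) (reducedSource h) :=
    ((hasExp_source ha ha1 hℓ₀ hh hE).mul_smoothIcc ha (hasExp_rad ha ha1 (c := 1))).congr hf
      (.of_forall fun ℓ t _ => by simp only [Pi.mul_apply, reducedSource]; ring)
  exact ((h2.primitive ha ha1 le_rfl hℓ₀ (contDiffOn_reducedSource h1)).mul_smoothIcc ha
    (hasExp_inv_sq ha ha1)).congr hf
    (.of_forall fun ℓ t _ => by simp only [Pi.mul_apply, reducedSlope]; ring)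

theorem hasExp_particular (ha : 0 < a) (ha1 : a < 1) (hℓ₀ : 0 < ℓ₀)
    (hh : ContDiffOn ℝ ∞ (fun p : ℝ × ℝ => h p.1 p.2) (Ioo 0 ℓ₀ ×ˢ Icc (-1) 1))
    (hE : HasPhgExpansionAtFace E (Ioo 0 1) id (sideFacePhg E') fun s t => h (s * t) t) :
    HasExp E (Ioo a 1) id (smoothIcc a 1) (particular a h) := by
  refine (((hasExp_reducedSlope ha ha1 hℓ₀ hh hE).primitive ha ha1 le_rfl hℓ₀
    (contDiffOn_reducedSlope ha1 (left_mem_Icc.2 ha1.le) (contDiffOn_mono_Icc ha hh))).mul_smoothIcc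
    ha (hasExp_rad ha ha1 (c := -1))).congr (isFace_Ioo ha le_rfl) (.of_forall fun ℓ t _ => ?_)
  simp only [Pi.mul_apply, particular]
  ring

theorem hasExp_particular_one (ha : 0 < a) (ha1 : a < 1) (hℓ₀ : 0 < ℓ₀)
    (hh : ContDiffOn ℝ ∞ (fun p : ℝ × ℝ => h p.1 p.2) (Ioo 0 ℓ₀ ×ˢ Icc (-1) 1))
    (hE : HasPhgExpansionAtFace E (Ioo 0 1) id (sideFacePhg E') fun s t => h (s * t) t) :
    HasExp E (Ioo a 1) id constFunctions fun ℓ _ => particular a h ℓ 1 := by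
  have hf := isFace_Ioo ha le_rfl
  refine (((hasExp_reducedSlope ha ha1 hℓ₀ hh hE).integral ha ha1 le_rfl hℓ₀
    (contDiffOn_reducedSlope ha1 (left_mem_Icc.2 ha1.le) (contDiffOn_mono_Icc ha hh))).mul_const hf
    (hasExp_of_analyticAt hf (analyticAt_ofReal_comp contDiffAt_sqrt_one_add_sq).neg)).congr hf
    (.of_forall fun ℓ t _ => ?_)
  simp only [Pi.mul_apply, Pi.neg_apply, particular, rad, one_pow]
  ring

theorem particular_zero_eq (ha : 0 < a) (hac : a ≤ c) {ℓ : ℝ} (hℓ : ℓ ∈ Ioo 0 ℓ₀)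
    (hh : ContDiffOn ℝ ∞ (fun p : ℝ × ℝ => h p.1 p.2) (Ioo 0 ℓ₀ ×ˢ Icc (-1) 1))
    (hv : ∀ τ, |τ| ≤ c → h ℓ τ = 0) {t : ℝ} (ht : t ∈ Icc a 1) :
    particular 0 h ℓ t = particular a h ℓ t := by
  have hab : |a| ≤ c := by rwa [abs_of_pos ha]
  have h0 : |(0 : ℝ)| ≤ c := by simpa using ha.le.trans hac
  have hs : ∀ {F : ℝ → ℝ → ℂ}, ContDiffOn ℝ ∞ (fun p : ℝ × ℝ => F p.1 p.2)
      (Ioo 0 ℓ₀ ×ˢ Icc (-1) 1) → ∀ {σ}, σ ∈ Icc a 1 →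
        IntervalIntegrable (F ℓ) MeasureTheory.volume a σ := fun hF σ hσ =>
    (continuousOn_slice hF.continuousOn fun s hs => ⟨hℓ, by
      have := uIcc_subset_Icc_of_mem (left_mem_Icc.2 (hσ.1.trans hσ.2)) hσ hs
      exact ⟨by linarith [this.1], this.2⟩⟩).intervalIntegrable
  have h1 : ∀ σ ∈ Icc a 1, reducedSlope 0 h ℓ σ = reducedSlope a h ℓ σ := fun σ hσ => by
    rw [reducedSlope, reducedSlope, primitive_zero_eq (fun τ => reducedSource_eq_zero hv) hab
      (hs (contDiffOn_reducedSource hh) hσ)]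
  rw [particular, particular, primitive_zero_eq (fun τ => reducedSlope_eq_zero hv h0) hab
    (hs (contDiffOn_reducedSlope (by norm_num) (by simp) hh) ht)]
  congr 1
  refine intervalIntegral.integral_congr fun σ hσ => h1 σ ?_
  exact uIcc_subset_Icc_of_mem (left_mem_Icc.2 (ht.1.trans ht.2)) ht hσ

end Interior

/-! ### Extension by zero to the whole side face -/

section Cutoff

variable {a c : ℝ}

/-- A smooth function that vanishes for `t ≤ a` and equals `1` for `t ≥ c`. -/
noncomputable def cutoff (a c t : ℝ) : ℂ := (Real.smoothTransition ((t - a) / (c - a)) : ℂ)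

theorem contDiff_cutoff : ContDiff ℝ ∞ (cutoff a c) :=
  Complex.ofRealCLM.contDiff.comp (Real.smoothTransition.contDiff.comp
    ((contDiff_id.sub contDiff_const).div_const _))

theorem cutoff_of_le (hac : a < c) {t : ℝ} (ht : t ≤ a) : cutoff a c t = 0 := by
  rw [cutoff, Real.smoothTransition.zero_of_nonpos, Complex.ofReal_zero]
  exact div_nonpos_of_nonpos_of_nonneg (sub_nonpos.2 ht) (sub_pos.2 hac).le

theorem cutoff_of_ge (hac : a < c) {t : ℝ} (ht : c ≤ t) : cutoff a c t = 1 := by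
  rw [cutoff, Real.smoothTransition.one_of_one_le, Complex.ofReal_one]
  rw [one_le_div (sub_pos.2 hac)]
  linarith

/-- Extension by zero of a function on `(a, 1)` after multiplication with a cutoff function. -/
noncomputable def extendZero (a b c : ℝ) (g : ℝ → ℂ) (t : ℝ) : ℂ :=
  open Classical in if a < t then cutoff b c t * g t else 0

variable {b : ℝ} {E E' : IndexSet} {F : ℝ → ℝ → ℂ}

theorem extendZero_of_le (hbc : b < c) {g : ℝ → ℂ} {t : ℝ} (ht : t ≤ b) :
    extendZero a b c g t = 0 := by
  rw [extendZero, cutoff_of_le hbc ht, zero_mul, ite_self]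

theorem extendZero_of_gt {g : ℝ → ℂ} {t : ℝ} (ht : a < t) :
    extendZero a b c g t = cutoff b c t * g t := if_pos ht

/-- The extension vanishes for `t ≤ b`, so its expansion at the corner is zero and any index set is
allowed there. On the other part the cutoff and `g` are smooth up to `t = 1`. -/
theorem extendZero_mem_sideFacePhg (ha : 0 < a) (hab : a < b) (hbc : b < c) {g : ℝ → ℂ}
    (hg : g ∈ smoothIcc a 1) : extendZero a b c g ∈ sideFacePhg E := by
  constructor
  · intro t ht
    rcases lt_or_ge t b with h | h
    · have : extendZero a b c g =ᶠ[𝓝[Ioc 0 1] t] fun _ => 0 := by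
        filter_upwards [mem_nhdsWithin_of_mem_nhds (Iio_mem_nhds h)] with σ hσ
        exact extendZero_of_le hbc (le_of_lt hσ)
      exact contDiffWithinAt_const.congr_of_eventuallyEq this (extendZero_of_le hbc h.le)
    · have hat := hab.trans_le h
      have hI : Ioi a ∈ 𝓝[Ioc 0 1] t := mem_nhdsWithin_of_mem_nhds (Ioi_mem_nhds hat)
      have : extendZero a b c g =ᶠ[𝓝[Ioc 0 1] t] fun t => cutoff b c t * g t := by
        filter_upwards [hI] with σ hσ using extendZero_of_gt hσ
      refine ContDiffWithinAt.congr_of_eventuallyEq ?_ this (extendZero_of_gt hat)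
      have h1 : ContDiffWithinAt ℝ ∞ g (Icc a 1) t := hg t ⟨hat.le, ht.2⟩
      refine contDiff_cutoff.contDiffWithinAt.mul (h1.mono_of_mem_nhdsWithin ?_)
      filter_upwards [hI, self_mem_nhdsWithin] with σ hσ hσ' using ⟨le_of_lt hσ, hσ'.2⟩
  · refine ⟨fun _ => 0, fun N i => ⟨0, b, ha.trans hab, fun x hx => ?_⟩⟩
    have key : ∀ (i : ℕ) (f : ℝ → ℂ), (∀ x ∈ Ioo 0 b, f x = 0) →
        ∀ x ∈ Ioo 0 b, (bDeriv id)^[i] f x = 0 := by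
      intro i
      induction i with
      | zero => exact fun f hf => hf
      | succ i ih =>
        refine fun f hf => ih _ fun x hx => ?_
        have : f =ᶠ[𝓝 x] fun _ => 0 := by
          filter_upwards [isOpen_Ioo.mem_nhds hx] with σ hσ using hf σ hσ
        simp [bDeriv, this.deriv_eq]
    rw [key i _ (fun x hx => ?_) x hx]
    · simp
    · simp [extendZero_of_le hbc hx.2.le]

theorem Ioo_eq_union (ha : 0 < a) (hab : a < b) (hb1 : b < 1) :
    Ioo (0 : ℝ) 1 = Ioo 0 b ∪ Ioo a 1 :=
  (Ioo_union_Ioo' hab (zero_lt_one)).trans (by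
    rw [min_eq_left ha.le, max_eq_right hb1.le]) |>.symm

/-- Since `F` vanishes for `t ≤ c` and the cutoff is `1` for `t ≥ c`, `F` equals its product with
the cutoff. Multiplying the whole expansion by the cutoff makes coefficients and remainders vanish
on the overlap `(a, b)` and glue with zero. -/
theorem HasExp.extend (ha : 0 < a) (hab : a < b) (hbc : b < c) (hc1 : c < 1)
    (h : HasExp E (Ioo a 1) id (smoothIcc a 1) F)
    (hF : ∀ᶠ x in 𝓝[>] (0 : ℝ), ∀ t ∈ Ioc 0 c, F x t = 0) :
    HasExp E (Ioo 0 1) id (sideFacePhg E') F := by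
  have hf := isFace_Ioo ha le_rfl
  have hunion := Ioo_eq_union ha hab (hbc.trans hc1)
  have hglue : ∀ {N : ℝ} {M : ℕ} {G : ℝ → ℝ → ℂ}, EqNear (Ioo 0 b) (fun _ _ => 0) G →
      Conormal (Ioo a 1) id (wt id N M) G → Conormal (Ioo 0 1) id (wt id N M) G := by
    intro N M G h0 hG
    rw [hunion]
    refine Conormal.union isOpen_Ioo isOpen_Ioo ?_
      ((conormal_zero isOpen_Ioo).congr isOpen_Ioo h0) hG
    rw [← hunion]
    filter_upwards [eventually_pos_lt one_pos] with x hx y hy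
    exact isFace_Ioo_one.wt_nonneg hx.1 hy
  have hcut : Conormal (Ioo a 1) id (fun _ _ => 1) fun _ t => cutoff b c t :=
    conormal_of_contDiffOn_Icc (hab.trans (hbc.trans hc1)) contDiff_id.contDiffOn
      contDiff_cutoff.contDiffOn
  obtain ⟨ι, q, g, M, hq, hfin, hA, hg, hN⟩ := h
  refine ⟨ι, q, fun k => extendZero a b c (g k), M, hq, hfin,
    fun k => extendZero_mem_sideFacePhg ha hab hbc (hA k), fun k => ?_, fun N => ?_⟩
  · refine hglue (.of_forall fun x t ht => (extendZero_of_le hbc ht.2.le).symm) ?_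
    refine ((hg k).mul_bounded hf hcut).congr isOpen_Ioo (.of_forall fun x t ht => ?_)
    beta_reduce
    rw [extendZero_of_gt ht.1, Pi.mul_apply, Pi.mul_apply, mul_comm]
  · obtain ⟨S, hS, hR⟩ := hN N
    refine ⟨S, hS, hglue ?_ ?_⟩
    · filter_upwards [hF] with x hx t ht
      rw [hx t ⟨ht.1, (ht.2.trans hbc).le⟩, Finset.sum_eq_zero, sub_zero]
      intro k _
      rw [extendZero_of_le hbc ht.2.le, mul_zero]
    · refine (hR.mul_bounded hf hcut).congr isOpen_Ioo ?_
      filter_upwards [hF] with x hx t ht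
      have e1 : F x t * cutoff b c t = F x t := by
        rcases le_or_gt t c with h | h
        · rw [hx t ⟨ha.trans ht.1, h⟩, zero_mul]
        · rw [cutoff_of_ge hbc h.le, mul_one]
      have e2 : ∀ k, phgTerm (q k) x * extendZero a b c (g k) t =
          phgTerm (q k) x * g k t * cutoff b c t := fun k => by
        rw [extendZero_of_gt ht.1]
        ring
      simp only [Pi.mul_apply, e2, ← Finset.sum_mul, sub_mul, e1]

end Cutoff

/-! ### Lifting functions of `ℓ` to the faces -/

section Faces

variable {E E' : IndexSet} {I : Set ℝ} {r : ℝ → ℝ} {A : Set (ℝ → ℂ)}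

theorem nonempty_Ioo_one : (Ioo (0 : ℝ) 1).Nonempty := nonempty_Ioo.2 one_pos

theorem HasPhgExpansionAtZero.add {g g' : ℝ → ℂ} (h : HasPhgExpansionAtZero E g)
    (h' : HasPhgExpansionAtZero E g') {δ : ℝ} (hδ : 0 < δ) (hg : ContDiffOn ℝ ∞ g (Ioo 0 δ))
    (hg' : ContDiffOn ℝ ∞ g' (Ioo 0 δ)) : HasPhgExpansionAtZero E fun x => g x + g' x :=
  ((h.hasExp isFace_Ioo_one hδ hg).add isFace_Ioo_one (h'.hasExp isFace_Ioo_one hδ hg')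
    ).hasPhgExpansionAtZero isFace_Ioo_one nonempty_Ioo_one

theorem hasPhgExpansionAtZero_zero : HasPhgExpansionAtZero E fun _ => 0 := by
  refine HasExp.hasPhgExpansionAtZero isFace_Ioo_one nonempty_Ioo_one
    ⟨Empty, Empty.elim, Empty.elim, 0, fun k => k.elim, fun C => toFinite _, fun k => k.elim,
      fun k => k.elim, fun N => ⟨∅, fun k => k.elim, ?_⟩⟩
  simpa using conormal_zero isOpen_Ioo

theorem zero_mem_sideFacePhg : (fun _ => 0) ∈ sideFacePhg E :=
  ⟨contDiffOn_const, hasPhgExpansionAtZero_zero⟩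

theorem add_mem_sideFacePhg {b b' : ℝ → ℂ} (h : b ∈ sideFacePhg E) (h' : b' ∈ sideFacePhg E) :
    (fun t => b t + b' t) ∈ sideFacePhg E :=
  ⟨h.1.add h'.1, h.2.add h'.2 one_pos (h.1.mono Ioo_subset_Ioc_self)
    (h'.1.mono Ioo_subset_Ioc_self)⟩

theorem zero_mem_frontFacePhg : (fun _ => 0) ∈ frontFacePhg E E' :=
  ⟨contDiffOn_const, hasPhgExpansionAtZero_zero, hasPhgExpansionAtZero_zero⟩

theorem ContDiffOn.comp_pi_sub {b : ℝ → ℂ} (h : ContDiffOn ℝ ∞ b (Ioo 0 Real.pi)) :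
    ContDiffOn ℝ ∞ (fun x => b (Real.pi - x)) (Ioo 0 Real.pi) :=
  h.comp (contDiff_const.sub contDiff_id).contDiffOn fun x hx =>
    ⟨by simpa using hx.2, by simpa using hx.1⟩

theorem add_mem_frontFacePhg {b b' : ℝ → ℂ} (h : b ∈ frontFacePhg E E')
    (h' : b' ∈ frontFacePhg E E') : (fun t => b t + b' t) ∈ frontFacePhg E E' :=
  ⟨h.1.add h'.1, h.2.1.add h'.2.1 Real.pi_pos h.1 h'.1,
    h.2.2.add h'.2.2 Real.pi_pos h.1.comp_pi_sub h'.1.comp_pi_sub⟩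

theorem HasExp.sum (hf : IsFace I r) {ι : Type*} (S : Finset ι) {F : ι → ℝ → ℝ → ℂ}
    (h : ∀ k ∈ S, HasExp E I r A (F k)) : HasExp E I r A (fun x y => ∑ k ∈ S, F k x y) := by
  classical
  induction S using Finset.induction_on with
  | empty =>
    refine ⟨Empty, Empty.elim, Empty.elim, 0, fun k => k.elim, fun C => toFinite _, fun k => k.elim,
      fun k => k.elim, fun N => ⟨∅, fun k => k.elim, ?_⟩⟩
    simpa using conormal_zero hf.isOpen
  | insert k S hk ih =>
    simp only [Finset.sum_insert hk]
    exact (h k (Finset.mem_insert_self k S)).add hf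
      (ih fun l hl => h l (Finset.mem_insert_of_mem hl))

theorem hasExp_term_const (hf : IsFace I r) {q : ℂ × ℕ} (hq : q ∈ E.carrier) (c : ℂ) :
    HasExp E I r constFunctions fun x _ => phgTerm q x * c :=
  (hasExp_term hf hq (hf.conormal_const_wt c 0)).mono le_rfl (singleton_subset_iff.2 ⟨c, rfl⟩)

theorem mem_sideFacePhg {z : ℂ} {j : ℕ} (hq : (z, j) ∈ E.carrier) (c : ℂ) :
    (fun t : ℝ => c * phgTerm (z, j) t * (t : ℂ)) ∈ sideFacePhg E := by
  constructor
  · exact (contDiffOn_const.mul ((contDiffOn_phgTerm _).mono fun t ht => ht.1)).mul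
      Complex.ofRealCLM.contDiff.contDiffOn
  · refine ((hasExp_term_const isFace_Ioo_one (E.add_one _ _ hq) c).congr isFace_Ioo_one
      (G := fun t _ => c * phgTerm (z, j) t * (t : ℂ)) ?_).hasPhgExpansionAtZero isFace_Ioo_one
      nonempty_Ioo_one
    filter_upwards [eventually_pos_lt one_pos] with t ht y _
    have h1 := phgTerm_add (z, j) (1, 0) ht.1
    have h2 := phgTerm_natCast 1 t
    rw [Nat.cast_one, pow_one] at h2
    rw [Prod.mk_add_mk, add_zero, h2] at h1
    rw [h1]
    ring

/-- Pulling back along `ℓ = s t` gives coefficients `t ^ z (log t) ^ j`. The factor `t` from `rad`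
shifts `z` by one within `E`, and the analytic factor in `s` contributes only integer powers. -/
theorem HasPhgExpansionAtZero.hasExp_side {g f : ℝ → ℂ} (h : HasPhgExpansionAtZero E g) {δ : ℝ}
    (hδ : 0 < δ) (hg : ContDiffOn ℝ ∞ g (Ioo 0 δ)) (hfa : AnalyticAt ℝ f 0) :
    HasExp E (Ioo 0 1) id (sideFacePhg E) fun s t => g (s * t) * (t : ℂ) * f s := by
  have hf := isFace_Ioo_one
  have h1 := (h.hasExp hf hδ hg).comp_scale hf (isScale_id le_rfl)
    (A' := {b | ∃ z j, (z, j) ∈ E.carrier ∧ ∃ c : ℂ, b = fun t : ℝ => c * phgTerm (z, j) t}) <| by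
    rintro _ ⟨c, rfl⟩ z j hq d
    exact ⟨z, j, hq, d * c, by funext t; simp only [id]; ring⟩
  have ht : HasExp natIndex (Ioo 0 1) id {fun t : ℝ => (t : ℂ)} fun _ t => (t : ℂ) := by
    refine hasExp_snd hf (M := 0) ?_
    have e : (fun _ _ => 1) = wt id 0 0 := by funext x y; simp [wt]
    rw [← e]
    exact conormal_of_contDiffOn_Icc one_pos contDiff_id.contDiffOn
      Complex.ofRealCLM.contDiff.contDiffOn
  have h2 := h1.mul hf ht (E'' := E) (fun _ hq _ hq' => E.add_natIndex hq hq')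
    (A'' := {b | ∃ z j, (z, j) ∈ E.carrier ∧ ∃ c : ℂ,
      b = fun t : ℝ => c * phgTerm (z, j) t * (t : ℂ)}) <| by
    rintro _ ⟨z, j, hq, c, rfl⟩ _ rfl
    exact ⟨z, j, hq, c, rfl⟩
  refine h2.mul hf (hasExp_of_analyticAt hf hfa) (fun _ hq _ hq' => E.add_natIndex hq hq') ?_
  rintro _ ⟨z, j, hq, c, rfl⟩ _ ⟨d, rfl⟩
  have := mem_sideFacePhg hq (c * d)
  convert this using 2
  ring

theorem analyticAt_sinc : AnalyticAt ℝ Real.sinc 0 := by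
  obtain ⟨p, hp⟩ := (Real.contDiff_sin (n := ω)).contDiffAt.analyticAt (x := (0 : ℝ))
  rw [Real.sinc_eq_dslope]
  exact ⟨_, hp.has_fpower_series_dslope_fslope⟩

/-- As `sinc 0 = 1`, the logarithm of `sinc` is analytic at `0`. -/
theorem analyticAt_phgTerm_sinc (z : ℂ) (k : ℕ) :
    AnalyticAt ℝ (fun x => phgTerm (z, k) (Real.sinc x)) 0 := by
  have hpos : ∀ᶠ x in 𝓝 (0 : ℝ), 0 < Real.sinc x :=
    analyticAt_sinc.continuousAt.eventually (lt_mem_nhds (by simp))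
  have hl : ContDiffAt ℝ ω (fun x => (Real.log (Real.sinc x) : ℂ)) 0 :=
    Complex.ofRealCLM.contDiff.contDiffAt.comp 0 (analyticAt_sinc.contDiffAt.log (by simp))
  have h1 : ContDiffAt ℝ ω (fun x => Complex.exp (z * (Real.log (Real.sinc x) : ℂ)) *
      (Real.log (Real.sinc x) : ℂ) ^ k) 0 :=
    (Complex.contDiff_exp.contDiffAt.comp 0 (contDiffAt_const.mul hl)).mul (hl.pow k)
  refine (h1.congr_of_eventuallyEq ?_).analyticAt
  filter_upwards [hpos] with x hx using phgTerm_eq_exp _ hx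

/-- Factor `sin x = x * sinc x` and split the term binomially; everything in `sinc x` is analytic at
the corner. -/
theorem hasPhgExpansionAtZero_sin {q : ℂ × ℕ} (hq : q ∈ E.carrier) {θ : ℝ → ℂ}
    (hθ : AnalyticAt ℝ θ 0) : HasPhgExpansionAtZero E fun x => phgTerm q (Real.sin x) * θ x := by
  obtain ⟨z, p⟩ := q
  have hf := isFace_Ioo_one
  have h1 : ∀ i ∈ (Finset.univ : Finset (Fin (p + 1))), HasExp E (Ioo 0 1) id constFunctions
      fun x _ => phgTerm (z, i) x * 1 *
        ((p.choose i : ℂ) * phgTerm (z, p - i) (Real.sinc x) * θ x) := fun i _ =>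
    (hasExp_term_const hf (E.lower_log _ _ _ hq (Nat.lt_succ_iff.1 i.2)) 1).mul_const hf
      (hasExp_of_analyticAt hf ((analyticAt_const.mul (analyticAt_phgTerm_sinc z _)).mul hθ))
  refine ((HasExp.sum hf _ h1).congr hf (G := fun x _ => phgTerm (z, p) (Real.sin x) * θ x)
    ?_).hasPhgExpansionAtZero hf nonempty_Ioo_one
  filter_upwards [eventually_pos_lt Real.pi_pos] with x hx y _
  have hs : Real.sinc x = Real.sin x / x := Real.sinc_of_ne_zero hx.1.ne'
  have hp : 0 < Real.sinc x := hs ▸ div_pos (Real.sin_pos_of_mem_Ioo hx) hx.1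
  have e : Real.sin x = x * Real.sinc x := by
    rw [hs, mul_div_cancel₀ _ hx.1.ne']
  rw [e, phgTerm_mul z p hx.1 hp, Finset.sum_mul]
  refine Finset.sum_congr rfl fun i _ => ?_
  ring

theorem mem_frontFacePhg {q : ℂ × ℕ} (hq : q ∈ E.carrier) {θ : ℝ → ℂ} (hθ : ContDiff ℝ ω θ) :
    (fun χ => phgTerm q (Real.sin χ) * θ χ) ∈ frontFacePhg E E := by
  refine ⟨?_, hasPhgExpansionAtZero_sin hq hθ.contDiffAt.analyticAt, ?_⟩
  · exact (isScale_sin.contDiffOn_phgTerm q).mul (hθ.of_le (by simp)).contDiffOn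
  · have h1 : AnalyticAt ℝ (fun x => θ (Real.pi - x)) 0 :=
      (hθ.comp (contDiff_const.sub contDiff_id)).contDiffAt.analyticAt
    simpa only [Real.sin_pi_sub] using hasPhgExpansionAtZero_sin hq h1

/-- The pullback along `ℓ = ρ sin χ` has coefficients `(sin χ) ^ z (log sin χ) ^ j`, which expand
over the same `E` at both corners since `sin (π - χ) = sin χ`. The factor `ρ` is the value of `rad`.
-/
theorem HasPhgExpansionAtZero.hasExp_front {g θ : ℝ → ℂ} (h : HasPhgExpansionAtZero E g) {δ : ℝ}
    (hδ : 0 < δ) (hg : ContDiffOn ℝ ∞ g (Ioo 0 δ)) (hθ : ContDiff ℝ ω θ) :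
    HasExp E (Ioo 0 Real.pi) Real.sin (frontFacePhg E E)
      fun ρ χ => g (ρ * Real.sin χ) * ((ρ : ℂ) * θ χ) := by
  have hf := isFace_sin
  have h1 := (h.hasExp hf hδ hg).comp_scale hf isScale_sin
    (A' := {b | ∃ q ∈ E.carrier, ∃ c : ℂ, b = fun χ : ℝ => c * phgTerm q (Real.sin χ)}) <| by
    rintro _ ⟨c, rfl⟩ z j hq d
    exact ⟨(z, j), hq, d * c, by funext t; ring⟩
  have h2 : HasExp natIndex (Ioo 0 Real.pi) Real.sin {θ} fun ρ χ => phgTerm (1, 0) ρ * θ χ := by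
    refine hasExp_term hf (E := natIndex) (q := (1, 0)) ⟨rfl, 1, by simp⟩ (M := 0) ?_
    have e : (fun _ _ => 1) = wt Real.sin 0 0 := by funext x y; simp [wt]
    rw [← e]
    exact conormal_of_contDiffOn_Icc Real.pi_pos Real.contDiff_sin.contDiffOn
      (hθ.of_le (by simp)).contDiffOn
  refine (h1.mul hf h2 (fun _ hq _ hq' => E.add_natIndex hq hq') ?_).congr hf
    (.of_forall fun ρ χ _ => ?_)
  · rintro _ ⟨q, hq, c, rfl⟩ _ rfl
    have := mem_frontFacePhg hq (contDiff_const.mul hθ (f := fun _ => c))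
    convert this using 2
    ring
  · have e := phgTerm_natCast 1 ρ
    rw [Nat.cast_one, pow_one] at e
    simp only [Pi.mul_apply, e]

end Faces

/-! ### Assembly of the proof -/

/-- The union of two index sets. -/
def IndexSet.union (E E' : IndexSet) : IndexSet where
  carrier := E.carrier ∪ E'.carrier
  finite_le C := ((E.finite_le C).union (E'.finite_le C)).subset fun _ hq =>
    hq.1.elim (fun h => .inl ⟨h, hq.2⟩) fun h => .inr ⟨h, hq.2⟩
  lower_log z p q h hq :=
    h.elim (fun h => .inl (E.lower_log z p q h hq)) fun h => .inr (E'.lower_log z p q h hq)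
  add_one z p h := h.elim (fun h => .inl (E.add_one z p h)) fun h => .inr (E'.add_one z p h)

section Assembly

variable {E E' : IndexSet} {ℓ₀ c : ℝ} {h : ℝ → ℝ → ℂ} {ηp ηm : ℝ → ℂ}

theorem contDiffOn_reflect
    (hh : ContDiffOn ℝ ∞ (fun p : ℝ × ℝ => h p.1 p.2) (Ioo 0 ℓ₀ ×ˢ Icc (-1) 1)) :
    ContDiffOn ℝ ∞ (fun p : ℝ × ℝ => h p.1 (-p.2)) (Ioo 0 ℓ₀ ×ˢ Icc (-1) 1) :=
  hh.comp (f := fun p : ℝ × ℝ => (p.1, -p.2)) (contDiff_fst.prodMk contDiff_snd.neg).contDiffOn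
    fun p hp => ⟨hp.1, by linarith [hp.2.2], by linarith [hp.2.1]⟩

theorem hasExp_particular_zero_one (hc₀ : 0 < c) (hc₁ : c < 1) (hℓ₀ : 0 < ℓ₀)
    (hh : ContDiffOn ℝ ∞ (fun p : ℝ × ℝ => h p.1 p.2) (Ioo 0 ℓ₀ ×ˢ Icc (-1) 1))
    (hv : ∀ ℓ ∈ Ioo 0 ℓ₀, ∀ τ : ℝ, |τ| ≤ c → h ℓ τ = 0)
    (hE : HasPhgExpansionAtFace E (Ioo 0 1) id (sideFacePhg E') fun s t => h (s * t) t) :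
    HasExp E (Ioo c 1) id constFunctions fun ℓ _ => particular 0 h ℓ 1 := by
  refine (hasExp_particular_one hc₀ hc₁ hℓ₀ hh hE).congr (isFace_Ioo hc₀ le_rfl) ?_
  filter_upwards [eventually_pos_lt hℓ₀] with ℓ hℓ t _
  exact (particular_zero_eq hc₀ le_rfl hℓ hh (hv ℓ hℓ) (right_mem_Icc.2 hc₁.le)).symm

theorem hasExp_particular_side (hc₀ : 0 < c) (hc₁ : c < 1) (hℓ₀ : 0 < ℓ₀)
    (hh : ContDiffOn ℝ ∞ (fun p : ℝ × ℝ => h p.1 p.2) (Ioo 0 ℓ₀ ×ˢ Icc (-1) 1))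
    (hv : ∀ ℓ ∈ Ioo 0 ℓ₀, ∀ τ : ℝ, |τ| ≤ c → h ℓ τ = 0)
    (hE : HasPhgExpansionAtFace E (Ioo 0 1) id (sideFacePhg E') fun s t => h (s * t) t)
    (E'' : IndexSet) :
    HasExp E (Ioo 0 1) id (sideFacePhg E'') fun s t => particular 0 h (s * t) t := by
  -- The thresholds `c / 3 < c / 2 < c` leave room for the cutoff inside the region where the
  -- particular solution vanishes.
  have ha : 0 < c / 3 := by positivity
  have hf := isFace_Ioo ha (le_refl (1 : ℝ))
  have h1 : HasExp E (Ioo (c / 3) 1) id (smoothIcc (c / 3) 1)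
      fun s t => particular (c / 3) h (s * t) t := by
    refine (hasExp_particular ha (by linarith) hℓ₀ hh hE).comp_scale hf (isScale_id ha.le) ?_
    intro b hb z j _ d
    exact (contDiffOn_const.mul ((contDiffOn_phgTerm _).mono
      fun t ht => ha.trans_le ht.1)).mul hb
  refine HasExp.extend ha (b := c / 2) (c := c) (by linarith) (by linarith) hc₁
    (h1.congr hf ?_) ?_
  · filter_upwards [eventually_pos_lt hℓ₀] with s hs t ht
    have ht0 := ha.trans ht.1
    have hst : s * t ∈ Ioo 0 ℓ₀ :=
      ⟨mul_pos hs.1 ht0, (mul_le_of_le_one_right hs.1.le ht.2.le).trans_lt hs.2⟩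
    exact (particular_zero_eq ha (by linarith) hst hh (hv _ hst) (Ioo_subset_Icc_self ht)).symm
  · filter_upwards [eventually_pos_lt hℓ₀] with s hs t ht
    have hst : s * t ∈ Ioo 0 ℓ₀ :=
      ⟨mul_pos hs.1 ht.1, (mul_le_of_le_one_right hs.1.le (ht.2.trans hc₁.le)).trans_lt hs.2⟩
    exact particular_eq_zero (hv _ hst) (by simpa using hc₀.le) (by rw [abs_of_pos ht.1]; exact ht.2)

/-- The denominators `2 √(1 + ℓ²)` and `2 √(1 + ℓ²) * sideAngle ℓ` are analytic and nonzero at `ℓ =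
0`, because `sideAngle 0 = π / 2`. So dividing by them does not enlarge the index set. -/
theorem hasPhgExpansionAtZero_coeffs (hc₀ : 0 < c) (hc₁ : c < 1)
    (hp : HasExp E (Ioo c 1) id constFunctions fun ℓ _ => ηp ℓ)
    (hm : HasExp E (Ioo c 1) id constFunctions fun ℓ _ => ηm ℓ)
    (hp' : HasExp E (Ioo c 1) id constFunctions fun ℓ _ => particular 0 h ℓ 1)
    (hm' : HasExp E (Ioo c 1) id constFunctions fun ℓ _ => particular 0 h ℓ (-1)) :
    HasPhgExpansionAtZero E (evenCoeff h ηp ηm) ∧ HasPhgExpansionAtZero E (oddCoeff h ηp ηm) := by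
  have hf := isFace_Ioo hc₀ (le_refl (1 : ℝ))
  have hI : (Ioo c 1).Nonempty := nonempty_Ioo.2 hc₁
  have hneg : HasExp natIndex (Ioo c 1) id constFunctions fun _ _ => (-1 : ℂ) :=
    hasExp_of_analyticAt hf (f := fun _ => -1) analyticAt_const
  have hx := hp.add hf (hp'.mul_const hf hneg)
  have hy := hm.add hf (hm'.mul_const hf hneg)
  have hs0 : √(1 + (0 : ℝ) ^ 2) ≠ 0 := by norm_num
  have ha0 : sideAngle 0 ≠ 0 := by simp [sideAngle, Real.pi_ne_zero]
  have hrad := contDiffAt_const (c := (2 : ℝ)).mul contDiffAt_sqrt_one_add_sq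
  have hr1 : ∀ ℓ : ℝ, rad ℓ 1 = √(1 + ℓ ^ 2) := fun ℓ => by rw [rad, one_pow]
  constructor
  · refine (((hx.add hf hy).mul_const hf (hasExp_of_analyticAt hf (analyticAt_ofReal_comp
      (hrad.inv (mul_ne_zero two_ne_zero hs0))))).congr hf
      (G := fun ℓ _ => evenCoeff h ηp ηm ℓ) (.of_forall fun ℓ t _ => ?_)).hasPhgExpansionAtZero hf hI
    simp only [Pi.mul_apply, Pi.add_apply, Pi.inv_apply, evenCoeff, hr1]
    ring
  · refine (((hx.add hf (hy.mul_const hf hneg)).mul_const hf (hasExp_of_analyticAt hf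
      (analyticAt_ofReal_comp ((hrad.mul contDiffAt_sideAngle).inv
        (mul_ne_zero (mul_ne_zero two_ne_zero hs0) ha0))))).congr hf
      (G := fun ℓ _ => oddCoeff h ηp ηm ℓ) ?_).hasPhgExpansionAtZero hf hI
    filter_upwards [eventually_pos_lt one_pos] with ℓ hℓ t _
    have e := angle_mul hℓ.1 one_pos
    rw [mul_one] at e
    simp only [Pi.mul_apply, Pi.add_apply, Pi.inv_apply, oddCoeff, hr1, e]
    ring

theorem hasExp_homogeneousPart_front (hℓ₀ : 0 < ℓ₀)
    (he : HasPhgExpansionAtZero E (evenCoeff h ηp ηm))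
    (ho : HasPhgExpansionAtZero E (oddCoeff h ηp ηm))
    (hes : ContDiffOn ℝ ∞ (evenCoeff h ηp ηm) (Ioo 0 ℓ₀))
    (hos : ContDiffOn ℝ ∞ (oddCoeff h ηp ηm) (Ioo 0 ℓ₀)) :
    HasExp E (Ioo 0 Real.pi) Real.sin (frontFacePhg E E)
      fun ρ χ => homogeneousPart h ηp ηm (ρ * Real.sin χ) (ρ * Real.cos χ) := by
  refine ((he.hasExp_front hℓ₀ hes (θ := fun _ => 1) contDiff_const).add isFace_sin
    (ho.hasExp_front hℓ₀ hos (θ := fun χ => (frontAngle χ : ℂ))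
      (Complex.ofRealCLM.contDiff.comp contDiff_frontAngle))).congr isFace_sin ?_
  filter_upwards [eventually_pos_lt one_pos] with ρ hρ χ hχ
  simp only [Pi.add_apply, homogeneousPart, rad_polar hρ.1, angle_polar hρ.1 hχ]
  push_cast
  ring

/-- The factor `κ = ±1` treats both side faces at once, `rad` being even and `angle` odd in `τ`. -/
theorem hasExp_homogeneousPart_side (hℓ₀ : 0 < ℓ₀)
    (he : HasPhgExpansionAtZero E (evenCoeff h ηp ηm))
    (ho : HasPhgExpansionAtZero E (oddCoeff h ηp ηm))
    (hes : ContDiffOn ℝ ∞ (evenCoeff h ηp ηm) (Ioo 0 ℓ₀))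
    (hos : ContDiffOn ℝ ∞ (oddCoeff h ηp ηm) (Ioo 0 ℓ₀)) (κ : ℝ) :
    HasExp E (Ioo 0 1) id (sideFacePhg E) fun s t => evenCoeff h ηp ηm (s * t) *
      (rad (s * t) t : ℂ) + oddCoeff h ηp ηm (s * t) * ((rad (s * t) t * (κ * angle (s * t) t) : ℝ) : ℂ) := by
  have hf := isFace_Ioo_one
  refine ((he.hasExp_side hℓ₀ hes (analyticAt_ofReal_comp contDiffAt_sqrt_one_add_sq)).add hf
    (ho.hasExp_side hℓ₀ hos (analyticAt_ofReal_comp (contDiffAt_sqrt_one_add_sq.mul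
      ((contDiffAt_const (c := κ)).mul contDiffAt_sideAngle))))).congr hf ?_
  filter_upwards [eventually_pos_lt one_pos] with s hs t ht
  simp only [Pi.add_apply, rad_mul ht.1, angle_mul hs.1 ht.1]
  push_cast
  ring

end Assembly

theorem mainTheorem5 (ℓ₀ : ℝ) (hℓ₀ : 0 < ℓ₀) (c : ℝ) (hc₀ : 0 < c) (hc₁ : c < 1) (ε : ℤˣ)
    (h : ℝ → ℝ → ℂ) (hphg : IsPolyhomogeneousOnBlowup ℓ₀ h)
    (hvanish : ∀ ℓ ∈ Ioo 0 ℓ₀, ∀ τ : ℝ, |τ| ≤ c → h ℓ τ = 0)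
    (ηp ηm : ℝ → ℂ) (hηp : IsPolyhomogeneousInLength ℓ₀ ηp)
    (hηm : IsPolyhomogeneousInLength ℓ₀ ηm) :
    ∃ u : ℝ → ℝ → ℂ,
      (∀ ℓ ∈ Ioo 0 ℓ₀, IsDirichletSolution ε ℓ 0 (h ℓ) (ηp ℓ) (ηm ℓ) (u ℓ) ∧
        ∀ w : ℝ → ℂ, IsDirichletSolution ε ℓ 0 (h ℓ) (ηp ℓ) (ηm ℓ) w →
          EqOn w (u ℓ) (Icc (-1) 1)) ∧
      IsPolyhomogeneousOnBlowup ℓ₀ u := by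
  obtain ⟨hh, Ef, E₁, E₂, -, hE₁, hE₂⟩ := hphg
  obtain ⟨hps, E₃, hE₃⟩ := hηp
  obtain ⟨hms, E₄, hE₄⟩ := hηm
  have hh' := contDiffOn_reflect hh
  have hv' : ∀ ℓ ∈ Ioo 0 ℓ₀, ∀ τ : ℝ, |τ| ≤ c → h ℓ (-τ) = 0 := fun ℓ hℓ τ hτ =>
    hvanish ℓ hℓ (-τ) (by rwa [abs_neg])
  -- The coefficients mix the expansions of `h` at both sides with those of `ηp` and `ηm`, so the
  -- union of the four index sets is used at every face.
  obtain ⟨E, h₁, h₂, h₃, h₄⟩ : ∃ E : IndexSet, E₁.carrier ⊆ E.carrier ∧ E₂.carrier ⊆ E.carrier ∧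
      E₃.carrier ⊆ E.carrier ∧ E₄.carrier ⊆ E.carrier :=
    ⟨(E₁.union E₂).union (E₃.union E₄), fun _ hq => .inl (.inl hq), fun _ hq => .inl (.inr hq),
      fun _ hq => .inr (.inl hq), fun _ hq => .inr (.inr hq)⟩
  have hf := isFace_Ioo hc₀ (le_refl (1 : ℝ))
  obtain ⟨he, ho⟩ := hasPhgExpansionAtZero_coeffs hc₀ hc₁
    ((hE₃.hasExp hf hℓ₀ hps).mono h₃ le_rfl) ((hE₄.hasExp hf hℓ₀ hms).mono h₄ le_rfl)
    ((hasExp_particular_zero_one hc₀ hc₁ hℓ₀ hh hvanish hE₁).mono h₁ le_rfl)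
    (by simpa only [particular_reflect] using
      (hasExp_particular_zero_one (h := fun ℓ τ => h ℓ (-τ)) hc₀ hc₁ hℓ₀ hh' hv' hE₂).mono h₂ le_rfl)
  have hes := contDiffOn_evenCoeff hps hms hh
  have hos := contDiffOn_oddCoeff hps hms hh
  refine ⟨dirichletSolution h ηp ηm, fun ℓ hℓ => ?_, contDiffOn_dirichletSolution hps hms hh,
    E, E, E, ?_, ?_, ?_⟩
  · have hs := isDirichletSolution_dirichletSolution ε hps hms hh hℓ
    exact ⟨hs, fun w hw => hs.eqOn hℓ.1 hw⟩
  · refine ((hasExp_homogeneousPart_front hℓ₀ he ho hes hos).congr isFace_sin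
      ?_).hasPhgExpansionAtFace isFace_sin zero_mem_frontFacePhg
      fun _ hb _ hb' => add_mem_frontFacePhg hb hb'
    -- For `ρ < c` one has `|τ| ≤ c`, so the particular solution is absent near the front face.
    filter_upwards [eventually_pos_lt (lt_min hℓ₀ hc₀)] with ρ hρ χ hχ
    have hs := Real.sin_pos_of_mem_Ioo hχ
    have hℓ : ρ * Real.sin χ ∈ Ioo 0 ℓ₀ := ⟨mul_pos hρ.1 hs,
      (mul_le_of_le_one_right hρ.1.le (Real.sin_le_one χ)).trans_lt
        (hρ.2.trans_le (min_le_left _ _))⟩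
    have hτ : |ρ * Real.cos χ| ≤ c := by
      rw [abs_mul, abs_of_pos hρ.1]
      exact (mul_le_of_le_one_right hρ.1.le (Real.abs_cos_le_one χ)).trans
        (hρ.2.le.trans (min_le_right _ _))
    rw [dirichletSolution, particular_eq_zero (hvanish _ hℓ) (by simpa using hc₀.le) hτ, add_zero]
  · refine (((hasExp_homogeneousPart_side hℓ₀ he ho hes hos 1).add isFace_Ioo_one
      ((hasExp_particular_side hc₀ hc₁ hℓ₀ hh hvanish hE₁ E).mono h₁ le_rfl)).congr isFace_Ioo_one
      (.of_forall fun s t _ => ?_)).hasPhgExpansionAtFace isFace_Ioo_one zero_mem_sideFacePhg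
      fun _ hb _ hb' => add_mem_sideFacePhg hb hb'
    simp only [Pi.add_apply, dirichletSolution, homogeneousPart, one_mul]
  · refine (((hasExp_homogeneousPart_side hℓ₀ he ho hes hos (-1)).add isFace_Ioo_one
      ((hasExp_particular_side (h := fun ℓ τ => h ℓ (-τ)) hc₀ hc₁ hℓ₀ hh' hv' hE₂ E).mono h₂
        le_rfl)).congr isFace_Ioo_one (.of_forall fun s t _ => ?_)).hasPhgExpansionAtFace
      isFace_Ioo_one zero_mem_sideFacePhg fun _ hb _ hb' => add_mem_sideFacePhg hb hb'
    simp only [Pi.add_apply, dirichletSolution, homogeneousPart, particular_reflect, rad_neg,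
      angle_neg, neg_one_mul]
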